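/- Let $\tau:\mathbb N=\{0,1,2,\dots\}\to\mathbb R_+$ be non-decreasing, with $\tau(0)=0$, $\tau(k)>0$ for all $k\ge 1$, and at most polynomial growth at infinity. For $a>0$ set $Z_a=\sum_{k\ge0}\frac{a^k}{\prod_{i=1}^k\tau(i)}$, let $a^*=\sup\{a>0:Z_a<\infty\}\in(0,\infty]$, and for $a\in(0,a^*)$ let $\nu_a(k)=\frac1{Z_a}\frac{a^k}{\prod_{i=1}^k\tau(i)}$, $k\in\mathbb N$, and $R(a)=\sum_k k\,\nu_a(k)$. Let $R^*=\lim_{a\uparrow a^*}R(a)$ and let $\Phi:(0,R^*)\to(0,a^*)$ be the inverse of $R$. Fix $\overline n\in(0,R^*)$, put $a=\Phi(\overline n)$ and $$\overline\tau=\mathbb E_{\nu_a}[\tau(n)],\quad \rho=\mathrm{Cov}_{\nu_a}(n,\tau(n)),\quad \alpha=\mathrm{Var}_{\nu_a}(n),\quad \gamma=\mathrm{Var}_{\nu_a}(\tau(n)).$$ For $N\ge1$ let $m_N$ be the invariant (reversible) probability measure of the zero-range process with jump rate $\tau$ on $\{1,\dots,N\}$ with $\lfloor N\overline n\rfloor$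 particles, that is, the probability measure on the set of configurations $n=(n(1),\dots,n(N))\in\mathbb N^N$ with $\sum_i n(i)=\lfloor N\overline n\rfloor$ under which $n$ has probability proportional to $\prod_{i=1}^N\prod_{j=1}^{n(i)}\tau(j)^{-1}$. For $x\in[0,1]$ let $$u_N(x)=\frac1{\sqrt N}\sum_{k=1}^{\lfloor xN\rfloor}(n(k)-\overline n),\qquad q_N(x)=\frac1{\sqrt N}\sum_{k=1}^{\lfloor xN\rfloor}(\tau(n(k))-\overline\tau).$$ Then there is a centered Gaussian process $(\beta(x),\zeta(x))_{0\le x\le1}$ with values in $\mathbb R^2$ and continuous sample paths such that for all $s,t\in[0,1]$ $$\mathrm{Cov}(\beta(s),\beta(t))=\alpha\min(s,t)(1-\max(s,t)),\qquad \mathrm{Cov}(\zeta(s),\zeta(t))=\gamma\min(s,t)-\frac{\rho^2}{\alpha}st,$$ $$\mathrm{Cov}(\beta(s),\zeta(t))=\rho\min(s,t)(1-\max(s,t)),$$ and, as $N\to\infty$, the pair $(u_N,q_N)$ under $m_N$ converges in law to $(\beta,\zeta)$ for the topology of uniform convergence on $[0,1]$ (that is, $m_N[F(u_N,q_N)]\to\mathbb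 E[F(\beta,\zeta)]$ for every bounded function $F$ of paths $[0,1]\to\mathbb R^2$ that is continuous for uniform convergence). In addition, for all real $p\ge1$, $$\sup_{N\ge1}m_N\Big[\sup_{x\in[0,1]}|u_N(x)|^p\Big]<\infty,\qquad \sup_{N\ge1}m_N\Big[\sup_{x\in[0,1]}|q_N(x)|^p\Big]<\infty,\qquad \sup_{N\ge1}m_N[\tau(n(1))^p]<\infty.$$ -/

import Mathlib

open MeasureTheory ProbabilityTheory Filter Topology
open scoped ENNReal UniformConvergence BoundedContinuousFunction

namespace ZeroRange

noncomputable section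

/-! ### The one-site measures `ν_a` -/

/-- The unnormalised mass `a ^ k / ∏_{i=1}^k τ i`. -/
def siteWeight (τ : ℕ → ℝ) (a : ℝ) (k : ℕ) : ℝ :=
  a ^ k / ∏ i ∈ Finset.Icc 1 k, τ i

/-- The normalisation `Z_a`; finite exactly when `siteWeight τ a` is summable. -/
def Z (τ : ℕ → ℝ) (a : ℝ) : ℝ :=
  ∑' k, siteWeight τ a k

/-- The probability mass function `ν_a` on `ℕ`. -/
def nu (τ : ℕ → ℝ) (a : ℝ) (k : ℕ) : ℝ :=
  siteWeight τ a k / Z τ a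

/-- `a* = sup {a > 0 : Z_a < ∞}`, an element of `[0, ∞]`. -/
def aStar (τ : ℕ → ℝ) : ℝ≥0∞ :=
  ⨆ (a : ℝ) (_ : 0 < a) (_ : Summable (siteWeight τ a)), ENNReal.ofReal a

/-- The open interval `(0, a*)`. -/
def params (τ : ℕ → ℝ) : Set ℝ :=
  {a | 0 < a ∧ ENNReal.ofReal a < aStar τ}

/-- The expectation of `f` under `ν_a`. -/
def nuMean (τ : ℕ → ℝ) (a : ℝ) (f : ℕ → ℝ) : ℝ :=
  ∑' k, f k * nu τ a k

/-- The density `R(a)`, the first moment of `ν_a`. -/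
def R (τ : ℕ → ℝ) (a : ℝ) : ℝ :=
  nuMean τ a (fun k => (k : ℝ))

/-- `R* = lim_{a ↑ a*} R(a)` in `[0, ∞]`; as `R` is nondecreasing on `(0, a*)`, the limit is the
supremum. -/
def RStar (τ : ℕ → ℝ) : ℝ≥0∞ :=
  ⨆ (a : ℝ) (_ : a ∈ params τ), ENNReal.ofReal (R τ a)

/-- The reciprocal function `Φ : (0, R*) → (0, a*)` of `R`. -/
def Phi (τ : ℕ → ℝ) (nbar : ℝ) : ℝ :=
  Function.invFunOn (R τ) (params τ) nbar

/-- `τ̄`, the mean of `τ(n)` under `ν_a` with `a = Φ(n̄)`. -/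
def tauBar (τ : ℕ → ℝ) (nbar : ℝ) : ℝ :=
  nuMean τ (Phi τ nbar) τ

/-- `ρ`, the covariance of `n` and `τ(n)` under `ν_a` with `a = Φ(n̄)`. -/
def rho (τ : ℕ → ℝ) (nbar : ℝ) : ℝ :=
  nuMean τ (Phi τ nbar) (fun k => ((k : ℝ) - nbar) * (τ k - tauBar τ nbar))

/-- `α`, the variance of `n` under `ν_a` with `a = Φ(n̄)`. -/
def alpha (τ : ℕ → ℝ) (nbar : ℝ) : ℝ :=
  nuMean τ (Phi τ nbar) (fun k => ((k : ℝ) - nbar) ^ 2)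

/-- `γ`, the variance of `τ(n)` under `ν_a` with `a = Φ(n̄)`. -/
def gam (τ : ℕ → ℝ) (nbar : ℝ) : ℝ :=
  nuMean τ (Phi τ nbar) (fun k => (τ k - tauBar τ nbar) ^ 2)

/-! ### The invariant measure

Site `k ∈ {1, …, N}` is the element `k - 1` of `Fin N`. -/

/-- The configurations on `N` sites with `⌊N n̄⌋` particles. -/
def configs (nbar : ℝ) (N : ℕ) : Finset (Fin N → ℕ) :=
  Finset.piAntidiag Finset.univ ⌊(N : ℝ) * nbar⌋₊

/-- The unnormalised mass `1 / ∏_i ∏_{j=1}^{n(i)} τ j` of a configuration. -/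
def configWeight (τ : ℕ → ℝ) {N : ℕ} (n : Fin N → ℕ) : ℝ :=
  (∏ i, ∏ j ∈ Finset.Icc 1 (n i), τ j)⁻¹

/-- The invariant probability measure of the zero-range process with `⌊N n̄⌋` particles on `N`
sites, as a measure on configurations. -/
def invMeasure (τ : ℕ → ℝ) (nbar : ℝ) (N : ℕ) : Measure (Fin N → ℕ) :=
  ∑ n ∈ configs nbar N,
    ENNReal.ofReal (configWeight τ n / ∑ n' ∈ configs nbar N, configWeight τ n') • Measure.dirac n

/-- The configuration obtained from `n` when a particle jumps from site `i` to site `j`. -/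
def jump {N : ℕ} (n : Fin N → ℕ) (i j : Fin N) : Fin N → ℕ :=
  Function.update (Function.update n i (n i - 1)) j (n j + 1)

/-- Detailed balance: the weights are reversible for the dynamics in which a particle jumps from
`i` to each of its neighbours `j` at a rate proportional to `τ (n i)`. -/
theorem configWeight_detailed_balance (τ : ℕ → ℝ) (hpos : ∀ k, 1 ≤ k → 0 < τ k) {N : ℕ}
    (n : Fin N → ℕ) (i j : Fin N) (hij : i ≠ j) (hi : 1 ≤ n i) :
    configWeight τ n * τ (n i) = configWeight τ (jump n i j) * τ (jump n i j j) := by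
  obtain ⟨m, hm⟩ : ∃ m, n i = m + 1 := ⟨n i - 1, by omega⟩
  have hP : ∀ k, (∏ l ∈ Finset.Icc 1 k, τ l) ≠ 0 := fun k =>
    Finset.prod_ne_zero_iff.mpr fun l hl => (hpos l (Finset.mem_Icc.mp hl).1).ne'
  have hji : j ∈ (Finset.univ.erase i : Finset (Fin N)) := by simp [hij.symm]
  have split : ∀ f : Fin N → ℝ,
      ∏ l, f l = f i * (f j * ∏ l ∈ (Finset.univ.erase i).erase j, f l) := fun f => by
    rw [Finset.mul_prod_erase _ f hji, Finset.mul_prod_erase _ f (Finset.mem_univ i)]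
  have h1 : jump n i j i = m := by simp [jump, hij, hm]
  have h2 : jump n i j j = n j + 1 := by simp [jump]
  have h3 : ∏ l ∈ (Finset.univ.erase i).erase j, ∏ k ∈ Finset.Icc 1 (jump n i j l), τ k
      = ∏ l ∈ (Finset.univ.erase i).erase j, ∏ k ∈ Finset.Icc 1 (n l), τ k := by
    refine Finset.prod_congr rfl fun l hl => ?_
    simp only [Finset.mem_erase] at hl
    simp [jump, hl.1, hl.2.1]
  have h4 : (∏ l ∈ (Finset.univ.erase i).erase j, ∏ k ∈ Finset.Icc 1 (n l), τ k) ≠ 0 :=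
    Finset.prod_ne_zero_iff.mpr fun l _ => hP _
  have h5 := (hpos (m + 1) (by omega)).ne'
  have h6 := (hpos (n j + 1) (by omega)).ne'
  have h7 := hP m
  have h8 := hP (n j)
  simp only [configWeight]
  rw [split, split (fun l => ∏ k ∈ Finset.Icc 1 (jump n i j l), τ k), h3, h1, h2, hm,
    Finset.prod_Icc_succ_top (by omega), Finset.prod_Icc_succ_top (by omega)]
  field_simp

/-! ### Height functions -/

/-- The height function `N^{-1/2} ∑_{k=1}^{⌊xN⌋} (f (n(k)) - c)` on `[0, 1]`. -/
def height (f : ℕ → ℝ) (c : ℝ) {N : ℕ} (n : Fin N → ℕ) (x : unitInterval) : ℝ :=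
  (Real.sqrt N)⁻¹ *
    ∑ k ∈ Finset.univ.filter (fun k : Fin N => (k : ℕ) + 1 ≤ ⌊(x : ℝ) * N⌋₊), (f (n k) - c)

/-- The height function `u_N` of a configuration. -/
def uN (nbar : ℝ) {N : ℕ} (n : Fin N → ℕ) : unitInterval → ℝ :=
  height (fun k => (k : ℝ)) nbar n

/-- The height function `q_N` of the field of jump rates of a configuration. -/
def qN (τ : ℕ → ℝ) (nbar : ℝ) {N : ℕ} (n : Fin N → ℕ) : unitInterval → ℝ :=
  height τ (tauBar τ nbar) n

/-! ### Convergence in law -/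

/-- Convergence in law of random paths `X N : [0, 1] → ℝ × ℝ` to the random path `Y`, for the
topology of uniform convergence on `[0, 1]`: the expectation of every bounded functional that is
continuous for this topology converges. It is used for `X N` on discrete probability spaces and
`Y` with continuous sample paths, so that all these functionals are random variables. -/
def ConvergesInLaw {S : ℕ → Type} [∀ N, MeasurableSpace (S N)] (μ : ∀ N, Measure (S N))
    (X : ∀ N, S N → unitInterval → ℝ × ℝ) {Ω : Type} [MeasurableSpace Ω] (P : Measure Ω)
    (Y : Ω → unitInterval → ℝ × ℝ) : Prop :=
  ∀ F : (unitInterval →ᵤ ℝ × ℝ) →ᵇ ℝ,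
    Tendsto (fun N => ∫ s, F (UniformFun.ofFun (X N s)) ∂(μ N)) atTop
      (𝓝 (∫ ω, F (UniformFun.ofFun (Y ω)) ∂P))

end

end ZeroRange

/-! Under the product of the one-site laws `nu`, a configuration with `m` particles has mass `a ^ m
/ Z ^ N` times its weight. Conditioning on the total cancels the prefactor, so the invariant measure
is an i.i.d. family conditioned on its sum (`invMeasure_eq_cond`). The choice `a = Phi τ nbar` makes
the sum typical: the conditioning event has probability of order `N ^ (-1/2)`, and comparisons with
independent variables are made at that scale.

Finite-dimensional laws. The indicator of the event is a Fourier integral over `(-π, π]`, so the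
conditioned characteristic function of a linear statistic is a quotient of integrals of products of
one-site characteristic functions. After the substitution `t = s / √N` the product tends to a
Gaussian in `s`, dominated thanks to the masses at `0` and `1` (`norm_jointChar_le`,
`tendsto_sqrt_mul_setIntegral`). Integrating in `s` completes a square. This subtracts from the
unconditioned variance the squared covariance with the total, divided by `α`, which produces the
terms `α s t`, `ρ s t` and `ρ ^ 2 / α * s t` of the limit (`limitVar_eq`).

Tightness. Any given value of the sum over a fixed fraction of the sites has probability `O(N ^
(-1/2))`, so conditioning costs only a constant factor for functions of a block that leaves out such
a fraction (`exists_lintegral_cond_le`). Increments over `l` sites thus have moments of order `2 q`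
bounded by a constant times `l ^ q`, as in the independent case. A dyadic argument turns this into
maximal bounds (`exists_lintegral_maxIncr_le`), which give both the uniform moments and the modulus
of continuity.

The limit process is not built beforehand. Arzelà-Ascoli and Prokhorov give a limit point on the
space of continuous paths; its characteristic functions are the computed limits. Uniqueness,
Gaussianity and covariances are read off from them (`exists_functional_limit`,
`map_pathCoord_eq_gaussianReal`). -/

namespace ZeroRange

/-! ### The one-site measures -/

section OneSite

variable {τ : ℕ → ℝ}

lemma prod_rates_pos (hτ_pos : ∀ k, 1 ≤ k → 0 < τ k) (k : ℕ) : 0 < ∏ i ∈ Finset.Icc 1 k, τ i :=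
  Finset.prod_pos fun i hi => hτ_pos i (Finset.mem_Icc.mp hi).1

lemma siteWeight_pos (hτ_pos : ∀ k, 1 ≤ k → 0 < τ k) {a : ℝ} (ha : 0 < a) (k : ℕ) :
    0 < siteWeight τ a k :=
  div_pos (pow_pos ha k) (prod_rates_pos hτ_pos k)

lemma siteWeight_eq_ratio_mul {a b : ℝ} (hb : 0 < b) (k : ℕ) :
    siteWeight τ a k = (a / b) ^ k * siteWeight τ b k := by
  unfold siteWeight
  rw [div_pow]
  field_simp

lemma siteWeight_mono (hτ_pos : ∀ k, 1 ≤ k → 0 < τ k) {a b : ℝ} (ha : 0 ≤ a) (hab : a ≤ b) (k : ℕ) :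
    siteWeight τ a k ≤ siteWeight τ b k :=
  div_le_div_of_nonneg_right (pow_le_pow_left₀ ha hab k) (prod_rates_pos hτ_pos k).le

/-- Below the critical fugacity all the power moments of the weights are finite. -/
lemma summable_pow_mul_siteWeight (hτ_pos : ∀ k, 1 ≤ k → 0 < τ k) {a : ℝ} (ha : a ∈ params τ)
    (d : ℕ) : Summable fun k : ℕ => (k : ℝ) ^ d * siteWeight τ a k := by
  obtain ⟨ha0, hlt⟩ := ha
  simp only [aStar, lt_iSup_iff] at hlt
  obtain ⟨b, hb0, hb, hab⟩ := hlt
  have hab' : a < b := (ENNReal.ofReal_lt_ofReal_iff hb0).mp hab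
  have hr : ‖a / b‖ < 1 := by
    rw [Real.norm_of_nonneg (by positivity), div_lt_one hb0]
    exact hab'
  -- The power of `k` is absorbed by the geometric factor `(a / b) ^ k`, leaving a constant multiple
  -- of the summable weight at `b > a`.
  have h1 := summable_pow_mul_geometric_of_norm_lt_one d hr
  obtain ⟨C, hC⟩ := h1.tendsto_atTop_zero.bddAbove_range
  refine Summable.of_nonneg_of_le
    (fun k => mul_nonneg (by positivity) (siteWeight_pos hτ_pos ha0 k).le) (fun k => ?_)
    (hb.mul_left C)
  rw [siteWeight_eq_ratio_mul hb0, ← mul_assoc]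
  exact mul_le_mul_of_nonneg_right (hC ⟨k, rfl⟩) (siteWeight_pos hτ_pos hb0 k).le

lemma summable_siteWeight (hτ_pos : ∀ k, 1 ≤ k → 0 < τ k) {a : ℝ} (ha : a ∈ params τ) :
    Summable (siteWeight τ a) := by
  simpa using summable_pow_mul_siteWeight hτ_pos ha 0

lemma params_of_le {a b : ℝ} (hb : b ∈ params τ) (ha : 0 < a) (hab : a ≤ b) : a ∈ params τ :=
  ⟨ha, (ENNReal.ofReal_le_ofReal hab).trans_lt hb.2⟩

lemma one_le_Z (hτ_pos : ∀ k, 1 ≤ k → 0 < τ k) {a : ℝ} (ha : a ∈ params τ) : 1 ≤ Z τ a := by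
  calc (1 : ℝ) = siteWeight τ a 0 := by simp [siteWeight]
    _ ≤ Z τ a := (summable_siteWeight hτ_pos ha).le_tsum 0 fun k _ => (siteWeight_pos hτ_pos ha.1 k).le

lemma R_eq_div (a : ℝ) : R τ a = (∑' k : ℕ, (k : ℝ) * siteWeight τ a k) / Z τ a := by
  simp only [R, nuMean, nu, ← mul_div_assoc, tsum_div_const]

lemma continuousOn_R (hτ_pos : ∀ k, 1 ≤ k → 0 < τ k) {a b : ℝ} (ha : 0 < a) (hb : b ∈ params τ) :
    ContinuousOn (R τ) (Set.Icc a b) := by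
  have hw : ∀ k, ContinuousOn (fun x => siteWeight τ x k) (Set.Icc a b) := fun k => by
    unfold siteWeight
    fun_prop
  have hle : ∀ k, ∀ x ∈ Set.Icc a b, ‖siteWeight τ x k‖ ≤ siteWeight τ b k := fun k x hx => by
    rw [Real.norm_of_nonneg (siteWeight_pos hτ_pos (ha.trans_le hx.1) k).le]
    exact siteWeight_mono hτ_pos (ha.le.trans hx.1) hx.2 k
  have h0 : ContinuousOn (fun x => Z τ x) (Set.Icc a b) :=
    continuousOn_tsum hw (summable_siteWeight hτ_pos hb) hle
  have h1 : ContinuousOn (fun x => ∑' k : ℕ, (k : ℝ) * siteWeight τ x k) (Set.Icc a b) := by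
    refine continuousOn_tsum (fun k => continuousOn_const.mul (hw k))
      (by simpa using summable_pow_mul_siteWeight hτ_pos hb 1) fun k x hx => ?_
    rw [norm_mul, Real.norm_natCast]
    exact mul_le_mul_of_nonneg_left (hle k x hx) k.cast_nonneg
  refine (h1.div h0 fun x hx => ?_).congr fun x _ => R_eq_div x
  exact (zero_lt_one.trans_le
    (one_le_Z hτ_pos (params_of_le hb (ha.trans_le hx.1) hx.2))).ne'

/-- Makes `R` small near fugacity zero: the term `k = 0` vanishes and every other term yields a
factor `(a / b) ^ k ≤ a / b`. This gives the lower endpoint of an intermediate value argument. -/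
lemma R_le_ratio_mul (hτ_pos : ∀ k, 1 ≤ k → 0 < τ k) {a b : ℝ} (ha : 0 < a) (hab : a ≤ b)
    (hb : b ∈ params τ) : R τ a ≤ a / b * ∑' k : ℕ, (k : ℝ) * siteWeight τ b k := by
  have hs : Summable fun k : ℕ => (k : ℝ) * siteWeight τ b k := by
    simpa using summable_pow_mul_siteWeight hτ_pos hb 1
  have hs' : Summable fun k : ℕ => (k : ℝ) * siteWeight τ a k := by
    simpa using summable_pow_mul_siteWeight hτ_pos (params_of_le hb ha hab) 1
  rw [R_eq_div, ← tsum_mul_left]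
  refine (div_le_self (tsum_nonneg fun k => mul_nonneg k.cast_nonneg
    (siteWeight_pos hτ_pos ha k).le) (one_le_Z hτ_pos (params_of_le hb ha hab))).trans ?_
  refine hs'.tsum_le_tsum (fun k => ?_) (hs.mul_left _)
  rcases Nat.eq_zero_or_pos k with rfl | hk
  · simp
  have hb0 := hb.1
  have h1 : (a / b) ^ k ≤ a / b :=
    pow_le_of_le_one (by positivity) ((div_le_one hb0).mpr hab) hk.ne'
  have := mul_le_mul_of_nonneg_right h1
    (mul_nonneg k.cast_nonneg (siteWeight_pos hτ_pos hb.1 k).le)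
  calc _ = (a / b) ^ k * (k * siteWeight τ b k) := by
        rw [siteWeight_eq_ratio_mul hb.1]; ring
    _ ≤ _ := this

/-- Every density below `R*` is attained. -/
lemma exists_R_eq (hτ_pos : ∀ k, 1 ≤ k → 0 < τ k) {nbar : ℝ} (hnbar_pos : 0 < nbar)
    (hnbar_lt : ENNReal.ofReal nbar < RStar τ) : ∃ a ∈ params τ, R τ a = nbar := by
  simp only [RStar, lt_iSup_iff] at hnbar_lt
  obtain ⟨b, hb, hlt⟩ := hnbar_lt
  have hlt' : nbar < R τ b := lt_of_not_ge fun h => (ENNReal.ofReal_le_ofReal h).not_gt hlt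
  have hb0 := hb.1
  set M := ∑' k : ℕ, (k : ℝ) * siteWeight τ b k
  have hM : 0 ≤ M := tsum_nonneg fun k => mul_nonneg k.cast_nonneg (siteWeight_pos hτ_pos hb0 k).le
  -- Chosen so that `a / b * M ≤ nbar`; the `+ 1` keeps the denominator positive.
  set a := min b (b * nbar / (M + 1))
  have ha0 : 0 < a := lt_min hb0 (by positivity)
  have hRa : R τ a ≤ nbar := by
    refine (R_le_ratio_mul hτ_pos ha0 (min_le_left _ _) hb).trans ?_
    have h1 : a / b ≤ nbar / (M + 1) := by
      rw [div_le_iff₀ hb0]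
      refine (min_le_right _ _).trans_eq ?_
      ring
    calc a / b * M ≤ nbar / (M + 1) * M := mul_le_mul_of_nonneg_right h1 hM
      _ ≤ nbar := by
        rw [div_mul_eq_mul_div, div_le_iff₀ (by positivity)]
        nlinarith
  obtain ⟨c, hc, hRc⟩ := intermediate_value_Icc (min_le_left _ _ : a ≤ b)
    (continuousOn_R hτ_pos ha0 hb) ⟨hRa, hlt'.le⟩
  exact ⟨c, params_of_le hb (ha0.trans_le hc.1) hc.2, hRc⟩

/-- `Phi` chooses some preimage under `R`; this membership and `R_Phi` are all that the proof uses
of it, so injectivity of `R` plays no role. -/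
lemma Phi_mem (hτ_pos : ∀ k, 1 ≤ k → 0 < τ k) {nbar : ℝ} (hnbar_pos : 0 < nbar)
    (hnbar_lt : ENNReal.ofReal nbar < RStar τ) : Phi τ nbar ∈ params τ :=
  Function.invFunOn_mem (exists_R_eq hτ_pos hnbar_pos hnbar_lt)

lemma R_Phi (hτ_pos : ∀ k, 1 ≤ k → 0 < τ k) {nbar : ℝ} (hnbar_pos : 0 < nbar)
    (hnbar_lt : ENNReal.ofReal nbar < RStar τ) : R τ (Phi τ nbar) = nbar :=
  Function.invFunOn_eq (exists_R_eq hτ_pos hnbar_pos hnbar_lt)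

/-- The measure `ν_a` on `ℕ`. -/
noncomputable def nuMeasure (τ : ℕ → ℝ) (a : ℝ) : Measure ℕ :=
  Measure.sum fun k => ENNReal.ofReal (nu τ a k) • Measure.dirac k

lemma nu_pos (hτ_pos : ∀ k, 1 ≤ k → 0 < τ k) {a : ℝ} (ha : a ∈ params τ) (k : ℕ) : 0 < nu τ a k :=
  div_pos (siteWeight_pos hτ_pos ha.1 k) (zero_lt_one.trans_le (one_le_Z hτ_pos ha))

lemma isProbabilityMeasure_nuMeasure (hτ_pos : ∀ k, 1 ≤ k → 0 < τ k) {a : ℝ} (ha : a ∈ params τ) :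
    IsProbabilityMeasure (nuMeasure τ a) := by
  refine HasSum.isProbabilityMeasure_sum_dirac (fun k => (nu_pos hτ_pos ha k).le) ?_
  have := (summable_siteWeight hτ_pos ha).hasSum.div_const (Z τ a)
  rwa [← Z, div_self (zero_lt_one.trans_le (one_le_Z hτ_pos ha)).ne'] at this

lemma nuMeasure_singleton (a : ℝ) (k : ℕ) :
    nuMeasure τ a {k} = ENNReal.ofReal (nu τ a k) := by
  rw [nuMeasure, Measure.sum_smul_dirac_singleton]

lemma nuMeasure_real_singleton (hτ_pos : ∀ k, 1 ≤ k → 0 < τ k) {a : ℝ} (ha : a ∈ params τ) (k : ℕ) :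
    (nuMeasure τ a).real {k} = nu τ a k := by
  rw [measureReal_def, nuMeasure_singleton, ENNReal.toReal_ofReal (nu_pos hτ_pos ha k).le]

lemma integral_nuMeasure (hτ_pos : ∀ k, 1 ≤ k → 0 < τ k) {a : ℝ} (ha : a ∈ params τ) (f : ℕ → ℝ) :
    ∫ k, f k ∂(nuMeasure τ a) = nuMean τ a f := by
  rw [nuMeasure, integral_sum_dirac (by simp), nuMean]
  refine tsum_congr fun k => ?_
  rw [ENNReal.toReal_ofReal (nu_pos hτ_pos ha k).le, smul_eq_mul, mul_comm]

/-- Functions of polynomial growth are integrable against `ν_a`. -/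
lemma integrable_nuMeasure_of_le_pow (hτ_pos : ∀ k, 1 ≤ k → 0 < τ k) {a : ℝ} (ha : a ∈ params τ)
    {f : ℕ → ℝ} (C : ℝ) (d : ℕ) (hf : ∀ k, |f k| ≤ C * (1 + (k : ℝ)) ^ d) :
    Integrable f (nuMeasure τ a) := by
  rw [nuMeasure, integrable_sum_dirac_iff (by simp)]
  have h1 : Summable fun k : ℕ => (1 + (k : ℝ)) ^ d * nu τ a k := by
    have h2 : ∀ k : ℕ, (1 + (k : ℝ)) ^ d * nu τ a k
        = ∑ i ∈ Finset.range (d + 1),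
          (d.choose i : ℝ) / Z τ a * ((k : ℝ) ^ i * siteWeight τ a k) := fun k => by
      rw [add_comm, add_pow, Finset.sum_mul]
      refine Finset.sum_congr rfl fun i _ => ?_
      simp only [one_pow, nu]
      ring
    simp_rw [h2]
    exact summable_sum fun i _ => (summable_pow_mul_siteWeight hτ_pos ha i).mul_left _
  refine Summable.of_nonneg_of_le (fun k => by positivity) (fun k => ?_) (h1.mul_left C)
  rw [ENNReal.toReal_ofReal (nu_pos hτ_pos ha k).le, Real.norm_eq_abs, mul_comm, ← mul_assoc]
  exact mul_le_mul_of_nonneg_right (hf k) (nu_pos hτ_pos ha k).le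

/-- All moments of a centred function of polynomial growth are finite. -/
lemma integrable_pow_sub_nuMeasure (hτ_pos : ∀ k, 1 ≤ k → 0 < τ k) {a : ℝ} (ha : a ∈ params τ)
    {f : ℕ → ℝ} {C : ℝ} {d : ℕ} (hf : ∀ k, |f k| ≤ C * (1 + (k : ℝ)) ^ d) (c : ℝ) (p : ℕ) :
    Integrable (fun k => |f k - c| ^ p) (nuMeasure τ a) := by
  refine integrable_nuMeasure_of_le_pow hτ_pos ha ((C + |c|) ^ p) (d * p) fun k => ?_
  rw [abs_of_nonneg (by positivity), pow_mul, ← mul_pow]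
  refine pow_le_pow_left₀ (abs_nonneg _) ?_ p
  have h1 : (1 : ℝ) ≤ (1 + (k : ℝ)) ^ d := one_le_pow₀ (by simp)
  calc |f k - c| ≤ |f k| + |c| := abs_sub _ _
    _ ≤ C * (1 + (k : ℝ)) ^ d + |c| * (1 + (k : ℝ)) ^ d :=
      add_le_add (hf k) (le_mul_of_one_le_right (abs_nonneg c) h1)
    _ = _ := by ring

end OneSite

end ZeroRange

namespace ZeroRange

/-! ### Fourier inversion for integer-valued sums -/

section Fourier

open Complex

lemma integral_cexp_int_mul (j : ℤ) :
    ∫ t in (-Real.pi)..Real.pi, cexp ((t * j : ℝ) * I) = if j = 0 then 2 * (Real.pi : ℂ) else 0 := by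
  split_ifs with h
  · subst h
    simp
    ring
  · have hc : (j : ℂ) * I ≠ 0 := mul_ne_zero (by exact_mod_cast h) I_ne_zero
    have h1 : ∀ t : ℝ, cexp ((t * j : ℝ) * I) = cexp ((j : ℂ) * I * t) := fun t => by
      congr 1; push_cast; ring
    simp_rw [h1]
    rw [integral_exp_mul_complex hc, div_eq_zero_iff]
    left
    rw [sub_eq_zero, Complex.exp_eq_exp_iff_exists_int]
    refine ⟨j, ?_⟩
    push_cast
    ring

lemma norm_cexp_ofReal_mul_I (x : ℝ) : ‖cexp ((x : ℂ) * I)‖ = 1 := Complex.norm_exp_ofReal_mul_I x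

/-- Fourier inversion: the expectation of `G` on the event `T = m`. -/
lemma setIntegral_eq_fourier {Ω : Type*} [MeasurableSpace Ω] (P : Measure Ω) [IsFiniteMeasure P]
    {T : Ω → ℤ} (hT : Measurable T) {G : Ω → ℂ} (hG : Integrable G P) (m : ℤ) :
    ∫ ω in {ω | T ω = m}, G ω ∂P = (2 * (Real.pi : ℂ))⁻¹ *
      ∫ t in (-Real.pi)..Real.pi, ∫ ω, G ω * cexp ((t * ((T ω - m : ℤ) : ℝ) : ℝ) * I) ∂P := by
  have hπ : (2 * (Real.pi : ℂ)) ≠ 0 := by simp [Real.pi_ne_zero]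
  have hle : -Real.pi ≤ Real.pi := by linarith [Real.pi_pos]
  have hms : MeasurableSet {ω | T ω = m} := hT (measurableSet_singleton m)
  have hTr : Measurable fun ω => ((T ω - m : ℤ) : ℝ) :=
    (measurable_of_countable (fun z : ℤ => ((z - m : ℤ) : ℝ))).comp hT
  rw [intervalIntegral.integral_of_le hle, integral_integral_swap, ← integral_const_mul,
    ← integral_indicator hms]
  · refine integral_congr_ae (.of_forall fun ω => ?_)
    simp only
    rw [← intervalIntegral.integral_of_le hle, intervalIntegral.integral_const_mul,
      integral_cexp_int_mul]
    by_cases h : T ω = m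
    · simp [Set.indicator, h]
      field_simp
    · simp [Set.indicator, h, sub_eq_zero]
  · have h1 : Integrable (fun z : ℝ × Ω => (1 : ℂ) * G z.2)
        ((volume.restrict (Set.Ioc (-Real.pi) Real.pi)).prod P) :=
      Integrable.mul_prod (f := fun _ : ℝ => (1 : ℂ)) (integrable_const _) hG
    simp only [one_mul] at h1
    refine h1.mul_bdd (c := 1) ?_ (.of_forall fun z => ?_)
    · refine Measurable.aestronglyMeasurable ?_
      have : Measurable fun z : ℝ × Ω => z.1 * ((T z.2 - m : ℤ) : ℝ) :=
        measurable_fst.mul (hTr.comp measurable_snd)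
      exact Complex.measurable_exp.comp ((Complex.measurable_ofReal.comp this).mul_const _)
    · exact (norm_cexp_ofReal_mul_I _).le

/-- The joint characteristic function of `(f, g)` under `ν`. -/
noncomputable def jointChar (ν : Measure ℕ) (f g : ℕ → ℝ) (u v : ℝ) : ℂ :=
  ∫ k, cexp ((u * f k + v * g k : ℝ) * I) ∂ν

lemma integrable_cexp_ofReal_mul_I {Ω : Type*} [MeasurableSpace Ω] (P : Measure Ω)
    [IsFiniteMeasure P] {X : Ω → ℝ} (hX : Measurable X) :
    Integrable (fun ω => cexp ((X ω : ℂ) * I)) P := by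
  refine Integrable.of_bound (C := 1) ?_ (.of_forall fun ω => (norm_cexp_ofReal_mul_I _).le)
  exact (Complex.measurable_exp.comp
    ((Complex.measurable_ofReal.comp hX).mul_const _)).aestronglyMeasurable

/-- The squared modulus is `(p + q) ^ 2 - 2 c` with `c = p q (1 - cos (y - x))`. Since `p + q ≤ 1`
and `c ≥ 0`, this is at most `(p + q - c) ^ 2`. -/
lemma norm_two_point_le {p q : ℝ} (hp : 0 < p) (hq : 0 < q) (hpq : p + q ≤ 1) (x y : ℝ) :
    ‖(p : ℂ) * cexp ((x : ℂ) * I) + q * cexp ((y : ℂ) * I)‖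
      ≤ p + q - p * q * (1 - Real.cos (y - x)) := by
  have hcos := Real.cos_le_one (y - x)
  have hcos' := Real.neg_one_le_cos (y - x)
  have h0 : 0 ≤ p + q - p * q * (1 - Real.cos (y - x)) := by
    nlinarith [mul_pos hp hq, mul_nonneg (mul_pos hp hq).le (by linarith : 0 ≤ 1 + Real.cos (y - x))]
  refine le_of_sq_le_sq ?_ h0 |>.trans_eq rfl
  rw [← Complex.normSq_eq_norm_sq, Complex.normSq_apply]
  simp only [add_re, add_im, re_ofReal_mul, im_ofReal_mul, exp_ofReal_mul_I_re,
    exp_ofReal_mul_I_im]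
  have h1 : (p * Real.cos x + q * Real.cos y) * (p * Real.cos x + q * Real.cos y)
      + (p * Real.sin x + q * Real.sin y) * (p * Real.sin x + q * Real.sin y)
      = (p + q) ^ 2 - 2 * (p * q * (1 - Real.cos (y - x))) := by
    rw [Real.cos_sub]
    linear_combination p ^ 2 * Real.sin_sq_add_cos_sq x + q ^ 2 * Real.sin_sq_add_cos_sq y
  rw [h1]
  have h2 : 0 ≤ p * q * (1 - Real.cos (y - x)) := mul_nonneg (mul_pos hp hq).le (by linarith)
  nlinarith [mul_nonneg (by linarith : 0 ≤ 1 - (p + q)) h2]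

/-- The mass at the two points `0` and `1` bounds the characteristic function away from `1`. -/
lemma norm_jointChar_le {ν : Measure ℕ} [IsProbabilityMeasure ν] (h0 : 0 < ν.real {0})
    (h1 : 0 < ν.real {1}) (f g : ℕ → ℝ) (u v : ℝ) :
    ‖jointChar ν f g u v‖ ≤ Real.exp (-(ν.real {0} * ν.real {1} *
      (1 - Real.cos (u * (f 1 - f 0) + v * (g 1 - g 0))))) := by
  set F : ℕ → ℂ := fun k => cexp ((u * f k + v * g k : ℝ) * I) with hF
  have hFi : Integrable F ν := integrable_cexp_ofReal_mul_I ν (measurable_of_countable _)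
  have hs : MeasurableSet ({0, 1} : Set ℕ) := .of_discrete
  have hpair : ν.real {0, 1} = ν.real {0} + ν.real {1} := by
    rw [Set.insert_eq, measureReal_union (by simp) (measurableSet_singleton _)]
  have hsum : ν.real {0} + ν.real {1} ≤ 1 := hpair ▸ measureReal_le_one
  have hint : ∫ k in ({0, 1} : Set ℕ), F k ∂ν = (ν.real {0} : ℂ) * F 0 + (ν.real {1} : ℂ) * F 1 := by
    rw [Set.insert_eq, setIntegral_union (by simp) (measurableSet_singleton _) hFi.integrableOn
      hFi.integrableOn, integral_singleton, integral_singleton]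
    simp
  have hrest : ‖∫ k in ({0, 1} : Set ℕ)ᶜ, F k ∂ν‖ ≤ 1 - (ν.real {0} + ν.real {1}) := by
    have := norm_setIntegral_le_of_norm_le_const (μ := ν) (s := ({0, 1} : Set ℕ)ᶜ) (C := 1) (f := F)
      (measure_lt_top _ _) (fun k _ => (norm_cexp_ofReal_mul_I _).le)
    rwa [one_mul, probReal_compl_eq_one_sub hs, hpair] at this
  have hstep : ‖jointChar ν f g u v‖ ≤ 1 - ν.real {0} * ν.real {1} *
      (1 - Real.cos (u * (f 1 - f 0) + v * (g 1 - g 0))) := by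
    have heq : jointChar ν f g u v
        = ((ν.real {0} : ℂ) * F 0 + (ν.real {1} : ℂ) * F 1) + ∫ k in ({0, 1} : Set ℕ)ᶜ, F k ∂ν := by
      rw [← hint, integral_add_compl hs hFi]
      rfl
    have hcos : u * (f 1 - f 0) + v * (g 1 - g 0)
        = (u * f 1 + v * g 1) - (u * f 0 + v * g 0) := by ring
    rw [heq, hcos]
    refine (norm_add_le _ _).trans ?_
    have := norm_two_point_le h0 h1 hsum (u * f 0 + v * g 0) (u * f 1 + v * g 1)
    simp only [hF]
    linarith
  refine hstep.trans ?_
  have := Real.add_one_le_exp (-(ν.real {0} * ν.real {1} *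
      (1 - Real.cos (u * (f 1 - f 0) + v * (g 1 - g 0)))))
  linarith

/-- The range reaches `4`, beyond `π`, so that frequencies in `[-π, π]` may be shifted slightly
without losing the quadratic bound. -/
lemma sq_div_le_one_sub_cos {w : ℝ} (hw : |w| ≤ 4) : w ^ 2 / 16 ≤ 1 - Real.cos w := by
  rcases le_or_gt |w| Real.pi with h | h
  · have h1 := Real.cos_le_one_sub_mul_cos_sq h
    have h2 : w ^ 2 / 16 ≤ 2 / Real.pi ^ 2 * w ^ 2 := by
      rw [div_eq_mul_one_div, mul_comm]
      refine mul_le_mul_of_nonneg_right ?_ (sq_nonneg w)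
      rw [div_le_div_iff₀ (by norm_num) (by positivity)]
      nlinarith [Real.pi_lt_d2, Real.pi_pos]
    linarith
  · have h1 : Real.cos w ≤ 0 := by
      rw [← Real.cos_abs]
      refine Real.cos_nonpos_of_pi_div_two_le_of_le (by linarith [Real.pi_pos]) ?_
      linarith [Real.pi_gt_three]
    have h2 : w ^ 2 ≤ 16 := by
      rw [← sq_abs]
      nlinarith [abs_nonneg w]
    linarith

variable {ι : Type*} [Fintype ι]

omit [Fintype ι] in
lemma measurable_eval_comp {β : Type*} [MeasurableSpace β] (i : ι) (f : ℕ → β) :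
    Measurable fun n : ι → ℕ => f (n i) :=
  (measurable_of_countable f).comp (measurable_pi_apply i)

/-- Fourier representation of a characteristic function restricted to a fixed total sum. -/
lemma setIntegral_cexp_eq_fourier (ν : Measure ℕ) [IsProbabilityMeasure ν] (nbar : ℝ) (g : ℕ → ℝ)
    (A B : ι → ℝ) (m : ℕ) :
    ∫ n in {n : ι → ℕ | ∑ i, n i = m},
        cexp ((∑ i, (A i * ((n i : ℝ) - nbar) + B i * g (n i)) : ℝ) * I) ∂(Measure.pi fun _ => ν)
      = (2 * (Real.pi : ℂ))⁻¹ * ∫ t in (-Real.pi)..Real.pi,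
        cexp ((t * (Fintype.card ι * nbar - m) : ℝ) * I) *
          ∏ i, jointChar ν (fun k => (k : ℝ) - nbar) g (t + A i) (B i) := by
  have hT : Measurable fun n : ι → ℕ => ((∑ i, n i : ℕ) : ℤ) :=
    (measurable_of_countable (fun k : ℕ => (k : ℤ))).comp
      (Finset.measurable_fun_sum _ fun i _ => measurable_pi_apply i)
  have hG := integrable_cexp_ofReal_mul_I (Measure.pi fun _ : ι => ν)
    (X := fun n : ι → ℕ => ∑ i, (A i * ((n i : ℝ) - nbar) + B i * g (n i)))
    (Finset.measurable_fun_sum _ fun i _ =>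
      measurable_eval_comp i (fun k : ℕ => A i * ((k : ℝ) - nbar) + B i * g k))
  have hset : {n : ι → ℕ | ∑ i, n i = m} = {n : ι → ℕ | ((∑ i, n i : ℕ) : ℤ) = (m : ℤ)} := by
    ext n
    simp only [Set.mem_ofPred_eq]
    exact_mod_cast Iff.rfl
  rw [hset, setIntegral_eq_fourier _ hT hG]
  congr 1
  refine intervalIntegral.integral_congr fun t _ => ?_
  simp only [jointChar]
  rw [← integral_fintype_prod_eq_prod (𝕜 := ℂ)
    (f := fun i (k : ℕ) => cexp (((t + A i) * ((k : ℝ) - nbar) + B i * g k : ℝ) * I)),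
    ← integral_const_mul]
  refine integral_congr_ae (.of_forall fun n => ?_)
  simp only
  rw [← Complex.exp_sum, ← Complex.exp_add, ← Complex.exp_add]
  congr 1
  rw [← Finset.sum_mul, ← add_mul, ← add_mul]
  congr 1
  -- Centring each factor at `nbar` removes a phase `t * nbar` per site, which the prefactor
  -- restores.
  have : t * (Fintype.card ι * nbar - m) = ∑ _i : ι, t * nbar - t * m := by
    rw [Finset.sum_const, Finset.card_univ, nsmul_eq_mul]; ring
  rw [this]
  push_cast
  rw [mul_sub, Finset.mul_sum, add_sub_assoc', sub_add_eq_add_sub, ← Finset.sum_add_distrib,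
    ← Finset.sum_add_distrib]
  congr 1
  refine Finset.sum_congr rfl fun i _ => ?_
  ring

/-- Local upper bound: a partial sum over `B` takes each value with probability
`O(|B| ^ (-1/2))`. -/
lemma measureReal_sum_eq_le (ν : Measure ℕ) [IsProbabilityMeasure ν] (h0 : 0 < ν.real {0})
    (h1 : 0 < ν.real {1}) (B : Finset ι) (hB : B.Nonempty) (m : ℕ) :
    (Measure.pi fun _ : ι => ν).real {n : ι → ℕ | ∑ i ∈ B, n i = m}
      ≤ (2 * Real.pi)⁻¹ * √(Real.pi / (ν.real {0} * ν.real {1} / 16 * B.card)) := by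
  classical
  have hT : Measurable fun n : ι → ℕ => ((∑ i ∈ B, n i : ℕ) : ℤ) :=
    (measurable_of_countable (fun k : ℕ => (k : ℤ))).comp
      (Finset.measurable_fun_sum _ fun i _ => measurable_pi_apply i)
  have hset : {n : ι → ℕ | ∑ i ∈ B, n i = m}
      = {n : ι → ℕ | ((∑ i ∈ B, n i : ℕ) : ℤ) = (m : ℤ)} := by
    ext n
    simp only [Set.mem_ofPred_eq]
    exact_mod_cast Iff.rfl
  have hF := setIntegral_eq_fourier (Measure.pi fun _ : ι => ν) hT (integrable_const (1 : ℂ)) m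
  rw [← hset, setIntegral_const] at hF
  simp only [one_mul, mul_one, Complex.real_smul] at hF
  set c := ν.real {0} * ν.real {1} / 16 with hc
  have hc0 : 0 < c * B.card := by
    have : 0 < B.card := Finset.card_pos.mpr hB
    positivity
  have hnorm := congrArg norm hF
  rw [Complex.norm_real, Real.norm_of_nonneg measureReal_nonneg] at hnorm
  rw [hnorm, norm_mul, norm_inv, norm_mul, Complex.norm_real, Real.norm_of_nonneg Real.pi_pos.le,
    Complex.norm_ofNat]
  refine mul_le_mul_of_nonneg_left ?_ (by positivity)
  have hbound : ∀ t ∈ Set.Ioc (-Real.pi) Real.pi,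
      ‖∫ n : ι → ℕ, cexp ((t * (((∑ i ∈ B, n i : ℕ) - m : ℤ) : ℝ) : ℝ) * I)
        ∂(Measure.pi fun _ : ι => ν)‖ ≤ Real.exp (-(c * B.card) * t ^ 2) := fun t ht => by
    -- Sites outside `B` contribute the factor `1`, so exactly `|B|` factors decay like `exp (-c t ^
    -- 2)`.
    have hform : ∀ n : ι → ℕ, cexp ((t * (((∑ i ∈ B, n i : ℕ) - m : ℤ) : ℝ) : ℝ) * I)
        = cexp ((-(t * m) : ℝ) * I) * ∏ i, (if i ∈ B then cexp ((t * (n i : ℝ) : ℝ) * I) else 1) :=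
      fun n => by
      rw [Finset.prod_ite_mem, Finset.univ_inter, ← Complex.exp_sum, ← Complex.exp_add,
        ← Finset.sum_mul, ← add_mul]
      congr 2
      push_cast
      rw [mul_sub, Finset.mul_sum]
      ring
    simp_rw [hform]
    rw [integral_const_mul, norm_mul, norm_cexp_ofReal_mul_I, one_mul,
      integral_fintype_prod_eq_prod (𝕜 := ℂ)
        (f := fun i (k : ℕ) => if i ∈ B then cexp ((t * (k : ℝ) : ℝ) * I) else 1), norm_prod]
    have hone : ∀ i : ι, ‖∫ k : ℕ, (if i ∈ B then cexp ((t * (k : ℝ) : ℝ) * I) else 1) ∂ν‖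
        ≤ if i ∈ B then Real.exp (-c * t ^ 2) else 1 := fun i => by
      split_ifs
      · have h2 := norm_jointChar_le h0 h1 (fun k => (k : ℝ)) (fun _ => 0) t 0
        simp only [jointChar, add_zero, mul_zero, Nat.cast_one, Nat.cast_zero, sub_zero,
          mul_one] at h2
        refine h2.trans (Real.exp_le_exp.mpr ?_)
        have h3 : |t| ≤ 4 := by
          rw [abs_le]
          constructor <;> linarith [ht.1, ht.2, Real.pi_lt_four]
        have h4 := mul_le_mul_of_nonneg_left (sq_div_le_one_sub_cos h3) (mul_pos h0 h1).le
        rw [hc]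
        linarith
      · simp
    refine (Finset.prod_le_prod (fun i _ => norm_nonneg _) fun i _ => hone i).trans_eq ?_
    rw [Finset.prod_ite_mem, Finset.univ_inter, Finset.prod_const, ← Real.exp_nat_mul]
    congr 1
    ring
  have hle : -Real.pi ≤ Real.pi := by linarith [Real.pi_pos]
  rw [intervalIntegral.integral_of_le hle]
  refine (norm_integral_le_of_norm_le (integrable_exp_neg_mul_sq hc0).integrableOn
    ((ae_restrict_iff' measurableSet_Ioc).mpr (.of_forall hbound))).trans ?_
  rw [← integral_gaussian]
  exact setIntegral_le_integral (integrable_exp_neg_mul_sq hc0)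
    (.of_forall fun t => (Real.exp_pos _).le)

end Fourier

end ZeroRange

namespace ZeroRange

/-! ### The local limit theorem -/

section LocalLimit

open Complex

/-- Telescoping: the factors are exchanged one at a time, and all the others have modulus at most
`1`. -/
lemma norm_prod_sub_prod_le_sum {ι : Type*} (s : Finset ι) (a b : ι → ℂ)
    (ha : ∀ i ∈ s, ‖a i‖ ≤ 1) (hb : ∀ i ∈ s, ‖b i‖ ≤ 1) :
    ‖∏ i ∈ s, a i - ∏ i ∈ s, b i‖ ≤ ∑ i ∈ s, ‖a i - b i‖ := by
  classical
  induction s using Finset.induction_on with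
  | empty => simp
  | insert j s hj ih =>
    rw [Finset.prod_insert hj, Finset.prod_insert hj, Finset.sum_insert hj]
    have h1 : a j * ∏ i ∈ s, a i - b j * ∏ i ∈ s, b i
        = (a j - b j) * ∏ i ∈ s, a i + b j * (∏ i ∈ s, a i - ∏ i ∈ s, b i) := by ring
    rw [h1]
    refine (norm_add_le _ _).trans (add_le_add ?_ ?_)
    · rw [norm_mul]
      refine mul_le_of_le_one_right (norm_nonneg _) ?_
      rw [norm_prod]
      exact Finset.prod_le_one (fun i _ => norm_nonneg _)
        fun i hi => ha i (Finset.mem_insert_of_mem hi)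
    · rw [norm_mul]
      refine (mul_le_of_le_one_left (norm_nonneg _) (hb j (Finset.mem_insert_self _ _))).trans ?_
      exact ih (fun i hi => ha i (Finset.mem_insert_of_mem hi))
        fun i hi => hb i (Finset.mem_insert_of_mem hi)

/-- The constant is crude so that the bound holds for all real `x`: for `|x| > 1` each term
separately is dominated by a multiple of `|x| ^ 3`. -/
lemma norm_cexp_sub_taylor_le (x : ℝ) :
    ‖cexp ((x : ℂ) * I) - (1 + x * I - (x ^ 2 / 2 : ℝ))‖ ≤ 4 * |x| ^ 3 := by
  have hn : ‖(x : ℂ) * I‖ = |x| := by simp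
  have hx := abs_nonneg x
  rcases le_or_gt |x| 1 with h | h
  · have h1 := Complex.exp_bound (x := (x : ℂ) * I) (by rw [hn]; exact h) (n := 3) (by norm_num)
    have h2 : ∑ m ∈ Finset.range 3, ((x : ℂ) * I) ^ m / (m.factorial : ℂ)
        = 1 + x * I - (x ^ 2 / 2 : ℝ) := by
      simp only [Finset.sum_range_succ, Finset.sum_range_zero, Nat.factorial]
      push_cast
      linear_combination (x ^ 2 / 2 : ℂ) * I_sq
    rw [h2, hn] at h1
    refine h1.trans ?_
    have h3 : 0 ≤ |x| ^ 3 := by positivity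
    norm_num [Nat.factorial]
    linarith
  · have h1 : ‖cexp ((x : ℂ) * I)‖ = 1 := norm_cexp_ofReal_mul_I x
    have h2 : ‖(1 : ℂ) + x * I - (x ^ 2 / 2 : ℝ)‖ ≤ 1 + |x| + x ^ 2 / 2 := by
      refine (norm_sub_le _ _).trans (add_le_add ((norm_add_le _ _).trans_eq ?_) ?_)
      · rw [hn]; simp
      · rw [Complex.norm_real, Real.norm_of_nonneg (by positivity)]
    refine (norm_sub_le _ _).trans ?_
    rw [h1]
    have h3 : x ^ 2 = |x| ^ 2 := (sq_abs x).symm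
    have h4 : |x| ≤ |x| ^ 3 := le_self_pow₀ h.le (by norm_num)
    have h5 : |x| ^ 2 ≤ |x| ^ 3 := pow_le_pow_right₀ h.le (by norm_num)
    linarith

variable {ν : Measure ℕ} [IsProbabilityMeasure ν] {f g : ℕ → ℝ}

/-- The second moment of `u f + v g` under `ν`. -/
noncomputable def quadForm (ν : Measure ℕ) (f g : ℕ → ℝ) (u v : ℝ) : ℝ :=
  ∫ k, (u * f k + v * g k) ^ 2 ∂ν

omit [IsProbabilityMeasure ν] in
lemma quadForm_nonneg (u v : ℝ) : 0 ≤ quadForm ν f g u v :=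
  integral_nonneg fun _ => sq_nonneg _

omit [IsProbabilityMeasure ν] in
lemma quadForm_mul (c u v : ℝ) :
    quadForm ν f g (c * u) (c * v) = c ^ 2 * quadForm ν f g u v := by
  unfold quadForm
  rw [← integral_const_mul]
  congr 1
  ext k
  ring

lemma abs_linear_le (u v : ℝ) (k : ℕ) :
    |u * f k + v * g k| ≤ (|u| + |v|) * (|f k| + |g k|) := by
  refine (abs_add_le _ _).trans ?_
  rw [abs_mul, abs_mul]
  nlinarith [mul_nonneg (abs_nonneg u) (abs_nonneg (g k)),
    mul_nonneg (abs_nonneg v) (abs_nonneg (f k))]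

omit [IsProbabilityMeasure ν] in
lemma integrable_abs_add_pow (hf : ∀ p : ℕ, Integrable (fun k => |f k| ^ p) ν)
    (hg : ∀ p : ℕ, Integrable (fun k => |g k| ^ p) ν) (p : ℕ) :
    Integrable (fun k => (|f k| + |g k|) ^ p) ν := by
  refine Integrable.mono' (((hf p).add (hg p)).const_mul (2 ^ (p - 1)))
    (measurable_of_countable _).aestronglyMeasurable (.of_forall fun k => ?_)
  rw [Real.norm_of_nonneg (by positivity)]
  exact add_pow_le (abs_nonneg _) (abs_nonneg _) p

omit [IsProbabilityMeasure ν] in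
lemma integrable_of_pow_one (hf : ∀ p : ℕ, Integrable (fun k => |f k| ^ p) ν) :
    Integrable f ν := by
  have := hf 1
  simp only [pow_one] at this
  exact this.mono (measurable_of_countable _).aestronglyMeasurable (.of_forall fun k => by simp)

omit [IsProbabilityMeasure ν] in
lemma integrable_linear_sq (hf : ∀ p : ℕ, Integrable (fun k => |f k| ^ p) ν)
    (hg : ∀ p : ℕ, Integrable (fun k => |g k| ^ p) ν) (u v : ℝ) :
    Integrable (fun k => (u * f k + v * g k) ^ 2) ν := by
  refine ((integrable_abs_add_pow hf hg 2).const_mul ((|u| + |v|) ^ 2)).mono'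
    (measurable_of_countable _).aestronglyMeasurable (.of_forall fun k => ?_)
  rw [Real.norm_of_nonneg (sq_nonneg _), ← mul_pow, ← sq_abs]
  exact pow_le_pow_left₀ (abs_nonneg _) (abs_linear_le u v k) 2

omit [IsProbabilityMeasure ν] in
lemma quadForm_le (hf : ∀ p : ℕ, Integrable (fun k => |f k| ^ p) ν)
    (hg : ∀ p : ℕ, Integrable (fun k => |g k| ^ p) ν) (u v : ℝ) :
    quadForm ν f g u v ≤ (|u| + |v|) ^ 2 * ∫ k, (|f k| + |g k|) ^ 2 ∂ν := by
  unfold quadForm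
  rw [← integral_const_mul]
  refine integral_mono (integrable_linear_sq hf hg u v)
    ((integrable_abs_add_pow hf hg 2).const_mul _) fun k => ?_
  simp only
  rw [← mul_pow, ← sq_abs]
  exact pow_le_pow_left₀ (abs_nonneg _) (abs_linear_le u v k) 2

/-- Second order Taylor expansion of the joint characteristic function of centred functions. -/
lemma norm_jointChar_sub_taylor_le (hf : ∀ p : ℕ, Integrable (fun k => |f k| ^ p) ν)
    (hg : ∀ p : ℕ, Integrable (fun k => |g k| ^ p) ν) (hf0 : ∫ k, f k ∂ν = 0)
    (hg0 : ∫ k, g k ∂ν = 0) (u v : ℝ) :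
    ‖jointChar ν f g u v - (1 - quadForm ν f g u v / 2 : ℝ)‖
      ≤ (|u| + |v|) ^ 3 * (4 * ∫ k, (|f k| + |g k|) ^ 3 ∂ν) := by
  have hlin : Integrable (fun k => u * f k + v * g k) ν :=
    ((integrable_of_pow_one hf).const_mul u).add ((integrable_of_pow_one hg).const_mul v)
  have hsq := integrable_linear_sq hf hg u v
  have hlin0 : ∫ k, (u * f k + v * g k) ∂ν = 0 := by
    rw [integral_add ((integrable_of_pow_one hf).const_mul u)
      ((integrable_of_pow_one hg).const_mul v), integral_const_mul, integral_const_mul, hf0, hg0]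
    simp
  have hlinC : Integrable (fun k => ((u * f k + v * g k : ℝ) : ℂ) * I) ν := hlin.ofReal.mul_const I
  have h1 : Integrable (fun k => (1 : ℂ) + ((u * f k + v * g k : ℝ) : ℂ) * I) ν :=
    (integrable_const _).add hlinC
  have h2 : Integrable (fun k => (((u * f k + v * g k) ^ 2 / 2 : ℝ) : ℂ)) ν :=
    (hsq.div_const 2).ofReal
  have heq : ((1 - quadForm ν f g u v / 2 : ℝ) : ℂ) = ∫ k, ((1 : ℂ) + ((u * f k + v * g k : ℝ) : ℂ) * I
      - (((u * f k + v * g k) ^ 2 / 2 : ℝ) : ℂ)) ∂ν := by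
    rw [integral_sub h1 h2, integral_add (integrable_const _) hlinC,
      integral_mul_const, integral_complex_ofReal, integral_complex_ofReal, hlin0,
      integral_div, ← quadForm]
    simp
  have h12 : Integrable (fun k => (1 : ℂ) + ((u * f k + v * g k : ℝ) : ℂ) * I
      - (((u * f k + v * g k) ^ 2 / 2 : ℝ) : ℂ)) ν := h1.sub h2
  rw [heq, jointChar, ← integral_sub (integrable_cexp_ofReal_mul_I ν (measurable_of_countable _)) h12]
  refine (norm_integral_le_of_norm_le (((integrable_abs_add_pow hf hg 3).const_mul 4).const_mul
    ((|u| + |v|) ^ 3)) (.of_forall fun k => ?_)).trans_eq ?_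
  · refine (norm_cexp_sub_taylor_le _).trans ?_
    have := pow_le_pow_left₀ (abs_nonneg _) (abs_linear_le (f := f) (g := g) u v k) 3
    rw [mul_pow] at this
    linarith
  · rw [integral_const_mul, integral_const_mul]

lemma abs_exp_neg_sub_le {y : ℝ} (hy : 0 ≤ y) : |Real.exp (-y) - (1 - y)| ≤ y ^ 2 := by
  have h1 := Real.add_one_le_exp (-y)
  rw [abs_of_nonneg (by linarith)]
  rcases le_or_gt y 1 with h | h
  · have := Real.abs_exp_sub_one_sub_id_le (x := -y) (by rw [abs_neg, abs_of_nonneg hy]; exact h)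
    rw [neg_sq] at this
    linarith [le_abs_self (Real.exp (-y) - 1 - -y)]
  · have : Real.exp (-y) ≤ 1 := Real.exp_le_one_iff.mpr (by linarith)
    nlinarith

/-- Lindeberg comparison: products of characteristic functions of the form appearing in the local
limit theorem converge to Gaussians. -/
lemma tendsto_prod_jointChar (hf : ∀ p : ℕ, Integrable (fun k => |f k| ^ p) ν)
    (hg : ∀ p : ℕ, Integrable (fun k => |g k| ^ p) ν) (hf0 : ∫ k, f k ∂ν = 0)
    (hg0 : ∫ k, g k ∂ν = 0) (A B : ∀ N : ℕ, Fin N → ℝ) (D : ℝ)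
    (hD : ∀ N k, |A N k| + |B N k| ≤ D) (q : ℝ)
    (hq : Tendsto (fun N : ℕ => (N : ℝ)⁻¹ * ∑ k, quadForm ν f g (A N k) (B N k)) atTop (𝓝 q)) :
    Tendsto (fun N : ℕ => ∏ k, jointChar ν f g ((√N)⁻¹ * A N k) ((√N)⁻¹ * B N k)) atTop
      (𝓝 (Real.exp (-(q / 2)) : ℂ)) := by
  set K3 := 4 * ∫ k, (|f k| + |g k|) ^ 3 ∂ν
  set K2 := ∫ k, (|f k| + |g k|) ^ 2 ∂ν
  have hK3 : 0 ≤ K3 := mul_nonneg (by norm_num) (integral_nonneg fun k => by positivity)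
  have hK2 : 0 ≤ K2 := integral_nonneg fun k => by positivity
  have hmain : Tendsto (fun N : ℕ =>
      ∏ k, ((Real.exp (-(quadForm ν f g ((√N)⁻¹ * A N k) ((√N)⁻¹ * B N k) / 2)) : ℝ) : ℂ)) atTop
      (𝓝 (Real.exp (-(q / 2)) : ℂ)) := by
    have h1 : ∀ N : ℕ, ∏ k, ((Real.exp
        (-(quadForm ν f g ((√N)⁻¹ * A N k) ((√N)⁻¹ * B N k) / 2)) : ℝ) : ℂ)
        = ((Real.exp (-(((N : ℝ)⁻¹ * ∑ k, quadForm ν f g (A N k) (B N k)) / 2)) : ℝ) : ℂ) :=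
      fun N => by
      rw [← Complex.ofReal_prod, ← Real.exp_sum, Finset.sum_neg_distrib, ← Finset.sum_div,
        Finset.mul_sum]
      congr 5
      ext k
      rw [quadForm_mul, inv_pow, Real.sq_sqrt N.cast_nonneg]
    simp_rw [h1]
    exact (Complex.continuous_ofReal.tendsto _).comp
      ((Real.continuous_exp.tendsto _).comp (hq.div_const 2).neg)
  have herr : Tendsto (fun N : ℕ => (√N)⁻¹ * (D ^ 3 * K3) + (N : ℝ)⁻¹ * (D ^ 2 * K2 / 2) ^ 2) atTop
      (𝓝 0) := by
    have h1 : Tendsto (fun N : ℕ => (√(N : ℝ))⁻¹) atTop (𝓝 0) :=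
      tendsto_inv_atTop_zero.comp (Real.tendsto_sqrt_atTop.comp tendsto_natCast_atTop_atTop)
    have h2 : Tendsto (fun N : ℕ => (N : ℝ)⁻¹) atTop (𝓝 0) :=
      tendsto_inv_atTop_zero.comp tendsto_natCast_atTop_atTop
    simpa using (h1.mul_const (D ^ 3 * K3)).add (h2.mul_const ((D ^ 2 * K2 / 2) ^ 2))
  have hdiff : Tendsto (fun N : ℕ =>
      ∏ k, jointChar ν f g ((√N)⁻¹ * A N k) ((√N)⁻¹ * B N k) -
      ∏ k, ((Real.exp (-(quadForm ν f g ((√N)⁻¹ * A N k) ((√N)⁻¹ * B N k) / 2)) : ℝ) : ℂ)) atTop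
      (𝓝 0) := by
    refine squeeze_zero_norm' ?_ herr
    filter_upwards [eventually_gt_atTop 0] with N hN
    have hN0 : (0 : ℝ) < N := by exact_mod_cast hN
    refine (norm_prod_sub_prod_le_sum _ _ _ (fun k _ => ?_) fun k _ => ?_).trans ?_
    · refine (norm_integral_le_of_norm_le (integrable_const (1 : ℝ))
        (.of_forall fun n => (norm_cexp_ofReal_mul_I _).le)).trans ?_
      simp
    · rw [Complex.norm_real, Real.norm_of_nonneg (Real.exp_pos _).le, Real.exp_le_one_iff]
      have := quadForm_nonneg (ν := ν) (f := f) (g := g) ((√N)⁻¹ * A N k) ((√N)⁻¹ * B N k)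
      linarith
    -- Both factors are compared with `1 - Q / 2`, where `Q` is the quadratic form at scale `N ^
    -- (-1/2)`. The Taylor remainder is of order `N ^ (-3/2)` and the error of the exponential of
    -- order `N ^ (-2)`; the sum over `N` sites tends to zero.
    · have hterm : ∀ k : Fin N, ‖jointChar ν f g ((√N)⁻¹ * A N k) ((√N)⁻¹ * B N k) -
          ((Real.exp (-(quadForm ν f g ((√N)⁻¹ * A N k) ((√N)⁻¹ * B N k) / 2)) : ℝ) : ℂ)‖
          ≤ (√N)⁻¹ ^ 3 * (D ^ 3 * K3) + (N : ℝ)⁻¹ ^ 2 * (D ^ 2 * K2 / 2) ^ 2 := fun k => by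
        have hAB : |(√N)⁻¹ * A N k| + |(√N)⁻¹ * B N k| = (√N)⁻¹ * (|A N k| + |B N k|) := by
          rw [abs_mul, abs_mul, abs_of_nonneg (by positivity : 0 ≤ (√(N : ℝ))⁻¹)]
          ring
        have hABn : 0 ≤ |A N k| + |B N k| := by positivity
        have h1 := norm_jointChar_sub_taylor_le hf hg hf0 hg0 ((√N)⁻¹ * A N k) ((√N)⁻¹ * B N k)
        have hQ0 := quadForm_nonneg (ν := ν) (f := f) (g := g) ((√N)⁻¹ * A N k) ((√N)⁻¹ * B N k)
        have hQ := quadForm_le hf hg ((√N)⁻¹ * A N k) ((√N)⁻¹ * B N k)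
        rw [hAB, mul_pow] at h1 hQ
        rw [inv_pow, Real.sq_sqrt hN0.le] at hQ
        have h2 := abs_exp_neg_sub_le (div_nonneg hQ0 zero_le_two)
        rw [← Real.norm_eq_abs, ← Complex.norm_real, Complex.ofReal_sub, norm_sub_rev] at h2
        refine (norm_sub_le_norm_sub_add_norm_sub _
          ((1 - quadForm ν f g ((√N)⁻¹ * A N k) ((√N)⁻¹ * B N k) / 2 : ℝ) : ℂ) _).trans
          (add_le_add (h1.trans ?_) (h2.trans ?_))
        · rw [mul_assoc]
          refine mul_le_mul_of_nonneg_left (mul_le_mul_of_nonneg_right ?_ hK3) (by positivity)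
          exact pow_le_pow_left₀ hABn (hD N k) 3
        · rw [← mul_pow]
          refine pow_le_pow_left₀ (by positivity) ?_ 2
          have h3 : (|A N k| + |B N k|) ^ 2 ≤ D ^ 2 := pow_le_pow_left₀ hABn (hD N k) 2
          have h4 : (N : ℝ)⁻¹ * (|A N k| + |B N k|) ^ 2 * K2 ≤ (N : ℝ)⁻¹ * D ^ 2 * K2 :=
            mul_le_mul_of_nonneg_right (mul_le_mul_of_nonneg_left h3 (by positivity)) hK2
          linarith
      refine (Finset.sum_le_sum fun k _ => hterm k).trans_eq ?_
      rw [Finset.sum_const, Finset.card_univ, Fintype.card_fin, nsmul_eq_mul]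
      have h5 : (N : ℝ) * (√N)⁻¹ ^ 2 = 1 := by
        rw [inv_pow, Real.sq_sqrt hN0.le, mul_inv_cancel₀ hN0.ne']
      have h6 : (N : ℝ) * (N : ℝ)⁻¹ = 1 := mul_inv_cancel₀ hN0.ne'
      linear_combination ((√N)⁻¹ * (D ^ 3 * K3)) * h5 + ((N : ℝ)⁻¹ * (D ^ 2 * K2 / 2) ^ 2) * h6
  simpa using hdiff.add hmain

lemma continuous_jointChar : Continuous fun p : ℝ × ℝ => jointChar ν f g p.1 p.2 := by
  refine continuous_of_dominated (bound := fun _ => 1)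
    (fun p => (measurable_of_countable _).aestronglyMeasurable)
    (fun p => .of_forall fun k => (norm_cexp_ofReal_mul_I _).le) (integrable_const _)
    (.of_forall fun k => ?_)
  fun_prop

/-- The local limit theorem, with a weak perturbation by exponentials of linear statistics. -/
theorem tendsto_sqrt_mul_setIntegral (h0 : 0 < ν.real {0}) (h1 : 0 < ν.real {1}) {nbar : ℝ}
    (hf : ∀ p : ℕ, Integrable (fun k : ℕ => |(k : ℝ) - nbar| ^ p) ν)
    (hg : ∀ p : ℕ, Integrable (fun k => |g k| ^ p) ν) (hf0 : ∫ k : ℕ, ((k : ℝ) - nbar) ∂ν = 0)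
    (hg0 : ∫ k, g k ∂ν = 0) (A B : ∀ N : ℕ, Fin N → ℝ) (D : ℝ)
    (hD : ∀ N k, |A N k| + |B N k| ≤ D) (m : ℕ → ℕ) (hm : ∀ N : ℕ, |N * nbar - m N| ≤ 1)
    (q : ℝ → ℝ)
    (hq : ∀ s : ℝ, Tendsto (fun N : ℕ => (N : ℝ)⁻¹ *
      ∑ k, quadForm ν (fun k => (k : ℝ) - nbar) g (s + A N k) (B N k)) atTop (𝓝 (q s))) :
    Tendsto (fun N : ℕ => (√N : ℂ) * ∫ n in {n : Fin N → ℕ | ∑ i, n i = m N},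
        cexp ((∑ i, ((√N)⁻¹ * A N i * ((n i : ℝ) - nbar) + (√N)⁻¹ * B N i * g (n i)) : ℝ) * I)
        ∂(Measure.pi fun _ => ν)) atTop
      (𝓝 ((2 * (Real.pi : ℂ))⁻¹ * ∫ s : ℝ, (Real.exp (-(q s / 2)) : ℂ))) := by
  set f : ℕ → ℝ := fun k => (k : ℝ) - nbar with hfdef
  set c := ν.real {0} * ν.real {1} / 16 with hc
  have hc0 : 0 < c := by positivity
  set G := g 1 - g 0
  -- Only the phase difference between occupation `0` and occupation `1` enters `norm_jointChar_le`.
  -- It equals `(s + A + B * G) / √N`, so `κ` bounds the perturbation of `s`.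
  set κ := D * (1 + |G|) with hκ
  have hκb : ∀ N k, |A N k + B N k * G| ≤ κ := fun N k => by
    refine (abs_add_le _ _).trans ?_
    rw [abs_mul, hκ]
    have := hD N k
    nlinarith [abs_nonneg (A N k), abs_nonneg (B N k), abs_nonneg G,
      mul_nonneg (abs_nonneg (A N k)) (abs_nonneg G), mul_nonneg (abs_nonneg G)
      (sub_nonneg.mpr this)]
  -- The Fourier integrand after the substitution `t = s / √N`; the prefactor `√N` of the statement
  -- compensates the Jacobian.
  set Ψ : ℕ → ℝ → ℂ := fun N s => cexp (((√N)⁻¹ * s * (N * nbar - m N) : ℝ) * I) *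
    ∏ i, jointChar ν f g ((√N)⁻¹ * (s + A N i)) ((√N)⁻¹ * B N i) with hΨ
  set S : ℕ → Set ℝ := fun N => Set.Ioc (-(Real.pi * √N)) (Real.pi * √N)
  have hsqrt : Tendsto (fun N : ℕ => √(N : ℝ)) atTop atTop :=
    Real.tendsto_sqrt_atTop.comp tendsto_natCast_atTop_atTop
  have hinv : Tendsto (fun N : ℕ => (√(N : ℝ))⁻¹) atTop (𝓝 0) := tendsto_inv_atTop_zero.comp hsqrt
  have hrep : ∀ᶠ N : ℕ in atTop, (2 * (Real.pi : ℂ))⁻¹ * ∫ s, (S N).indicator (Ψ N) s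
      = (√N : ℂ) * ∫ n in {n : Fin N → ℕ | ∑ i, n i = m N},
        cexp ((∑ i, ((√N)⁻¹ * A N i * ((n i : ℝ) - nbar) + (√N)⁻¹ * B N i * g (n i)) : ℝ) * I)
        ∂(Measure.pi fun _ => ν) := by
    filter_upwards [eventually_gt_atTop 0] with N hN
    have hN0 : 0 < √(N : ℝ) := Real.sqrt_pos.mpr (by exact_mod_cast hN)
    rw [setIntegral_cexp_eq_fourier ν nbar g, Fintype.card_fin, integral_indicator
      measurableSet_Ioc, mul_left_comm]
    congr 1
    rw [← intervalIntegral.integral_of_le (by nlinarith [Real.pi_pos])]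
    have hcv := intervalIntegral.integral_comp_div (a := -(Real.pi * √N)) (b := Real.pi * √N)
      (fun t : ℝ => cexp ((t * (N * nbar - m N) : ℝ) * I) *
        ∏ i, jointChar ν f g (t + (√N)⁻¹ * A N i) ((√N)⁻¹ * B N i)) hN0.ne'
    rw [neg_div, mul_div_cancel_right₀ _ hN0.ne', Complex.real_smul] at hcv
    rw [← hcv]
    refine intervalIntegral.integral_congr fun s _ => ?_
    simp only [hΨ]
    congr 1
    · congr 3
      rw [div_eq_inv_mul]
    · refine Finset.prod_congr rfl fun i _ => ?_
      congr 1
      rw [div_eq_inv_mul, mul_add]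
  refine Tendsto.congr' hrep (Tendsto.const_mul _ ?_)
  have hlim : ∀ s : ℝ, Tendsto (fun N => (S N).indicator (Ψ N) s) atTop
      (𝓝 (Real.exp (-(q s / 2)) : ℂ)) := fun s => by
    have hS : ∀ᶠ N : ℕ in atTop, s ∈ S N := by
      filter_upwards [hsqrt.eventually_ge_atTop (|s| + 1)] with N hN
      have h3 := Real.pi_gt_three
      have h4 := abs_nonneg s
      have : |s| < Real.pi * √N := by nlinarith
      exact ⟨(abs_lt.mp this).1, (abs_lt.mp this).2.le⟩
    have h1 := tendsto_prod_jointChar hf hg hf0 hg0 (fun N k => s + A N k) B (|s| + D)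
      (fun N k => by linarith [hD N k, abs_add_le s (A N k)]) (q s) (hq s)
    have h2 : Tendsto (fun N : ℕ => cexp (((√N)⁻¹ * s * (N * nbar - m N) : ℝ) * I)) atTop
        (𝓝 1) := by
      have h3 : Tendsto (fun N : ℕ => (√N)⁻¹ * s * (N * nbar - m N)) atTop (𝓝 0) := by
        refine squeeze_zero_norm (fun N => ?_) (by simpa using hinv.mul_const |s|)
        rw [norm_mul, norm_mul, Real.norm_of_nonneg (by positivity : 0 ≤ (√(N : ℝ))⁻¹)]
        exact mul_le_of_le_one_right (by positivity) (hm N)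
      have h4 : Continuous fun x : ℝ => cexp ((x : ℂ) * I) := by fun_prop
      have h5 := (h4.tendsto 0).comp h3
      simp only [Complex.ofReal_zero, zero_mul, Complex.exp_zero] at h5
      exact h5
    refine Tendsto.congr' ?_ (by simpa only [one_mul] using h2.mul h1)
    filter_upwards [hS] with N hN
    rw [Set.indicator_of_mem hN]
  refine tendsto_integral_filter_of_dominated_convergence
    (fun s => Real.exp (c * κ ^ 2) * Real.exp (-(c / 2) * s ^ 2)) (.of_forall fun N => ?_) ?_
    ((integrable_exp_neg_mul_sq (by positivity)).const_mul _) (.of_forall hlim)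
  · refine (Continuous.aestronglyMeasurable ?_).indicator measurableSet_Ioc
    have h5 : ∀ i, Continuous fun s : ℝ =>
        jointChar ν f g ((√N)⁻¹ * (s + A N i)) ((√N)⁻¹ * B N i) := fun i =>
      continuous_jointChar.comp (f := fun s : ℝ => ((√N)⁻¹ * (s + A N i), (√N)⁻¹ * B N i))
        (by fun_prop)
    simp only [hΨ]
    fun_prop
  -- For `|s| ≤ π √N` the phase difference exceeds `π` by at most `κ / √N`, so it eventually stays
  -- within the range `4` of `sq_div_le_one_sub_cos`.
  · have hsmall : ∀ᶠ N : ℕ in atTop, (√(N : ℝ))⁻¹ * κ < 4 - Real.pi := by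
      have := hinv.mul_const κ
      rw [zero_mul] at this
      exact this.eventually_lt_const (by linarith [Real.pi_lt_four])
    filter_upwards [hsmall, eventually_gt_atTop 0] with N hN hN0
    have hNr : (0 : ℝ) < N := by exact_mod_cast hN0
    have hs0 : 0 < √(N : ℝ) := Real.sqrt_pos.mpr hNr
    refine .of_forall fun s => ?_
    by_cases hs : s ∈ S N
    swap
    · rw [Set.indicator_of_notMem hs, norm_zero]
      positivity
    rw [Set.indicator_of_mem hs]
    simp only [hΨ]
    rw [norm_mul, norm_cexp_ofReal_mul_I, one_mul, norm_prod]
    have hsabs : |s| ≤ Real.pi * √N := abs_le.mpr ⟨hs.1.le, hs.2⟩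
    have hterm : ∀ i : Fin N, ‖jointChar ν f g ((√N)⁻¹ * (s + A N i)) ((√N)⁻¹ * B N i)‖
        ≤ Real.exp ((N : ℝ)⁻¹ * (c * κ ^ 2 + -(c / 2) * s ^ 2)) := fun i => by
      refine (norm_jointChar_le h0 h1 f g _ _).trans (Real.exp_le_exp.mpr ?_)
      have hw : (√N)⁻¹ * (s + A N i) * (f 1 - f 0) + (√N)⁻¹ * B N i * (g 1 - g 0)
          = (√N)⁻¹ * (s + (A N i + B N i * G)) := by
        simp only [hfdef, G]
        push_cast
        ring
      rw [hw]
      have hb := hκb N i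
      have hw4 : |(√N)⁻¹ * (s + (A N i + B N i * G))| ≤ 4 := by
        rw [abs_mul, abs_of_pos (inv_pos.mpr hs0)]
        have h6 : (√(N : ℝ))⁻¹ * |s| ≤ Real.pi := by
          rw [inv_mul_le_iff₀ hs0, mul_comm]
          exact hsabs
        have h7 : (√(N : ℝ))⁻¹ * |s + (A N i + B N i * G)| ≤ (√(N : ℝ))⁻¹ * (|s| + κ) :=
          mul_le_mul_of_nonneg_left ((abs_add_le _ _).trans (by linarith)) (by positivity)
        linarith
      have h8 := mul_le_mul_of_nonneg_left (sq_div_le_one_sub_cos hw4) (mul_pos h0 h1).le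
      rw [mul_pow, inv_pow, Real.sq_sqrt hNr.le] at h8
      -- Half of the Gaussian decay is given up to absorb the shift; the cost is the constant `exp
      -- (c κ ^ 2)` in the dominating function.
      have h9 : s ^ 2 / 2 - κ ^ 2 ≤ (s + (A N i + B N i * G)) ^ 2 := by
        have : (A N i + B N i * G) ^ 2 ≤ κ ^ 2 := by
          rw [← sq_abs]
          exact pow_le_pow_left₀ (abs_nonneg _) hb 2
        nlinarith [sq_nonneg (s + 2 * (A N i + B N i * G))]
      have h10 := mul_le_mul_of_nonneg_left h9 (by positivity : 0 ≤ c * (N : ℝ)⁻¹)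
      have h11 : ν.real {0} * ν.real {1} * ((N : ℝ)⁻¹ * (s + (A N i + B N i * G)) ^ 2 / 16)
          = c * (N : ℝ)⁻¹ * (s + (A N i + B N i * G)) ^ 2 := by rw [hc]; ring
      linarith
    refine (Finset.prod_le_prod (fun i _ => norm_nonneg _) fun i _ => hterm i).trans_eq ?_
    rw [Finset.prod_const, Finset.card_univ, Fintype.card_fin, ← Real.exp_nat_mul,
      ← mul_assoc, mul_inv_cancel₀ hNr.ne', one_mul, Real.exp_add]

end LocalLimit

end ZeroRange

namespace ZeroRange

/-! ### The invariant measure as a conditioned product measure -/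

section Conditioning

/-- The event that `N` sites carry `m` particles in total. -/
def sumEq (N m : ℕ) : Set (Fin N → ℕ) := {n | ∑ i, n i = m}

lemma measurableSet_sumEq (N m : ℕ) : MeasurableSet (sumEq N m) :=
  (Set.to_countable _).measurableSet

lemma coe_configs (nbar : ℝ) (N : ℕ) :
    (configs nbar N : Set (Fin N → ℕ)) = sumEq N ⌊(N : ℝ) * nbar⌋₊ := by
  ext n
  simp [configs, sumEq]

lemma configs_nonempty (nbar : ℝ) (N : ℕ) : (configs nbar N).Nonempty := by
  rcases Nat.eq_zero_or_pos N with rfl | hN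
  · exact ⟨0, by simp [configs]⟩
  · refine ⟨Pi.single ⟨0, hN⟩ ⌊(N : ℝ) * nbar⌋₊, ?_⟩
    simp [configs]

variable {τ : ℕ → ℝ}

lemma configWeight_pos (hτ_pos : ∀ k, 1 ≤ k → 0 < τ k) {N : ℕ} (n : Fin N → ℕ) :
    0 < configWeight τ n :=
  inv_pos.mpr (Finset.prod_pos fun i _ => prod_rates_pos hτ_pos (n i))

/-- The fugacity and the normalisation enter only through the total `m`, hence through a constant on
`sumEq N m`. -/
lemma pi_nuMeasure_singleton (hτ_pos : ∀ k, 1 ≤ k → 0 < τ k) {a : ℝ} (ha : a ∈ params τ) {N m : ℕ}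
    {n : Fin N → ℕ} (hn : n ∈ sumEq N m) :
    (Measure.pi fun _ : Fin N => nuMeasure τ a) {n}
      = ENNReal.ofReal (a ^ m / Z τ a ^ N * configWeight τ n) := by
  have := isProbabilityMeasure_nuMeasure hτ_pos ha
  rw [Measure.pi_singleton]
  simp_rw [nuMeasure_singleton]
  rw [← ENNReal.ofReal_prod_of_nonneg fun i _ => (nu_pos hτ_pos ha _).le]
  congr 1
  simp only [nu, siteWeight, configWeight]
  rw [Finset.prod_div_distrib, Finset.prod_div_distrib, Finset.prod_pow_eq_pow_sum,
    Finset.prod_const, Finset.card_univ, Fintype.card_fin, show ∑ i, n i = m from hn]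
  ring

/-- The constant `a ^ m / Z ^ N` appears in the mass of every admissible configuration and in the
mass of the event, and cancels. This holds for every admissible `a`; later `a` is tuned to the
density. -/
theorem invMeasure_eq_cond (hτ_pos : ∀ k, 1 ≤ k → 0 < τ k) {a : ℝ} (ha : a ∈ params τ)
    (nbar : ℝ) (N : ℕ) :
    invMeasure τ nbar N
      = cond (Measure.pi fun _ : Fin N => nuMeasure τ a) (sumEq N ⌊(N : ℝ) * nbar⌋₊) := by
  have := isProbabilityMeasure_nuMeasure hτ_pos ha
  set P := Measure.pi fun _ : Fin N => nuMeasure τ a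
  set m := ⌊(N : ℝ) * nbar⌋₊
  set c := a ^ m / Z τ a ^ N
  have hc : 0 < c := div_pos (pow_pos ha.1 _)
    (pow_pos (zero_lt_one.trans_le (one_le_Z hτ_pos ha)) _)
  set W := ∑ n' ∈ configs nbar N, configWeight τ n'
  have hW : 0 < W := Finset.sum_pos (fun n _ => configWeight_pos hτ_pos n) (configs_nonempty nbar N)
  have hPE : P (sumEq N m) = ENNReal.ofReal (c * W) := by
    rw [← coe_configs, ← sum_measure_singleton, Finset.mul_sum,
      ENNReal.ofReal_sum_of_nonneg fun n _ => (mul_pos hc (configWeight_pos hτ_pos n)).le]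
    refine Finset.sum_congr rfl fun n hn => pi_nuMeasure_singleton hτ_pos ha ?_
    rw [← coe_configs]
    exact hn
  refine Measure.ext_of_singleton fun n => ?_
  rw [cond_apply (measurableSet_sumEq N m), hPE, invMeasure, Measure.finsetSum_apply]
  by_cases hn : n ∈ sumEq N m
  · have hn' : n ∈ configs nbar N := by
      rw [← Finset.mem_coe, coe_configs]
      exact hn
    rw [Finset.sum_eq_single_of_mem n hn' fun n' _ hne => by simp [hne],
      Set.inter_eq_self_of_subset_right (Set.singleton_subset_iff.mpr hn),
      pi_nuMeasure_singleton hτ_pos ha hn, ← ENNReal.ofReal_inv_of_pos (by positivity),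
      ← ENNReal.ofReal_mul (by positivity)]
    simp only [Measure.smul_apply, Measure.dirac_apply, Set.indicator_of_mem (Set.mem_singleton n),
      Pi.one_apply, smul_eq_mul, mul_one]
    congr 1
    change configWeight τ n / W = (c * W)⁻¹ * (c * configWeight τ n)
    field_simp
  · have hn' : n ∉ configs nbar N := by
      rw [← Finset.mem_coe, coe_configs]
      exact hn
    rw [Set.inter_singleton_eq_empty.mpr hn, measure_empty, mul_zero]
    refine Finset.sum_eq_zero fun n' hn'' => ?_
    have hne : n' ≠ n := fun h => hn' (h ▸ hn'')
    simp [hne]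

lemma pi_sumEq_ne_zero (hτ_pos : ∀ k, 1 ≤ k → 0 < τ k) {a : ℝ} (ha : a ∈ params τ)
    (nbar : ℝ) (N : ℕ) :
    (Measure.pi fun _ : Fin N => nuMeasure τ a) (sumEq N ⌊(N : ℝ) * nbar⌋₊) ≠ 0 := by
  obtain ⟨n, hn⟩ := configs_nonempty nbar N
  have hn' : n ∈ sumEq N ⌊(N : ℝ) * nbar⌋₊ := by
    rw [← coe_configs]
    exact hn
  refine ne_of_gt (lt_of_lt_of_le ?_ (measure_mono (Set.singleton_subset_iff.mpr hn')))
  rw [pi_nuMeasure_singleton hτ_pos ha hn', ENNReal.ofReal_pos]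
  exact mul_pos (div_pos (pow_pos ha.1 _) (pow_pos (zero_lt_one.trans_le (one_le_Z hτ_pos ha)) _))
    (configWeight_pos hτ_pos n)

lemma isProbabilityMeasure_invMeasure (hτ_pos : ∀ k, 1 ≤ k → 0 < τ k) {a : ℝ} (ha : a ∈ params τ)
    (nbar : ℝ) (N : ℕ) : IsProbabilityMeasure (invMeasure τ nbar N) := by
  have := isProbabilityMeasure_nuMeasure hτ_pos ha
  rw [invMeasure_eq_cond hτ_pos ha]
  exact cond_isProbabilityMeasure (pi_sumEq_ne_zero hτ_pos ha nbar N)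

end Conditioning

/-! ### Finite-dimensional distributions -/

section FiniteDimensional

open Complex

/-- The indicator that site `k` contributes to the height at `x`. -/
noncomputable def siteInd (N : ℕ) (x : unitInterval) (k : Fin N) : ℝ :=
  if (k : ℕ) + 1 ≤ ⌊(x : ℝ) * N⌋₊ then 1 else 0

lemma floor_mul_le (x : unitInterval) (N : ℕ) : ⌊(x : ℝ) * N⌋₊ ≤ N := by
  refine Nat.floor_le_of_le ?_
  exact mul_le_of_le_one_left N.cast_nonneg x.2.2

lemma height_eq_sum (f : ℕ → ℝ) (c : ℝ) {N : ℕ} (n : Fin N → ℕ) (x : unitInterval) :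
    height f c n x = ∑ k, (√N)⁻¹ * siteInd N x k * (f (n k) - c) := by
  rw [height, Finset.sum_filter, Finset.mul_sum]
  refine Finset.sum_congr rfl fun k _ => ?_
  simp only [siteInd]
  split_ifs <;> ring

lemma sum_ite_succ_le {N j : ℕ} (hj : j ≤ N) :
    ∑ k : Fin N, (if (k : ℕ) + 1 ≤ j then (1 : ℝ) else 0) = j := by
  rw [Fin.sum_univ_eq_sum_range (fun k => if k + 1 ≤ j then (1 : ℝ) else 0), ← Finset.sum_filter]
  have : (Finset.range N).filter (fun k => k + 1 ≤ j) = Finset.range j := by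
    ext k
    simp only [Finset.mem_filter, Finset.mem_range]
    omega
  rw [this]
  simp

lemma tendsto_inv_mul_floor (x : unitInterval) :
    Tendsto (fun N : ℕ => (N : ℝ)⁻¹ * (⌊(x : ℝ) * N⌋₊ : ℝ)) atTop (𝓝 (x : ℝ)) := by
  have h := (tendsto_nat_floor_mul_div_atTop (R := ℝ) x.2.1).comp tendsto_natCast_atTop_atTop
  refine h.congr fun N => ?_
  simp only [Function.comp]
  rw [div_eq_inv_mul]

lemma tendsto_avg_siteInd (x : unitInterval) :
    Tendsto (fun N : ℕ => (N : ℝ)⁻¹ * ∑ k, siteInd N x k) atTop (𝓝 (x : ℝ)) := by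
  refine (tendsto_inv_mul_floor x).congr fun N => ?_
  simp only [siteInd]
  rw [sum_ite_succ_le (floor_mul_le x N)]

/-- The sites contributing at `x` form an initial segment, so intersecting two of them takes the
minimum; this is the origin of `min s t` in the covariances. -/
lemma siteInd_mul (N : ℕ) (x y : unitInterval) (k : Fin N) :
    siteInd N x k * siteInd N y k = siteInd N (min x y) k := by
  wlog h : x ≤ y generalizing x y
  · rw [mul_comm, this y x (le_of_not_ge h), min_comm]
  have h1 : ⌊(x : ℝ) * N⌋₊ ≤ ⌊(y : ℝ) * N⌋₊ :=
    Nat.floor_le_floor (mul_le_mul_of_nonneg_right h N.cast_nonneg)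
  rw [min_eq_left h]
  simp only [siteInd]
  split_ifs with h2 h3
  · simp
  · omega
  · simp
  · simp

variable {ι : Type*} [Fintype ι]

lemma tendsto_avg_linear (x : ι → unitInterval) (θ : ι → ℝ) :
    Tendsto (fun N : ℕ => (N : ℝ)⁻¹ * ∑ k, ∑ j, θ j * siteInd N (x j) k) atTop
      (𝓝 (∑ j, θ j * (x j : ℝ))) := by
  have h : ∀ N : ℕ, (N : ℝ)⁻¹ * ∑ k, ∑ j, θ j * siteInd N (x j) k
      = ∑ j, θ j * ((N : ℝ)⁻¹ * ∑ k, siteInd N (x j) k) := fun N => by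
    rw [Finset.sum_comm, Finset.mul_sum]
    refine Finset.sum_congr rfl fun j _ => ?_
    rw [← Finset.mul_sum]
    ring
  simp_rw [h]
  exact tendsto_finsetSum _ fun j _ => (tendsto_avg_siteInd (x j)).const_mul _

lemma tendsto_avg_bilinear (x : ι → unitInterval) (θ η : ι → ℝ) :
    Tendsto (fun N : ℕ => (N : ℝ)⁻¹ *
      ∑ k, (∑ j, θ j * siteInd N (x j) k) * (∑ l, η l * siteInd N (x l) k)) atTop
      (𝓝 (∑ j, ∑ l, θ j * η l * min (x j : ℝ) (x l))) := by
  have h : ∀ N : ℕ, (N : ℝ)⁻¹ *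
      ∑ k, (∑ j, θ j * siteInd N (x j) k) * (∑ l, η l * siteInd N (x l) k)
      = ∑ j, ∑ l, θ j * η l * ((N : ℝ)⁻¹ * ∑ k, siteInd N (min (x j) (x l)) k) := fun N => by
    simp_rw [Finset.sum_mul_sum]
    rw [Finset.sum_comm, Finset.mul_sum]
    refine Finset.sum_congr rfl fun j _ => ?_
    rw [Finset.sum_comm, Finset.mul_sum]
    refine Finset.sum_congr rfl fun l _ => ?_
    rw [Finset.mul_sum, Finset.mul_sum, Finset.mul_sum]
    refine Finset.sum_congr rfl fun k _ => ?_
    rw [← siteInd_mul]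
    ring
  simp_rw [h]
  refine tendsto_finsetSum _ fun j _ => tendsto_finsetSum _ fun l _ => ?_
  have := (tendsto_avg_siteInd (min (x j) (x l))).const_mul (θ j * η l)
  have hmin : ((min (x j) (x l) : unitInterval) : ℝ) = min (x j : ℝ) (x l) :=
    (Subtype.mono_coe _).map_min
  rwa [hmin] at this

/-- The variance of `∑ j, (θ j * β (x j) + η j * ζ (x j))` for the limiting Gaussian process. -/
noncomputable def limitVar (α ρ γ : ℝ) (x : ι → unitInterval) (θ η : ι → ℝ) : ℝ :=
  ∑ j, ∑ l, (α * (θ j * θ l * (min (x j : ℝ) (x l) - x j * x l))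
    + 2 * ρ * (θ j * η l * (min (x j : ℝ) (x l) - x j * x l))
    + η j * η l * (γ * min (x j : ℝ) (x l) - ρ ^ 2 / α * (x j * x l)))

/-- The first bracket is the variance without conditioning. The subtracted square is the squared
covariance with the total number of particles, divided by the variance `α` of one site. -/
lemma limitVar_eq {α : ℝ} (hα : 0 < α) (ρ γ : ℝ) (x : ι → unitInterval) (θ η : ι → ℝ) :
    limitVar α ρ γ x θ η
      = (α * ∑ j, ∑ l, θ j * θ l * min (x j : ℝ) (x l)
        + 2 * ρ * ∑ j, ∑ l, θ j * η l * min (x j : ℝ) (x l)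
        + γ * ∑ j, ∑ l, η j * η l * min (x j : ℝ) (x l))
        - (α * ∑ j, θ j * (x j : ℝ) + ρ * ∑ j, η j * (x j : ℝ)) ^ 2 / α := by
  have h1 : (α * ∑ j, θ j * (x j : ℝ) + ρ * ∑ j, η j * (x j : ℝ)) ^ 2 / α
      = α * ((∑ j, θ j * (x j : ℝ)) * ∑ l, θ l * (x l : ℝ))
        + 2 * ρ * ((∑ j, θ j * (x j : ℝ)) * ∑ l, η l * (x l : ℝ))
        + ρ ^ 2 / α * ((∑ j, η j * (x j : ℝ)) * ∑ l, η l * (x l : ℝ)) := by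
    field_simp
    ring
  rw [h1, limitVar]
  simp_rw [Finset.sum_mul_sum, Finset.mul_sum, ← Finset.sum_add_distrib]
  rw [← Finset.sum_sub_distrib]
  refine Finset.sum_congr rfl fun j _ => ?_
  rw [← Finset.sum_sub_distrib]
  refine Finset.sum_congr rfl fun l _ => ?_
  ring

/-- Completing the square: a translation by `b / α` leaves the value `c - b ^ 2 / α`, which is how
conditioning on the total reduces the variance. -/
lemma integral_exp_neg_quadratic {α : ℝ} (hα : 0 < α) (b c : ℝ) :
    ∫ s : ℝ, Real.exp (-((α * s ^ 2 + 2 * b * s + c) / 2))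
      = Real.exp (-((c - b ^ 2 / α) / 2)) * ∫ s : ℝ, Real.exp (-(α * s ^ 2 / 2)) := by
  rw [← integral_add_right_eq_self (fun s : ℝ => Real.exp (-(α * s ^ 2 / 2))) (b / α),
    ← integral_const_mul]
  congr 1
  ext s
  rw [← Real.exp_add]
  congr 1
  field_simp
  ring

lemma integral_exp_neg_sq_pos {α : ℝ} (hα : 0 < α) : 0 < ∫ s : ℝ, Real.exp (-(α * s ^ 2 / 2)) := by
  have h : (fun s : ℝ => Real.exp (-(α * s ^ 2 / 2))) = fun s : ℝ => Real.exp (-(α / 2) * s ^ 2) := by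
    ext s
    congr 1
    ring
  rw [h, integral_gaussian]
  positivity

variable {ν : Measure ℕ} [IsProbabilityMeasure ν]

omit [IsProbabilityMeasure ν] in
lemma quadForm_eq {f g : ℕ → ℝ} (hf : ∀ p : ℕ, Integrable (fun k => |f k| ^ p) ν)
    (hg : ∀ p : ℕ, Integrable (fun k => |g k| ^ p) ν) (u v : ℝ) :
    quadForm ν f g u v
      = (∫ k, f k ^ 2 ∂ν) * u ^ 2 + 2 * (∫ k, f k * g k ∂ν) * (u * v) + (∫ k, g k ^ 2 ∂ν) * v ^ 2 := by
  have hf2 : Integrable (fun k => f k ^ 2) ν := by simpa using hf 2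
  have hg2 : Integrable (fun k => g k ^ 2) ν := by simpa using hg 2
  have hfg : Integrable (fun k => f k * g k) ν := by
    refine (hf2.add hg2).mono' (measurable_of_countable _).aestronglyMeasurable
      (.of_forall fun k => ?_)
    rw [Real.norm_eq_abs, abs_mul]
    have : 0 ≤ (|f k| - |g k|) ^ 2 := sq_nonneg _
    simp only [Pi.add_apply]
    nlinarith [sq_abs (f k), sq_abs (g k), abs_nonneg (f k), abs_nonneg (g k)]
  have h : ∀ k, (u * f k + v * g k) ^ 2 = u ^ 2 * f k ^ 2 + 2 * (u * v) * (f k * g k)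
      + v ^ 2 * g k ^ 2 := fun k => by ring
  simp_rw [quadForm, h]
  have h1 : Integrable (fun k => u ^ 2 * f k ^ 2 + 2 * (u * v) * (f k * g k)) ν :=
    (hf2.const_mul _).add (hfg.const_mul _)
  rw [integral_add h1 (hg2.const_mul _), integral_add (hf2.const_mul _) (hfg.const_mul _),
    integral_const_mul, integral_const_mul, integral_const_mul]
  ring

omit [IsProbabilityMeasure ν] in
-- Both `0` and `1` are charged, and `nbar` differs from at least one of them.
lemma integral_sq_sub_pos (h0 : 0 < ν.real {0}) (h1 : 0 < ν.real {1}) {nbar : ℝ}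
    (hf : ∀ p : ℕ, Integrable (fun k : ℕ => |(k : ℝ) - nbar| ^ p) ν) :
    0 < ∫ k : ℕ, ((k : ℝ) - nbar) ^ 2 ∂ν := by
  have hf2 : Integrable (fun k : ℕ => ((k : ℝ) - nbar) ^ 2) ν := by simpa using hf 2
  rw [integral_pos_iff_support_of_nonneg (fun k => sq_nonneg _) hf2]
  have h : ∃ k : ℕ, 0 < ν.real {k} ∧ (k : ℝ) - nbar ≠ 0 := by
    by_cases hn : nbar = 0
    · exact ⟨1, h1, by simp [hn]⟩
    · exact ⟨0, h0, by simpa using hn⟩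
  obtain ⟨k, hk, hne⟩ := h
  have hk' : 0 < ν {k} := (ENNReal.toReal_pos_iff.mp hk).1
  refine hk'.trans_le (measure_mono ?_)
  rw [Set.singleton_subset_iff]
  exact pow_ne_zero 2 hne

lemma abs_mul_sub_floor_le {nbar : ℝ} (hnbar : 0 ≤ nbar) (N : ℕ) :
    |(N : ℝ) * nbar - (⌊(N : ℝ) * nbar⌋₊ : ℝ)| ≤ 1 := by
  have h1 := Nat.floor_le (mul_nonneg N.cast_nonneg hnbar : 0 ≤ (N : ℝ) * nbar)
  have h2 := Nat.lt_floor_add_one ((N : ℝ) * nbar)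
  rw [abs_le]
  constructor <;> linarith

/-- The local limit theorem for linear statistics of the height functions. -/
lemma tendsto_sqrt_mul_setIntegral_height (h0 : 0 < ν.real {0}) (h1 : 0 < ν.real {1}) {nbar : ℝ}
    (hnbar : 0 ≤ nbar) {t : ℕ → ℝ} {tbar : ℝ}
    (hf : ∀ p : ℕ, Integrable (fun k : ℕ => |(k : ℝ) - nbar| ^ p) ν)
    (hg : ∀ p : ℕ, Integrable (fun k => |t k - tbar| ^ p) ν)
    (hf0 : ∫ k : ℕ, ((k : ℝ) - nbar) ∂ν = 0) (hg0 : ∫ k, (t k - tbar) ∂ν = 0)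
    {α ρ γ : ℝ} (hα : ∫ k : ℕ, ((k : ℝ) - nbar) ^ 2 ∂ν = α)
    (hρ : ∫ k : ℕ, ((k : ℝ) - nbar) * (t k - tbar) ∂ν = ρ) (hγ : ∫ k, (t k - tbar) ^ 2 ∂ν = γ)
    (x : ι → unitInterval) (θ η : ι → ℝ) :
    Tendsto (fun N : ℕ => (√N : ℂ) * ∫ n in sumEq N ⌊(N : ℝ) * nbar⌋₊,
        cexp ((∑ j, (θ j * height (fun k => (k : ℝ)) nbar n (x j) + η j * height t tbar n (x j)) : ℝ)
          * I) ∂(Measure.pi fun _ => ν)) atTop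
      (𝓝 ((2 * (Real.pi : ℂ))⁻¹ * (Real.exp (-(limitVar α ρ γ x θ η / 2)) *
        ∫ s : ℝ, Real.exp (-(α * s ^ 2 / 2)) : ℝ))) := by
  have hα0 : 0 < α := hα ▸ integral_sq_sub_pos h0 h1 hf
  set A : ∀ N : ℕ, Fin N → ℝ := fun N k => ∑ j, θ j * siteInd N (x j) k
  set B : ∀ N : ℕ, Fin N → ℝ := fun N k => ∑ j, η j * siteInd N (x j) k
  have hb : ∀ (ξ : ι → ℝ) (N : ℕ) (k : Fin N), |∑ j, ξ j * siteInd N (x j) k| ≤ ∑ j, |ξ j| :=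
    fun ξ N k => by
    refine (Finset.abs_sum_le_sum_abs _ _).trans (Finset.sum_le_sum fun j _ => ?_)
    rw [abs_mul]
    refine mul_le_of_le_one_right (abs_nonneg _) ?_
    simp only [siteInd]
    split_ifs <;> simp
  set a1 := ∑ j, θ j * (x j : ℝ)
  set b1 := ∑ j, η j * (x j : ℝ)
  set a2 := ∑ j, ∑ l, θ j * θ l * min (x j : ℝ) (x l)
  set ab := ∑ j, ∑ l, θ j * η l * min (x j : ℝ) (x l)
  set b2 := ∑ j, ∑ l, η j * η l * min (x j : ℝ) (x l)
  -- The limiting exponent is the variance, under independence, of `s` times the total plus the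
  -- linear statistic; the cross term in `s` carries the covariance with the total.
  have hmain := tendsto_sqrt_mul_setIntegral h0 h1 hf hg hf0 hg0 A B
    (∑ j, |θ j| + ∑ j, |η j|) (fun N k => add_le_add (hb θ N k) (hb η N k))
    (fun N => ⌊(N : ℝ) * nbar⌋₊) (abs_mul_sub_floor_le hnbar)
    (fun s => α * s ^ 2 + 2 * (α * a1 + ρ * b1) * s + (α * a2 + 2 * ρ * ab + γ * b2)) fun s => by
      have hlim := ((((tendsto_avg_linear x θ).const_mul (2 * α * s)).add
        ((tendsto_avg_linear x η).const_mul (2 * ρ * s))).add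
        ((((tendsto_avg_bilinear x θ θ).const_mul α).add
        ((tendsto_avg_bilinear x θ η).const_mul (2 * ρ))).add
        ((tendsto_avg_bilinear x η η).const_mul γ))).const_add (α * s ^ 2)
      refine (hlim.congr' ?_).trans_eq ?_
      · filter_upwards [eventually_gt_atTop 0] with N hN
        have hN0 : (N : ℝ) ≠ 0 := by exact_mod_cast hN.ne'
        have hconst : α * s ^ 2 = (N : ℝ)⁻¹ * ∑ _k : Fin N, α * s ^ 2 := by
          rw [Finset.sum_const, Finset.card_univ, Fintype.card_fin, nsmul_eq_mul, ← mul_assoc,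
            inv_mul_cancel₀ hN0, one_mul]
        rw [hconst]
        simp only [mul_left_comm _ ((N : ℝ)⁻¹) _, ← mul_add]
        congr 1
        simp only [Finset.mul_sum (Finset.univ : Finset (Fin N)), ← Finset.sum_add_distrib]
        refine Finset.sum_congr rfl fun k _ => ?_
        rw [quadForm_eq hf hg, hα, hρ, hγ]
        simp only [A, B]
        ring
      · congr 1
        ring
  have hval : ∫ s : ℝ, (Real.exp (-((α * s ^ 2 + 2 * (α * a1 + ρ * b1) * s
      + (α * a2 + 2 * ρ * ab + γ * b2)) / 2)) : ℂ)
      = (Real.exp (-(limitVar α ρ γ x θ η / 2)) * ∫ s : ℝ, Real.exp (-(α * s ^ 2 / 2)) : ℝ) := by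
    rw [integral_complex_ofReal, integral_exp_neg_quadratic hα0, limitVar_eq hα0]
  rw [hval] at hmain
  refine hmain.congr fun N => ?_
  congr 2
  ext n
  congr 3
  simp_rw [height_eq_sum, Finset.mul_sum]
  rw [Finset.sum_add_distrib, Finset.sum_add_distrib]
  simp only [A, B]
  congr 1 <;>
  · rw [Finset.sum_comm]
    refine Finset.sum_congr rfl fun k _ => ?_
    simp only [Finset.mul_sum, Finset.sum_mul]
    refine Finset.sum_congr rfl fun j _ => ?_
    ring

/-- The local limit theorem for the total number of particles. -/
lemma tendsto_sqrt_mul_measureReal_sumEq (h0 : 0 < ν.real {0}) (h1 : 0 < ν.real {1}) {nbar : ℝ}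
    (hnbar : 0 ≤ nbar) (hf : ∀ p : ℕ, Integrable (fun k : ℕ => |(k : ℝ) - nbar| ^ p) ν)
    (hf0 : ∫ k : ℕ, ((k : ℝ) - nbar) ∂ν = 0) :
    Tendsto (fun N : ℕ => √N * (Measure.pi fun _ : Fin N => ν).real (sumEq N ⌊(N : ℝ) * nbar⌋₊)) atTop
      (𝓝 ((2 * Real.pi)⁻¹ *
        ∫ s : ℝ, Real.exp (-((∫ k : ℕ, ((k : ℝ) - nbar) ^ 2 ∂ν) * s ^ 2 / 2)))) := by
  -- With an empty family of test points the exponential is `1`, and the integral reduces to the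
  -- probability of the event.
  have h := tendsto_sqrt_mul_setIntegral_height h0 h1 hnbar (t := fun _ => 0) (tbar := 0) hf
    (fun p => by simp) hf0 (by simp) rfl rfl rfl (fun i : Fin 0 => i.elim0) (fun i => i.elim0)
    (fun i => i.elim0)
  simp only [limitVar, Finset.univ_eq_empty, Finset.sum_empty, zero_div, neg_zero, Real.exp_zero,
    one_mul, Complex.ofReal_zero, zero_mul, Complex.exp_zero, setIntegral_const, Complex.real_smul,
    mul_one] at h
  have h2 := (Complex.continuous_re.tendsto _).comp h
  have e1 : ∀ N : ℕ, (Complex.re ∘ fun N : ℕ => (√N : ℂ) *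
      (((Measure.pi fun _ : Fin N => ν).real (sumEq N ⌊(N : ℝ) * nbar⌋₊) : ℝ) : ℂ)) N
      = √N * (Measure.pi fun _ : Fin N => ν).real (sumEq N ⌊(N : ℝ) * nbar⌋₊) := fun N => by
    simp only [Function.comp]
    rw [← Complex.ofReal_mul, Complex.ofReal_re]
  refine (h2.congr e1).trans_eq ?_
  congr 1
  rw [← Complex.ofReal_ofNat, ← Complex.ofReal_mul, ← Complex.ofReal_inv, ← Complex.ofReal_mul,
    Complex.ofReal_re]

/-- Convergence of the characteristic functions of the finite-dimensional distributions. -/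
theorem tendsto_integral_cond_height (h0 : 0 < ν.real {0}) (h1 : 0 < ν.real {1}) {nbar : ℝ}
    (hnbar : 0 ≤ nbar) {t : ℕ → ℝ} {tbar : ℝ}
    (hf : ∀ p : ℕ, Integrable (fun k : ℕ => |(k : ℝ) - nbar| ^ p) ν)
    (hg : ∀ p : ℕ, Integrable (fun k => |t k - tbar| ^ p) ν)
    (hf0 : ∫ k : ℕ, ((k : ℝ) - nbar) ∂ν = 0) (hg0 : ∫ k, (t k - tbar) ∂ν = 0)
    {α ρ γ : ℝ} (hα : ∫ k : ℕ, ((k : ℝ) - nbar) ^ 2 ∂ν = α)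
    (hρ : ∫ k : ℕ, ((k : ℝ) - nbar) * (t k - tbar) ∂ν = ρ) (hγ : ∫ k, (t k - tbar) ^ 2 ∂ν = γ)
    (x : ι → unitInterval) (θ η : ι → ℝ) :
    Tendsto (fun N : ℕ => ∫ n,
        cexp ((∑ j, (θ j * height (fun k => (k : ℝ)) nbar n (x j) + η j * height t tbar n (x j)) : ℝ)
          * I) ∂(cond (Measure.pi fun _ : Fin N => ν) (sumEq N ⌊(N : ℝ) * nbar⌋₊))) atTop
      (𝓝 (Real.exp (-(limitVar α ρ γ x θ η / 2)) : ℂ)) := by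
  have hα0 : 0 < α := hα ▸ integral_sq_sub_pos h0 h1 hf
  have hnum := tendsto_sqrt_mul_setIntegral_height h0 h1 hnbar hf hg hf0 hg0 hα hρ hγ x θ η
  have hden := (Complex.continuous_ofReal.tendsto _).comp
    (tendsto_sqrt_mul_measureReal_sumEq h0 h1 hnbar hf hf0)
  rw [hα] at hden
  have hJ := integral_exp_neg_sq_pos hα0
  have hlimne : (((2 * Real.pi)⁻¹ * ∫ s : ℝ, Real.exp (-(α * s ^ 2 / 2)) : ℝ) : ℂ) ≠ 0 := by
    rw [Complex.ofReal_ne_zero]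
    positivity
  refine ((hnum.div hden hlimne).congr' ?_).trans_eq ?_
  · filter_upwards [eventually_gt_atTop 0] with N hN
    have hN0 : (√(N : ℝ) : ℂ) ≠ 0 := by
      rw [Complex.ofReal_ne_zero]
      exact (Real.sqrt_pos.mpr (by exact_mod_cast hN)).ne'
    simp only [Pi.div_apply, Function.comp]
    rw [ProbabilityTheory.cond, integral_smul_measure, ENNReal.toReal_inv, ← measureReal_def, Complex.real_smul,
      Complex.ofReal_mul, mul_div_mul_left _ _ hN0, div_eq_inv_mul, Complex.ofReal_inv]
  · congr 1
    rw [div_eq_iff hlimne]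
    push_cast
    ring

end FiniteDimensional

end ZeroRange

namespace ZeroRange

/-! ### Moments of sums of independent centred variables -/

section Moments

lemma integrable_abs_sum_pow {Ω ι : Type*} [MeasurableSpace Ω] {P : Measure Ω}
    [IsProbabilityMeasure P] {X : ι → Ω → ℝ} (hm : ∀ i, Measurable (X i))
    (hint : ∀ i (p : ℕ), Integrable (fun ω => |X i ω| ^ p) P) (B : Finset ι) (p : ℕ) :
    Integrable (fun ω => |∑ i ∈ B, X i ω| ^ p) P := by
  classical
  induction B using Finset.induction_on with
  | empty => simp
  | insert j B hj ih =>
    refine (((hint j p).add ih).const_mul (2 ^ (p - 1))).mono'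
      ((Finset.measurable_fun_sum _ fun i _ => hm i).abs.pow_const p).aestronglyMeasurable
      (.of_forall fun ω => ?_)
    rw [Real.norm_of_nonneg (by positivity), Finset.sum_insert hj]
    exact (pow_le_pow_left₀ (abs_nonneg _) (abs_add_le _ _) p).trans
      (add_pow_le (abs_nonneg _) (abs_nonneg _) p)

lemma integrable_pow_of_abs {Ω : Type*} [MeasurableSpace Ω] {P : Measure Ω} {Y : Ω → ℝ}
    (hY : Measurable Y) {p : ℕ} (h : Integrable (fun ω => |Y ω| ^ p) P) :
    Integrable (fun ω => Y ω ^ p) P :=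
  h.mono (hY.pow_const p).aestronglyMeasurable (.of_forall fun ω => by simp)

/-- The `p`-th moment of a sum of independent centred variables with bounded moments is of order
`|B| ^ (p / 2)`. -/
theorem exists_abs_integral_sum_pow_le (M : ℕ → ℝ) (p : ℕ) :
    ∃ K : ℝ, 0 ≤ K ∧ ∀ {Ω ι : Type} [MeasurableSpace Ω] {P : Measure Ω} [IsProbabilityMeasure P]
      {X : ι → Ω → ℝ}, iIndepFun X P → (∀ i, Measurable (X i)) →
      (∀ i (q : ℕ), Integrable (fun ω => |X i ω| ^ q) P) → (∀ i, ∫ ω, X i ω ∂P = 0) →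
      (∀ i (q : ℕ), |∫ ω, X i ω ^ q ∂P| ≤ M q) → ∀ B : Finset ι,
      |∫ ω, (∑ i ∈ B, X i ω) ^ p ∂P| ≤ K * (B.card : ℝ) ^ (p / 2) := by
  classical
  induction p using Nat.strong_induction_on with
  | _ p ih =>
    rcases Nat.lt_or_ge p 2 with hp | hp
    · refine ⟨1, zero_le_one, fun {Ω ι} _ P _ X hX hm hint h0 hM B => ?_⟩
      interval_cases p
      · simp
      · have hX1 : ∀ i, Integrable (X i) P := fun i => by
          have := integrable_pow_of_abs (hm i) (hint i 1)
          simpa using this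
        simp only [pow_one]
        rw [integral_finsetSum _ fun i _ => hX1 i, Finset.sum_eq_zero fun i _ => h0 i]
        simp
    · choose! K hK0 hK using ih
      obtain ⟨e, rfl⟩ : ∃ e, p = e + 2 := ⟨p - 2, by omega⟩
      -- Collects the constants of the binomial expansion of `(S + X j) ^ (e + 2)`. The power `k = e
      -- + 1` is absent because it multiplies the first moment of `X j`, which is zero.
      set D := ∑ k ∈ Finset.range (e + 1), K k * |M (e + 2 - k)| * ((e + 2).choose k : ℝ) with hD
      have hD0 : 0 ≤ D := Finset.sum_nonneg fun k hk =>
        mul_nonneg (mul_nonneg (hK0 k (by simp at hk; omega)) (abs_nonneg _)) (Nat.cast_nonneg _)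
      refine ⟨D, hD0, fun {Ω ι} _ P _ X hX hm hint h0 hM B => ?_⟩
      have hdiv : (e + 2) / 2 = e / 2 + 1 := by omega
      rw [hdiv]
      induction B using Finset.induction_on with
      | empty => simp
      | insert j B hj ihB =>
        have hSm : Measurable fun ω => ∑ i ∈ B, X i ω := Finset.measurable_fun_sum _ fun i _ => hm i
        have hSint : ∀ q : ℕ, Integrable (fun ω => (∑ i ∈ B, X i ω) ^ q) P := fun q =>
          integrable_pow_of_abs hSm (integrable_abs_sum_pow hm hint B q)
        have hXint : ∀ q : ℕ, Integrable (fun ω => X j ω ^ q) P := fun q =>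
          integrable_pow_of_abs (hm j) (hint j q)
        have hind : IndepFun (fun ω => ∑ i ∈ B, X i ω) (X j) P := by
          have := hX.indepFun_finsetSum_of_notMem hm hj
          rwa [Finset.sum_fn] at this
        have hind' : ∀ a b : ℕ, IndepFun (fun ω => (∑ i ∈ B, X i ω) ^ a) (fun ω => X j ω ^ b) P :=
          fun a b => hind.comp (measurable_id.pow_const a) (measurable_id.pow_const b)
        have hprod : ∀ a b : ℕ, ∫ ω, (∑ i ∈ B, X i ω) ^ a * X j ω ^ b ∂P
            = (∫ ω, (∑ i ∈ B, X i ω) ^ a ∂P) * ∫ ω, X j ω ^ b ∂P := fun a b =>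
          (hind' a b).integral_fun_mul_eq_mul_integral (hSint a).aestronglyMeasurable
            (hXint b).aestronglyMeasurable
        have hexp : ∫ ω, (∑ i ∈ insert j B, X i ω) ^ (e + 2) ∂P
            = ∑ k ∈ Finset.range (e + 1), (∫ ω, (∑ i ∈ B, X i ω) ^ k ∂P) *
                (∫ ω, X j ω ^ (e + 2 - k) ∂P) * ((e + 2).choose k : ℝ)
              + ∫ ω, (∑ i ∈ B, X i ω) ^ (e + 2) ∂P := by
          have h1 : ∀ ω, (∑ i ∈ insert j B, X i ω) ^ (e + 2)
              = ∑ k ∈ Finset.range (e + 2 + 1), (∑ i ∈ B, X i ω) ^ k * X j ω ^ (e + 2 - k) *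
                ((e + 2).choose k : ℝ) := fun ω => by
            rw [Finset.sum_insert hj, add_comm, add_pow]
          simp_rw [h1]
          rw [integral_finsetSum]
          · simp_rw [integral_mul_const, hprod]
            rw [Finset.sum_range_succ, Finset.sum_range_succ]
            have h2 : e + 2 - (e + 1) = 1 := by omega
            simp [h2, h0 j]
          · intro k _
            exact ((hind' k (e + 2 - k)).integrable_mul (hSint k) (hXint _)).mul_const _
        rw [hexp, Finset.card_insert_of_notMem hj]
        push_cast
        have hB0 : (0 : ℝ) ≤ B.card := Nat.cast_nonneg _
        have hfirst : |∑ k ∈ Finset.range (e + 1), (∫ ω, (∑ i ∈ B, X i ω) ^ k ∂P) *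
            (∫ ω, X j ω ^ (e + 2 - k) ∂P) * ((e + 2).choose k : ℝ)|
            ≤ D * ((B.card : ℝ) + 1) ^ (e / 2) := by
          refine (Finset.abs_sum_le_sum_abs _ _).trans ?_
          rw [hD, Finset.sum_mul]
          refine Finset.sum_le_sum fun k hk => ?_
          have hk' : k ≤ e := by simp at hk; omega
          rw [abs_mul, abs_mul, Nat.abs_cast]
          have h3 := hK k (by omega) hX hm hint h0 hM B
          have h4 : (B.card : ℝ) ^ (k / 2) ≤ ((B.card : ℝ) + 1) ^ (e / 2) :=
            (pow_le_pow_left₀ hB0 (by linarith) _).trans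
              (pow_le_pow_right₀ (by linarith) (by omega))
          have h5 := (hM j (e + 2 - k)).trans (le_abs_self _)
          have hKk := hK0 k (by omega)
          calc _ ≤ (K k * ((B.card : ℝ) + 1) ^ (e / 2)) * |M (e + 2 - k)| * ((e + 2).choose k : ℝ) := by
                gcongr
                exact h3.trans (mul_le_mul_of_nonneg_left h4 hKk)
            _ = _ := by ring
        -- With `b = |B|`, the two contributions add up to `D (b + 1) ^ (e / 2) * (1 + b)`, exactly
        -- the bound for `b + 1` sites.
        have hlast : D * (B.card : ℝ) ^ (e / 2 + 1) ≤ D * ((B.card : ℝ) * ((B.card : ℝ) + 1) ^ (e / 2)) := by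
          refine mul_le_mul_of_nonneg_left ?_ hD0
          rw [pow_succ, mul_comm]
          exact mul_le_mul_of_nonneg_left (pow_le_pow_left₀ hB0 (by linarith) _) hB0
        refine (abs_add_le _ _).trans ((add_le_add hfirst (ihB.trans hlast)).trans_eq ?_)
        ring

end Moments

/-! ### A maximal inequality -/

section Maximal

/-- The maximal increment `max_{j ≤ l} |S (a + j) - S a|`. -/
noncomputable def maxIncr {Ω : Type*} (S : ℕ → Ω → ℝ) (a l : ℕ) (ω : Ω) : ℝ≥0∞ :=
  (Finset.range (l + 1)).sup fun j => ‖S (a + j) ω - S a ω‖ₑ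

lemma enorm_sub_le_maxIncr {Ω : Type*} (S : ℕ → Ω → ℝ) {a l j : ℕ} (hj : j ≤ l) (ω : Ω) :
    ‖S (a + j) ω - S a ω‖ₑ ≤ maxIncr S a l ω :=
  Finset.le_sup (f := fun j => ‖S (a + j) ω - S a ω‖ₑ) (Finset.mem_range.mpr (by omega))

lemma measurable_maxIncr {Ω : Type*} [MeasurableSpace Ω] {S : ℕ → Ω → ℝ}
    (hS : ∀ j, Measurable (S j)) (a l : ℕ) : Measurable (maxIncr S a l) := by
  have h : maxIncr S a l
      = (Finset.range (l + 1)).sup fun j ω => ‖S (a + j) ω - S a ω‖ₑ := by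
    ext ω
    rw [maxIncr, Finset.sup_apply]
  rw [h]
  exact Finset.sup_induction measurable_const (fun _ h1 _ h2 => h1.sup h2)
    fun j _ => ((hS _).sub (hS _)).enorm

/-- Compare `x` with `ε y` for `ε` so small that `(1 + ε) ^ p < 3 / 2`. Keeping the factor of `y ^
p` close to `1` allows the maximal inequality below to close by induction; a factor `2 ^ (p - 1)`
would be too large. -/
lemma exists_add_pow_le (p : ℕ) : ∃ C : ℝ, 0 ≤ C ∧ ∀ x y : ℝ≥0∞,
    (x + y) ^ p ≤ ENNReal.ofReal (3 / 2) * y ^ p + ENNReal.ofReal C * x ^ p := by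
  have h1 : ∀ᶠ ε in 𝓝[>] (0 : ℝ), (1 + ε) ^ p < 3 / 2 := by
    have : Tendsto (fun ε : ℝ => (1 + ε) ^ p) (𝓝[>] 0) (𝓝 ((1 + 0) ^ p)) :=
      (Continuous.tendsto (by fun_prop) 0).mono_left nhdsWithin_le_nhds
    exact this.eventually_lt_const (by norm_num)
  obtain ⟨ε, hε, hε0⟩ := (h1.and self_mem_nhdsWithin).exists
  have hε0 : 0 < ε := hε0
  refine ⟨(1 + ε⁻¹) ^ p, by positivity, fun x y => ?_⟩
  rcases le_total x (ENNReal.ofReal ε * y) with h | h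
  · refine le_add_right ?_
    calc (x + y) ^ p ≤ (ENNReal.ofReal (1 + ε) * y) ^ p := by
          gcongr
          rw [ENNReal.ofReal_add zero_le_one hε0.le, ENNReal.ofReal_one, add_mul, one_mul, add_comm]
          gcongr
      _ = ENNReal.ofReal ((1 + ε) ^ p) * y ^ p := by
          rw [mul_pow, ENNReal.ofReal_pow (by positivity)]
      _ ≤ _ := by gcongr
  · refine le_add_left ?_
    have hy : y ≤ ENNReal.ofReal ε⁻¹ * x := by
      calc y = ENNReal.ofReal ε⁻¹ * (ENNReal.ofReal ε * y) := by
            rw [← mul_assoc, ← ENNReal.ofReal_mul (by positivity), inv_mul_cancel₀ hε0.ne',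
              ENNReal.ofReal_one, one_mul]
        _ ≤ _ := by gcongr
    calc (x + y) ^ p ≤ (ENNReal.ofReal (1 + ε⁻¹) * x) ^ p := by
          gcongr
          rw [ENNReal.ofReal_add zero_le_one (by positivity), ENNReal.ofReal_one, add_mul, one_mul]
          gcongr
      _ = _ := by rw [mul_pow, ENNReal.ofReal_pow (by positivity)]

/-- Points up to `h` are measured from `a`; later points are measured from `a + h + 1`, at the price
of a single increment. A sum of powers bounds the power of the maximum of the two cases. -/
lemma maxIncr_pow_le {Ω : Type*} (S : ℕ → Ω → ℝ) (a l h p : ℕ) (hh : h + 1 ≤ l) (ω : Ω) :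
    maxIncr S a l ω ^ p ≤ maxIncr S a h ω ^ p
      + (‖S (a + (h + 1)) ω - S a ω‖ₑ + maxIncr S (a + (h + 1)) (l - (h + 1)) ω) ^ p := by
  have hmax : maxIncr S a l ω ≤ max (maxIncr S a h ω)
      (‖S (a + (h + 1)) ω - S a ω‖ₑ + maxIncr S (a + (h + 1)) (l - (h + 1)) ω) := by
    refine Finset.sup_le fun j hj => ?_
    have hj' : j ≤ l := by simp at hj; omega
    rcases Nat.lt_or_ge h j with hlt | hge
    · refine le_max_of_le_right ?_
      have h1 := enorm_sub_le_maxIncr S (a := a + (h + 1)) (l := l - (h + 1)) (j := j - (h + 1))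
        (by omega) ω
      have h2 : a + (h + 1) + (j - (h + 1)) = a + j := by omega
      rw [h2] at h1
      calc ‖S (a + j) ω - S a ω‖ₑ
          = ‖(S (a + (h + 1)) ω - S a ω) + (S (a + j) ω - S (a + (h + 1)) ω)‖ₑ := by
            congr 1; ring
        _ ≤ _ := (enorm_add_le _ _).trans (by gcongr)
    · exact le_max_of_le_left (enorm_sub_le_maxIncr S hge ω)
  rcases le_max_iff.mp hmax with h1 | h1
  · exact le_add_right (pow_le_pow_left₀ zero_le h1 p)
  · exact le_add_left (pow_le_pow_left₀ zero_le h1 p)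

/-- Moment bounds of order `2 q ≥ 4` on the increments give the same bounds for the maximal
increments. -/
theorem exists_lintegral_maxIncr_le (q : ℕ) (hq : 2 ≤ q) (C0 : ℝ) (hC0 : 0 ≤ C0) :
    ∃ K : ℝ, 0 ≤ K ∧ ∀ {Ω : Type} [MeasurableSpace Ω] {P : Measure Ω} {S : ℕ → Ω → ℝ} {N : ℕ},
      (∀ j, Measurable (S j)) →
      (∀ a l, a + l ≤ N → ∫⁻ ω, ‖S (a + l) ω - S a ω‖ₑ ^ (2 * q) ∂P
        ≤ ENNReal.ofReal (C0 * (l : ℝ) ^ q)) →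
      ∀ l a, a + l ≤ N → ∫⁻ ω, maxIncr S a l ω ^ (2 * q) ∂P ≤ ENNReal.ofReal (K * (l : ℝ) ^ q) := by
  obtain ⟨C, hC, hadd⟩ := exists_add_pow_le (2 * q)
  -- The recursion closes since both halves have length at most `l / 2` and `2 ^ q ≥ 4`: the three
  -- contributions are `1/4`, `3/8` and `1/4` of `K l ^ q`, in total less than one.
  refine ⟨4 * (C * C0), by positivity, fun {Ω} _ P S N hS hinc l => ?_⟩
  set K := 4 * (C * C0) with hKdef
  have hK : 0 ≤ K := by positivity
  induction l using Nat.strong_induction_on with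
  | _ l ih =>
    intro a hal
    rcases Nat.eq_zero_or_pos l with rfl | hl
    · have h1 : ∀ ω, maxIncr S a 0 ω ^ (2 * q) = 0 := fun ω => by
        have : maxIncr S a 0 ω = 0 := by simp [maxIncr]
        rw [this, zero_pow (by omega)]
      simp [h1]
    -- The point at offset `h + 1` belongs to neither half of the index range, so that both `h` and
    -- `l - (h + 1)` are at most `l / 2`.
    · obtain ⟨h, hh1, hh2, hh3⟩ : ∃ h, h + 1 ≤ l ∧ 2 * h ≤ l ∧ 2 * (l - (h + 1)) ≤ l :=
        ⟨(l + 1) / 2 - 1, by omega, by omega, by omega⟩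
      set r := l - (h + 1) with hr
      have hb1 := ih h (by omega) a (by omega)
      have hb2 := ih r (by omega) (a + (h + 1)) (by omega)
      have hb3 := hinc a (h + 1) (by omega)
      have hmeas' : Measurable fun ω => ‖S (a + (h + 1)) ω - S a ω‖ₑ ^ (2 * q) :=
        ((hS _).sub (hS _)).enorm.pow_const _
      have hmeas := fun b k => (measurable_maxIncr hS b k).pow_const (2 * q)
      calc ∫⁻ ω, maxIncr S a l ω ^ (2 * q) ∂P
          ≤ ∫⁻ ω, (maxIncr S a h ω ^ (2 * q)
            + (ENNReal.ofReal (3 / 2) * maxIncr S (a + (h + 1)) r ω ^ (2 * q)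
            + ENNReal.ofReal C * ‖S (a + (h + 1)) ω - S a ω‖ₑ ^ (2 * q))) ∂P :=
            lintegral_mono fun ω => (maxIncr_pow_le S a l h (2 * q) hh1 ω).trans
              (add_le_add_right (hadd _ _) _)
        _ = ∫⁻ ω, maxIncr S a h ω ^ (2 * q) ∂P
            + (ENNReal.ofReal (3 / 2) * ∫⁻ ω, maxIncr S (a + (h + 1)) r ω ^ (2 * q) ∂P
            + ENNReal.ofReal C * ∫⁻ ω, ‖S (a + (h + 1)) ω - S a ω‖ₑ ^ (2 * q) ∂P) := by
            rw [lintegral_add_left (hmeas _ _), lintegral_add_left ((hmeas _ _).const_mul _),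
              lintegral_const_mul _ (hmeas _ _),
              lintegral_const_mul _ hmeas']
        _ ≤ ENNReal.ofReal (K * (h : ℝ) ^ q) + (ENNReal.ofReal (3 / 2) * ENNReal.ofReal (K * (r : ℝ) ^ q)
            + ENNReal.ofReal C * ENNReal.ofReal (C0 * ((h + 1 : ℕ) : ℝ) ^ q)) := by gcongr
        _ = ENNReal.ofReal (K * (h : ℝ) ^ q + (3 / 2 * (K * (r : ℝ) ^ q)
            + C * (C0 * ((h + 1 : ℕ) : ℝ) ^ q))) := by
            rw [← ENNReal.ofReal_mul (by norm_num), ← ENNReal.ofReal_mul hC,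
              ← ENNReal.ofReal_add (by positivity) (by positivity),
              ← ENNReal.ofReal_add (by positivity) (by positivity)]
        _ ≤ ENNReal.ofReal (K * (l : ℝ) ^ q) := by
            refine ENNReal.ofReal_le_ofReal ?_
            have hhalf : ∀ k : ℕ, 2 * k ≤ l → 4 * (k : ℝ) ^ q ≤ (l : ℝ) ^ q := fun k hk => by
              have h1 : (2 * (k : ℝ)) ^ q ≤ (l : ℝ) ^ q :=
                pow_le_pow_left₀ (by positivity) (by exact_mod_cast hk) q
              rw [mul_pow] at h1
              have h2 : (4 : ℝ) ≤ 2 ^ q := by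
                calc (4 : ℝ) = 2 ^ 2 := by norm_num
                  _ ≤ 2 ^ q := pow_le_pow_right₀ (by norm_num) hq
              nlinarith [pow_nonneg (Nat.cast_nonneg k : (0 : ℝ) ≤ k) q]
            have e1 := mul_le_mul_of_nonneg_left (hhalf h hh2) hK
            have e2 := mul_le_mul_of_nonneg_left (hhalf r hh3) hK
            have e3 : ((h + 1 : ℕ) : ℝ) ^ q ≤ (l : ℝ) ^ q :=
              pow_le_pow_left₀ (by positivity) (by exact_mod_cast hh1) q
            have e4 := mul_le_mul_of_nonneg_left e3 (by positivity : 0 ≤ C * C0)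
            have e5 : 0 ≤ K * (l : ℝ) ^ q := by positivity
            have e6 : C * C0 * (l : ℝ) ^ q = K * (l : ℝ) ^ q / 4 := by rw [hKdef]; ring
            linarith

end Maximal

end ZeroRange

namespace ZeroRange

/-! ### Comparison of the conditioned measure with the product measure -/

section Comparison

variable {ν : Measure ℕ} [IsProbabilityMeasure ν]

/-- Split according to the number `j` of particles in `B`: the complement then carries `m - j`,
independently of `B`, with probability at most `L`. Summing over `j` recovers at most the integral
of `H`. -/
lemma setLIntegral_sumEq_le {N : ℕ} (B : Finset (Fin N)) (m : ℕ) (L : ℝ≥0∞)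
    (hL : ∀ j : ℕ, (Measure.pi fun _ : Fin N => ν) {n : Fin N → ℕ | ∑ i ∈ Bᶜ, n i = j} ≤ L)
    (H : (B → ℕ) → ℝ≥0∞) :
    ∫⁻ n in sumEq N m, H (fun i => n i) ∂(Measure.pi fun _ => ν)
      ≤ L * ∫⁻ n, H (fun i => n i) ∂(Measure.pi fun _ : Fin N => ν) := by
  set P := Measure.pi fun _ : Fin N => ν
  have hmeas : ∀ φ : (Fin N → ℕ) → ℝ≥0∞, Measurable φ := fun φ => measurable_of_countable φ
  have hind : IndepFun (fun (n : Fin N → ℕ) (i : B) => n i) (fun n (i : (Bᶜ : Finset (Fin N))) => n i) P :=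
    (iIndepFun_pi (μ := fun _ : Fin N => ν) (X := fun _ (k : ℕ) => k)
      fun _ => measurable_id.aemeasurable).indepFun_finset B Bᶜ disjoint_compl_right
      fun i => measurable_pi_apply i
  set h : (Fin N → ℕ) → ℝ≥0∞ := fun n => H (fun i => n i)
  set F : ℕ → (Fin N → ℕ) → ℝ≥0∞ := fun j n => if ∑ i ∈ B, n i = j then h n else 0
  set G : ℕ → (Fin N → ℕ) → ℝ≥0∞ := fun j n => if ∑ i ∈ Bᶜ, n i = m - j then 1 else 0
  have hFG : ∀ j, ∫⁻ n, F j n * G j n ∂P = (∫⁻ n, F j n ∂P) * ∫⁻ n, G j n ∂P := fun j => by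
    refine lintegral_mul_eq_lintegral_mul_lintegral_of_indepFun (hmeas _) (hmeas _) ?_
    have hF : F j = (fun y : B → ℕ => if ∑ i, y i = j then H y else 0) ∘
        fun (n : Fin N → ℕ) (i : B) => n i := by
      ext n
      simp only [F, h, Function.comp, Finset.sum_coe_sort B (fun i => n i)]
    have hG : G j = (fun y : (Bᶜ : Finset (Fin N)) → ℕ => if ∑ i, y i = m - j then (1 : ℝ≥0∞) else 0) ∘
        fun (n : Fin N → ℕ) (i : (Bᶜ : Finset (Fin N))) => n i := by
      ext n
      simp only [G, Function.comp, Finset.sum_coe_sort Bᶜ (fun i => n i)]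
    rw [hF, hG]
    exact hind.comp (measurable_of_countable _) (measurable_of_countable _)
  have hGL : ∀ j, ∫⁻ n, G j n ∂P ≤ L := fun j => by
    refine le_trans (le_of_eq ?_) (hL (m - j))
    have h1 : G j = ({n : Fin N → ℕ | ∑ i ∈ Bᶜ, n i = m - j}).indicator 1 := by
      ext n
      simp [G, Set.indicator]
    rw [h1, lintegral_indicator_one ((Set.to_countable _).measurableSet)]
  have hpt : ∀ n ∈ sumEq N m, h n ≤ ∑ j ∈ Finset.range (m + 1), F j n * G j n := fun n hn => by
    have hn' : ∑ i ∈ B, n i + ∑ i ∈ Bᶜ, n i = m := by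
      rw [Finset.sum_add_sum_compl]
      exact hn
    refine le_trans (le_of_eq ?_) (Finset.single_le_sum (f := fun j => F j n * G j n)
      (fun _ _ => zero_le) (Finset.mem_range.mpr (by omega : ∑ i ∈ B, n i < m + 1)))
    have : ∑ i ∈ Bᶜ, n i = m - ∑ i ∈ B, n i := by omega
    simp only [F, G, this, if_true, mul_one]
  calc ∫⁻ n in sumEq N m, h n ∂P
      ≤ ∫⁻ n in sumEq N m, ∑ j ∈ Finset.range (m + 1), F j n * G j n ∂P :=
        setLIntegral_mono' (measurableSet_sumEq N m) hpt
    _ ≤ ∫⁻ n, ∑ j ∈ Finset.range (m + 1), F j n * G j n ∂P := setLIntegral_le_lintegral _ _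
    _ = ∑ j ∈ Finset.range (m + 1), (∫⁻ n, F j n ∂P) * ∫⁻ n, G j n ∂P := by
        rw [lintegral_finsetSum _ fun j _ => hmeas _]
        exact Finset.sum_congr rfl fun j _ => hFG j
    _ ≤ ∑ j ∈ Finset.range (m + 1), (∫⁻ n, F j n ∂P) * L := by
        gcongr with j
        exact hGL j
    _ = L * ∫⁻ n, ∑ j ∈ Finset.range (m + 1), F j n ∂P := by
        rw [← Finset.sum_mul, mul_comm, lintegral_finsetSum _ fun j _ => hmeas _]
    _ ≤ L * ∫⁻ n, h n ∂P := by
        refine mul_le_mul_right (lintegral_mono fun n => ?_) L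
        simp only [F, Finset.sum_ite_eq]
        split_ifs
        · exact le_rfl
        · exact zero_le

/-- Conditioning on the total number of particles costs at most a constant factor, for functions
of a block of sites whose complement has at least a quarter of all sites. -/
theorem exists_lintegral_cond_le (h0 : 0 < ν.real {0}) (h1 : 0 < ν.real {1}) {nbar : ℝ}
    (hnbar : 0 ≤ nbar) (hf : ∀ p : ℕ, Integrable (fun k : ℕ => |(k : ℝ) - nbar| ^ p) ν)
    (hf0 : ∫ k : ℕ, ((k : ℝ) - nbar) ∂ν = 0) :
    ∃ C : ℝ, 0 ≤ C ∧ ∃ N0 : ℕ, ∀ N ≥ N0, ∀ B : Finset (Fin N), N ≤ 4 * (Bᶜ).card →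
      ∀ H : (B → ℕ) → ℝ≥0∞,
      ∫⁻ n, H (fun i => n i) ∂(ProbabilityTheory.cond (Measure.pi fun _ : Fin N => ν)
        (sumEq N ⌊(N : ℝ) * nbar⌋₊))
      ≤ ENNReal.ofReal C * ∫⁻ n, H (fun i => n i) ∂(Measure.pi fun _ : Fin N => ν) := by
  have hα0 := integral_sq_sub_pos h0 h1 hf
  have hlim := tendsto_sqrt_mul_measureReal_sumEq h0 h1 hnbar hf hf0
  set ℓ := (2 * Real.pi)⁻¹ * ∫ s : ℝ, Real.exp (-((∫ k : ℕ, ((k : ℝ) - nbar) ^ 2 ∂ν) * s ^ 2 / 2))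
  have hℓ : 0 < ℓ := mul_pos (by positivity) (integral_exp_neg_sq_pos hα0)
  set c := ν.real {0} * ν.real {1} / 16 with hc
  have hc0 : 0 < c := by positivity
  -- The bound of `measureReal_sum_eq_le` for at least `N / 4` sites, multiplied by `√N`.
  set L := (2 * Real.pi)⁻¹ * √(4 * Real.pi / c)
  have hL0 : 0 ≤ L := by positivity
  obtain ⟨N1, hN1⟩ := eventually_atTop.mp (hlim.eventually_const_lt (half_lt_self hℓ))
  refine ⟨L / (ℓ / 2), by positivity, max N1 1, fun N hN B hB H => ?_⟩
  have hNpos : 0 < N := lt_of_lt_of_le one_pos ((le_max_right _ _).trans hN)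
  have hNr : (0 : ℝ) < N := by exact_mod_cast hNpos
  have hs0 : 0 < √(N : ℝ) := Real.sqrt_pos.mpr hNr
  set P := Measure.pi fun _ : Fin N => ν
  set m := ⌊(N : ℝ) * nbar⌋₊
  have hPE : ℓ / 2 / √N ≤ P.real (sumEq N m) := by
    rw [div_le_iff₀ hs0, mul_comm]
    exact (hN1 N ((le_max_left _ _).trans hN)).le
  have hBne : (Bᶜ).Nonempty := by
    rw [← Finset.card_pos]
    omega
  have hBc : (N : ℝ) ≤ 4 * (Bᶜ).card := by exact_mod_cast hB
  have hloc : ∀ j : ℕ, P {n : Fin N → ℕ | ∑ i ∈ Bᶜ, n i = j} ≤ ENNReal.ofReal (L / √N) := fun j => by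
    rw [← ofReal_measureReal]
    refine ENNReal.ofReal_le_ofReal ((measureReal_sum_eq_le ν h0 h1 Bᶜ hBne j).trans ?_)
    change (2 * Real.pi)⁻¹ * √(Real.pi / (c * (Bᶜ).card)) ≤ (2 * Real.pi)⁻¹ * √(4 * Real.pi / c) / √N
    rw [mul_div_assoc ((2 * Real.pi)⁻¹), ← Real.sqrt_div' _ hNr.le]
    refine mul_le_mul_of_nonneg_left (Real.sqrt_le_sqrt ?_) (by positivity)
    have hcard : (0 : ℝ) < (Bᶜ).card := by exact_mod_cast Finset.card_pos.mpr hBne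
    rw [div_div, div_le_div_iff₀ (by positivity) (by positivity)]
    have := mul_le_mul_of_nonneg_left hBc (by positivity : 0 ≤ Real.pi * c)
    linarith
  rw [ProbabilityTheory.cond, lintegral_smul_measure, smul_eq_mul]
  calc (P (sumEq N m))⁻¹ * ∫⁻ n in sumEq N m, H (fun i => n i) ∂P
      ≤ (ENNReal.ofReal (ℓ / 2 / √N))⁻¹ *
        (ENNReal.ofReal (L / √N) * ∫⁻ n, H (fun i => n i) ∂P) := by
        refine mul_le_mul' (ENNReal.inv_le_inv.mpr ?_) (setLIntegral_sumEq_le B m _ hloc H)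
        rw [← ofReal_measureReal]
        exact ENNReal.ofReal_le_ofReal hPE
    _ = ENNReal.ofReal (L / (ℓ / 2)) * ∫⁻ n, H (fun i => n i) ∂P := by
        rw [← mul_assoc, ← ENNReal.ofReal_inv_of_pos (by positivity),
          ← ENNReal.ofReal_mul (by positivity)]
        congr 2
        field_simp

end Comparison

/-! ### Moments of increments under the conditioned measure -/

section CondMoments

/-- The partial sums of `g (n k)` over the first `j` sites. -/
noncomputable def partialSum (g : ℕ → ℝ) (N j : ℕ) (n : Fin N → ℕ) : ℝ :=
  ∑ k ∈ Finset.univ.filter (fun k : Fin N => (k : ℕ) < j), g (n k)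

/-- The sites `a, …, a + l - 1`. -/
def block (N a l : ℕ) : Finset (Fin N) :=
  Finset.univ.filter fun k : Fin N => a ≤ (k : ℕ) ∧ (k : ℕ) < a + l

lemma partialSum_add_sub (g : ℕ → ℝ) (N a l : ℕ) (n : Fin N → ℕ) :
    partialSum g N (a + l) n - partialSum g N a n = ∑ k ∈ block N a l, g (n k) := by
  have h : Finset.univ.filter (fun k : Fin N => (k : ℕ) < a + l)
      = Finset.univ.filter (fun k : Fin N => (k : ℕ) < a) ∪ block N a l := by
    ext k
    simp only [block, Finset.mem_filter, Finset.mem_univ, true_and, Finset.mem_union]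
    omega
  have hd : Disjoint (Finset.univ.filter (fun k : Fin N => (k : ℕ) < a)) (block N a l) := by
    rw [Finset.disjoint_left]
    intro k
    simp only [block, Finset.mem_filter, Finset.mem_univ, true_and]
    omega
  rw [partialSum, h, Finset.sum_union hd, partialSum, add_sub_cancel_left]

lemma card_block {N a l : ℕ} (h : a + l ≤ N) : (block N a l).card = l := by
  have h1 : (block N a l).map Fin.valEmbedding = Finset.Ico a (a + l) := by
    ext k
    simp only [block, Finset.mem_map, Finset.mem_filter, Finset.mem_univ, true_and,
      Fin.valEmbedding_apply, Finset.mem_Ico]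
    exact ⟨fun ⟨i, hi, hik⟩ => hik ▸ hi, fun hk => ⟨⟨k, by omega⟩, hk, rfl⟩⟩
  rw [← Finset.card_map Fin.valEmbedding, h1, Nat.card_Ico, Nat.add_sub_cancel_left]

lemma measurable_partialSum (g : ℕ → ℝ) (N j : ℕ) : Measurable (partialSum g N j) :=
  measurable_of_countable _

variable {ν : Measure ℕ} [IsProbabilityMeasure ν] {g : ℕ → ℝ}

/-- The estimate under the product measure, before conditioning; the constant depends on the
one-site moments and on `q`, not on `N` or the block. -/
lemma exists_lintegral_sum_pow_le (hg : ∀ p : ℕ, Integrable (fun k => |g k| ^ p) ν)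
    (hg0 : ∫ k, g k ∂ν = 0) (q : ℕ) :
    ∃ K : ℝ, 0 ≤ K ∧ ∀ (N : ℕ) (B : Finset (Fin N)),
      ∫⁻ n, ‖∑ k ∈ B, g (n k)‖ₑ ^ (2 * q) ∂(Measure.pi fun _ : Fin N => ν)
        ≤ ENNReal.ofReal (K * (B.card : ℝ) ^ q) := by
  obtain ⟨K, hK0, hK⟩ := exists_abs_integral_sum_pow_le (fun p => |∫ k, g k ^ p ∂ν|) (2 * q)
  refine ⟨K, hK0, fun N B => ?_⟩
  set P := Measure.pi fun _ : Fin N => ν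
  have hmp : ∀ i : Fin N, MeasurePreserving (fun n : Fin N → ℕ => n i) P ν := fun i =>
    measurePreserving_eval (fun _ => ν) i
  have hind : iIndepFun (fun (i : Fin N) (n : Fin N → ℕ) => g (n i)) P :=
    iIndepFun_pi (μ := fun _ : Fin N => ν) (X := fun _ => g)
      fun _ => (measurable_of_countable g).aemeasurable
  have hm : ∀ i : Fin N, Measurable fun n : Fin N → ℕ => g (n i) := fun i => measurable_of_countable _
  have hint : ∀ (i : Fin N) (p : ℕ), Integrable (fun n : Fin N → ℕ => |g (n i)| ^ p) P := fun i p =>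
    (hmp i).integrable_comp_of_integrable (hg p)
  have hcomp : ∀ (i : Fin N) (φ : ℕ → ℝ), ∫ n, φ (n i) ∂P = ∫ k, φ k ∂ν := fun i φ => by
    rw [← (hmp i).map_eq, integral_map (hmp i).measurable.aemeasurable
      (measurable_of_countable φ).aestronglyMeasurable]
  have := hK hind hm hint (fun i => (hcomp i g).trans hg0)
    (fun i p => by rw [hcomp i fun k => g k ^ p]) B
  rw [Nat.mul_div_cancel_left q two_pos] at this
  have hpow : ∀ n : Fin N → ℕ, ‖∑ k ∈ B, g (n k)‖ₑ ^ (2 * q)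
      = ENNReal.ofReal ((∑ k ∈ B, g (n k)) ^ (2 * q)) := fun n => by
    rw [Real.enorm_eq_ofReal_abs, ← ENNReal.ofReal_pow (abs_nonneg _), pow_mul, sq_abs, ← pow_mul]
  simp_rw [hpow]
  rw [← ofReal_integral_eq_lintegral_ofReal
    (integrable_pow_of_abs (measurable_of_countable _) (integrable_abs_sum_pow hm hint B _))
    (.of_forall fun n => by simp only [Pi.zero_apply, pow_mul]; positivity)]
  exact ENNReal.ofReal_le_ofReal ((le_abs_self _).trans this)

/-- Maximal moment bounds under the conditioned measure. -/
theorem exists_lintegral_cond_maxIncr_le (h0 : 0 < ν.real {0}) (h1 : 0 < ν.real {1}) {nbar : ℝ}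
    (hnbar : 0 ≤ nbar) (hf : ∀ p : ℕ, Integrable (fun k : ℕ => |(k : ℝ) - nbar| ^ p) ν)
    (hf0 : ∫ k : ℕ, ((k : ℝ) - nbar) ∂ν = 0) (hg : ∀ p : ℕ, Integrable (fun k => |g k| ^ p) ν)
    (hg0 : ∫ k, g k ∂ν = 0) (q : ℕ) (hq : 2 ≤ q) :
    ∃ K : ℝ, 0 ≤ K ∧ ∃ N0 : ℕ, ∀ N ≥ N0, ∀ l a, a + l ≤ N →
      ∫⁻ n, maxIncr (partialSum g N) a l n ^ (2 * q)
        ∂(ProbabilityTheory.cond (Measure.pi fun _ : Fin N => ν) (sumEq N ⌊(N : ℝ) * nbar⌋₊))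
      ≤ ENNReal.ofReal (K * (l : ℝ) ^ q) := by
  obtain ⟨C, hC, N0, hcomp⟩ := exists_lintegral_cond_le h0 h1 hnbar hf hf0
  obtain ⟨K, hK, hmom⟩ := exists_lintegral_sum_pow_le hg hg0 q
  obtain ⟨D, hD, hadd⟩ := exists_add_pow_le (2 * q)
  obtain ⟨K', hK', hmax⟩ := exists_lintegral_maxIncr_le q hq (3 / 2 * (C * K) + D * (C * K))
    (by positivity)
  -- The maximal inequality requires no independence, so it applies to the conditioned measure once
  -- increments are controlled. `N ≥ 2` ensures that a block with `2 r ≤ N + 1` leaves at least a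
  -- quarter of the sites.
  refine ⟨K', hK', max N0 2, fun N hN => hmax (measurable_partialSum g N) fun a l hal => ?_⟩
  set Q := ProbabilityTheory.cond (Measure.pi fun _ : Fin N => ν) (sumEq N ⌊(N : ℝ) * nbar⌋₊)
  have hN2 : 2 ≤ N := (le_max_right _ _).trans hN
  have hshort : ∀ b r, b + r ≤ N → 2 * r ≤ N + 1 →
      ∫⁻ n, ‖∑ k ∈ block N b r, g (n k)‖ₑ ^ (2 * q) ∂Q ≤ ENNReal.ofReal (C * K * (r : ℝ) ^ q) :=
    fun b r hbr hr => by
    have hcard := card_block hbr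
    have hc : N ≤ 4 * ((block N b r)ᶜ).card := by
      rw [Finset.card_compl, hcard, Fintype.card_fin]
      omega
    have h2 := hcomp N ((le_max_left _ _).trans hN) (block N b r) hc
      fun y => ‖∑ k, g (y k)‖ₑ ^ (2 * q)
    have h3 : ∀ n : Fin N → ℕ, ∑ k : block N b r, g (n k) = ∑ k ∈ block N b r, g (n k) := fun n =>
      Finset.sum_coe_sort (block N b r) fun k => g (n k)
    simp only [h3] at h2
    refine h2.trans ((mul_le_mul_right (hmom N (block N b r)) _).trans_eq ?_)
    rw [← ENNReal.ofReal_mul hC, hcard, mul_assoc]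
  -- A long increment, even one over all `N` sites, is cut into two halves, each short enough for
  -- comparison with the product measure.
  obtain ⟨r, hr1, hr2⟩ : ∃ r, r ≤ l ∧ (2 * r ≤ N + 1 ∧ 2 * (l - r) ≤ N + 1) :=
    ⟨(l + 1) / 2, by omega, by omega⟩
  have hsplit : ∀ n : Fin N → ℕ, partialSum g N (a + l) n - partialSum g N a n
      = ∑ k ∈ block N a r, g (n k) + ∑ k ∈ block N (a + r) (l - r), g (n k) := fun n => by
    have e : a + l = a + r + (l - r) := by omega
    rw [← partialSum_add_sub, ← partialSum_add_sub, e]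
    ring
  have hmeas : ∀ φ : (Fin N → ℕ) → ℝ≥0∞, Measurable φ := fun φ => measurable_of_countable φ
  calc ∫⁻ n, ‖partialSum g N (a + l) n - partialSum g N a n‖ₑ ^ (2 * q) ∂Q
      ≤ ∫⁻ n, (ENNReal.ofReal (3 / 2) * ‖∑ k ∈ block N (a + r) (l - r), g (n k)‖ₑ ^ (2 * q)
        + ENNReal.ofReal D * ‖∑ k ∈ block N a r, g (n k)‖ₑ ^ (2 * q)) ∂Q := by
        refine lintegral_mono fun n => ?_
        rw [hsplit]
        exact (pow_le_pow_left₀ zero_le (enorm_add_le _ _) _).trans (hadd _ _)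
    _ = ENNReal.ofReal (3 / 2) * ∫⁻ n, ‖∑ k ∈ block N (a + r) (l - r), g (n k)‖ₑ ^ (2 * q) ∂Q
        + ENNReal.ofReal D * ∫⁻ n, ‖∑ k ∈ block N a r, g (n k)‖ₑ ^ (2 * q) ∂Q := by
        rw [lintegral_add_left (hmeas _), lintegral_const_mul _ (hmeas _),
          lintegral_const_mul _ (hmeas _)]
    _ ≤ ENNReal.ofReal (3 / 2) * ENNReal.ofReal (C * K * (l : ℝ) ^ q)
        + ENNReal.ofReal D * ENNReal.ofReal (C * K * (l : ℝ) ^ q) := by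
        gcongr
        · refine (hshort (a + r) (l - r) (by omega) hr2.2).trans (ENNReal.ofReal_le_ofReal ?_)
          gcongr
          omega
        · refine (hshort a r (by omega) hr2.1).trans (ENNReal.ofReal_le_ofReal ?_)
          gcongr
    _ = ENNReal.ofReal ((3 / 2 * (C * K) + D * (C * K)) * (l : ℝ) ^ q) := by
        rw [← ENNReal.ofReal_mul (by norm_num), ← ENNReal.ofReal_mul hD,
          ← ENNReal.ofReal_add (by positivity) (by positivity)]
        congr 1
        ring

end CondMoments

end ZeroRange

namespace ZeroRange

/-! ### Continuous interpolation of the height functions -/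

section Interpolation

/-- The truncation of a real number to `[0, 1]`. -/
noncomputable def clamp (r : ℝ) : ℝ := max 0 (min 1 r)

lemma continuous_clamp : Continuous clamp :=
  continuous_const.max (continuous_const.min continuous_id)

/-- The piecewise linear interpolation of the rescaled partial sums of `g (n k)`. -/
noncomputable def interpolation (g : ℕ → ℝ) {N : ℕ} (n : Fin N → ℕ) : C(unitInterval, ℝ) where
  toFun x := (√N)⁻¹ * ∑ k : Fin N, clamp ((x : ℝ) * N - (k : ℕ)) * g (n k)
  continuous_toFun := by
    refine continuous_const.mul (continuous_finsetSum _ fun k _ => ?_)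
    exact (continuous_clamp.comp (by fun_prop)).mul continuous_const

/-- `clamp (r - k)` is the portion of the cell `[k, k + 1]` lying to the left of `r`. Writing it
with two indicators makes the interpolation a convex combination of consecutive partial sums. -/
lemma clamp_sub_natCast {r : ℝ} (hr : 0 ≤ r) (k : ℕ) :
    clamp (r - k) = (1 - (r - ⌊r⌋₊)) * (if k < ⌊r⌋₊ then 1 else 0)
      + (r - ⌊r⌋₊) * (if k < ⌊r⌋₊ + 1 then 1 else 0) := by
  have h1 := Nat.floor_le hr
  have h2 := Nat.lt_floor_add_one r
  rcases lt_trichotomy k ⌊r⌋₊ with h | h | h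
  · have h3 : (k : ℝ) + 1 ≤ ⌊r⌋₊ := by exact_mod_cast h
    rw [clamp, min_eq_left (by linarith), max_eq_right zero_le_one, if_pos h, if_pos (by omega)]
    ring
  · rw [clamp, h, min_eq_right (by linarith), max_eq_right (by linarith), if_neg (lt_irrefl _),
      if_pos (by omega)]
    ring
  · have h3 : (⌊r⌋₊ : ℝ) + 1 ≤ k := by exact_mod_cast h
    rw [clamp, min_eq_right (by linarith), max_eq_left (by linarith), if_neg (by omega),
      if_neg (by omega)]
    ring

lemma interpolation_apply (g : ℕ → ℝ) {N : ℕ} (n : Fin N → ℕ) (x : unitInterval) :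
    interpolation g n x = (√N)⁻¹ *
      ((1 - ((x : ℝ) * N - ⌊(x : ℝ) * N⌋₊)) * partialSum g N ⌊(x : ℝ) * N⌋₊ n
        + ((x : ℝ) * N - ⌊(x : ℝ) * N⌋₊) * partialSum g N (⌊(x : ℝ) * N⌋₊ + 1) n) := by
  have hr : 0 ≤ (x : ℝ) * N := mul_nonneg x.2.1 N.cast_nonneg
  rw [interpolation, ContinuousMap.coe_mk]
  congr 1
  rw [partialSum, partialSum, Finset.sum_filter, Finset.sum_filter, Finset.mul_sum, Finset.mul_sum,
    ← Finset.sum_add_distrib]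
  refine Finset.sum_congr rfl fun k _ => ?_
  rw [clamp_sub_natCast hr]
  split_ifs <;> ring

lemma interpolation_zero (g : ℕ → ℝ) {N : ℕ} (n : Fin N → ℕ) : interpolation g n 0 = 0 := by
  rw [interpolation_apply]
  simp [partialSum]

lemma height_eq_partialSum (f : ℕ → ℝ) (c : ℝ) {N : ℕ} (n : Fin N → ℕ) (x : unitInterval) :
    height f c n x = (√N)⁻¹ * partialSum (fun k => f k - c) N ⌊(x : ℝ) * N⌋₊ n := rfl

lemma abs_convexComb_sub_le {s a b c r : ℝ} (hs0 : 0 ≤ s) (hs1 : s ≤ 1) (ha : |a - c| ≤ r)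
    (hb : |b - c| ≤ r) : |((1 - s) * a + s * b) - c| ≤ r := by
  rw [abs_le] at *
  constructor <;> nlinarith

lemma abs_sub_convexComb_le {s a b c r : ℝ} (hs0 : 0 ≤ s) (hs1 : s ≤ 1) (ha : |c - a| ≤ r)
    (hb : |c - b| ≤ r) : |c - ((1 - s) * a + s * b)| ≤ r := by
  rw [abs_sub_comm] at *
  exact abs_convexComb_sub_le hs0 hs1 ha hb

lemma fract_mem {r : ℝ} (hr : 0 ≤ r) : 0 ≤ r - ⌊r⌋₊ ∧ r - ⌊r⌋₊ ≤ 1 :=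
  ⟨sub_nonneg.mpr (Nat.floor_le hr), by linarith [Nat.lt_floor_add_one r]⟩

/-- Each interpolated value involves the partial sums at a floor and at its successor; the `+ 2`
absorbs the rounding. The successor at `x = 1` is why indices reach `N + 1`. -/
lemma abs_interpolation_sub_le (g : ℕ → ℝ) {N h : ℕ} (n : Fin N → ℕ) {r : ℝ}
    (hS : ∀ i j, i ≤ j → j ≤ N + 1 → j ≤ i + h → |partialSum g N i n - partialSum g N j n| ≤ r)
    (x y : unitInterval) (hxy : |(x : ℝ) * N - y * N| + 2 ≤ h) :
    |interpolation g n x - interpolation g n y| ≤ (√N)⁻¹ * r := by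
  have hS' : ∀ i j, i ≤ N + 1 → j ≤ N + 1 → j ≤ i + h → i ≤ j + h →
      |partialSum g N i n - partialSum g N j n| ≤ r := fun i j hi hj h1 h2 => by
    rcases le_total i j with hij | hij
    · exact hS i j hij hj h1
    · rw [abs_sub_comm]
      exact hS j i hij hi h2
  have key : ∀ x y : unitInterval, |(x : ℝ) * N - y * N| + 2 ≤ h →
      ⌊(x : ℝ) * N⌋₊ + 1 ≤ ⌊(y : ℝ) * N⌋₊ + h := fun x y hxy => by
    have h1 := Nat.floor_le (mul_nonneg x.2.1 N.cast_nonneg : 0 ≤ (x : ℝ) * N)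
    have h2 := Nat.lt_floor_add_one ((y : ℝ) * N)
    have h3 := le_abs_self ((x : ℝ) * N - y * N)
    have : (⌊(x : ℝ) * N⌋₊ : ℝ) + 1 ≤ ⌊(y : ℝ) * N⌋₊ + h := by linarith
    exact_mod_cast this
  have hx := floor_mul_le x N
  have hy := floor_mul_le y N
  have hxy1 := key x y hxy
  have hxy2 := key y x (by rwa [abs_sub_comm])
  obtain ⟨hx0, hx1⟩ := fract_mem (mul_nonneg x.2.1 N.cast_nonneg : 0 ≤ (x : ℝ) * N)
  obtain ⟨hy0, hy1⟩ := fract_mem (mul_nonneg y.2.1 N.cast_nonneg : 0 ≤ (y : ℝ) * N)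
  rw [interpolation_apply, interpolation_apply, ← mul_sub, abs_mul,
    abs_of_nonneg (inv_nonneg.mpr (Real.sqrt_nonneg _))]
  refine mul_le_mul_of_nonneg_left ?_ (inv_nonneg.mpr (Real.sqrt_nonneg _))
  refine abs_convexComb_sub_le hx0 hx1 (abs_sub_convexComb_le hy0 hy1 ?_ ?_)
    (abs_sub_convexComb_le hy0 hy1 ?_ ?_) <;> exact hS' _ _ (by omega) (by omega) (by omega) (by omega)

lemma abs_height_sub_interpolation_le (f : ℕ → ℝ) (c : ℝ) {N : ℕ} (n : Fin N → ℕ) {r : ℝ}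
    (hr : 0 ≤ r)
    (hS : ∀ i ≤ N, |partialSum (fun k => f k - c) N i n - partialSum (fun k => f k - c) N (i + 1) n| ≤ r)
    (x : unitInterval) : |height f c n x - interpolation (fun k => f k - c) n x| ≤ (√N)⁻¹ * r := by
  obtain ⟨hx0, hx1⟩ := fract_mem (mul_nonneg x.2.1 N.cast_nonneg : 0 ≤ (x : ℝ) * N)
  rw [height_eq_partialSum, interpolation_apply, ← mul_sub, abs_mul,
    abs_of_nonneg (inv_nonneg.mpr (Real.sqrt_nonneg _))]
  refine mul_le_mul_of_nonneg_left ?_ (inv_nonneg.mpr (Real.sqrt_nonneg _))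
  exact abs_sub_convexComb_le hx0 hx1 (by simpa using hr) (hS _ (floor_mul_le x N))

/-- Indices at distance at most `h` lie in the same or in adjacent blocks of the grid `b * h`.
Passing through block endpoints costs at most three increments. -/
lemma abs_sub_le_of_maxIncr {Ω : Type*} {S : ℕ → Ω → ℝ} {h M L : ℕ} {ω : Ω} {r : ℝ} (hr : 0 ≤ r)
    (hh : 0 < h) (hL : L < M * h) (hS : ∀ b < M, maxIncr S (b * h) h ω ≤ ENNReal.ofReal r)
    {i j : ℕ} (hij : i ≤ j) (hj : j ≤ L) (hjh : j ≤ i + h) : |S i ω - S j ω| ≤ 3 * r := by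
  have key : ∀ b < M, ∀ k, b * h ≤ k → k ≤ b * h + h → |S k ω - S (b * h) ω| ≤ r :=
    fun b hb k h1 h2 => by
    have h3 := (enorm_sub_le_maxIncr S (a := b * h) (l := h) (j := k - b * h) (by omega) ω).trans
      (hS b hb)
    rw [Nat.add_sub_cancel' h1, Real.enorm_eq_ofReal_abs] at h3
    exact (ENNReal.ofReal_le_ofReal_iff hr).mp h3
  have hb : i / h < M := Nat.div_lt_of_lt_mul (by rw [mul_comm]; omega)
  have hi1 : i / h * h ≤ i := Nat.div_mul_le_self i h
  have hi2 : i < i / h * h + h := by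
    have := Nat.lt_div_mul_add (a := i) hh
    omega
  have h1 := key _ hb i hi1 hi2.le
  rcases le_total j (i / h * h + h) with hjb | hjb
  · have h2 := key _ hb j (hi1.trans hij) hjb
    rw [abs_le] at *
    constructor <;> linarith
  · have hb' : i / h + 1 < M := by
      refine Nat.lt_of_mul_lt_mul_right (a := h) ?_
      rw [add_mul, one_mul]
      omega
    have h2 := key _ hb (i / h * h + h) (by omega) le_rfl
    have h3 := key _ hb' j (by rw [add_mul, one_mul]; omega) (by rw [add_mul, one_mul]; omega)
    rw [add_mul, one_mul] at h3
    rw [abs_le] at *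
    constructor <;> linarith

end Interpolation

/-! ### Modulus of continuity -/

section Modulus

lemma partialSum_min (g : ℕ → ℝ) (N j : ℕ) (n : Fin N → ℕ) :
    partialSum g N j n = partialSum g N (min j N) n := by
  rw [partialSum, partialSum]
  congr 1
  ext k
  simp only [Finset.mem_filter, Finset.mem_univ, true_and]
  omega

/-- Partial sums are constant beyond `N`, so a block overhanging the last site can be truncated to
one to which the moment bounds apply. -/
lemma maxIncr_partialSum_le (g : ℕ → ℝ) (N a l : ℕ) (n : Fin N → ℕ) :
    maxIncr (partialSum g N) a l n
      ≤ maxIncr (partialSum g N) (min a N) (min l (N - min a N)) n := by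
  refine Finset.sup_le fun j hj => ?_
  rw [Finset.mem_range] at hj
  have h := enorm_sub_le_maxIncr (partialSum g N) (a := min a N) (l := min l (N - min a N))
    (j := min (a + j) N - min a N) (by omega) n
  rwa [Nat.add_sub_cancel' (by omega), ← partialSum_min, ← partialSum_min] at h

variable {ν : Measure ℕ} [IsProbabilityMeasure ν]

/-- The interpolated height functions are uniformly close to the height functions and have a
uniform modulus of continuity, up to events of small probability. -/
theorem exists_measure_modulus_le (h0 : 0 < ν.real {0}) (h1 : 0 < ν.real {1}) {nbar : ℝ}
    (hnbar : 0 ≤ nbar) (hf : ∀ p : ℕ, Integrable (fun k : ℕ => |(k : ℝ) - nbar| ^ p) ν)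
    (hf0 : ∫ k : ℕ, ((k : ℝ) - nbar) ∂ν = 0) {t : ℕ → ℝ} {c : ℝ}
    (hg : ∀ p : ℕ, Integrable (fun k => |t k - c| ^ p) ν) (hg0 : ∫ k, (t k - c) ∂ν = 0)
    {ε : ℝ} (hε : 0 < ε) {η : ℝ} (hη : 0 < η) :
    ∃ δ : ℝ, 0 < δ ∧ ∃ N0 : ℕ, ∀ N ≥ N0,
      ProbabilityTheory.cond (Measure.pi fun _ : Fin N => ν) (sumEq N ⌊(N : ℝ) * nbar⌋₊)
        {n | ¬ ((∀ x y : unitInterval, dist x y ≤ δ →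
            |interpolation (fun k => t k - c) n x - interpolation (fun k => t k - c) n y| ≤ ε) ∧
          ∀ x, |height t c n x - interpolation (fun k => t k - c) n x| ≤ ε)}
        ≤ ENNReal.ofReal η := by
  obtain ⟨K, hK, N1, hmax⟩ := exists_lintegral_cond_maxIncr_le h0 h1 hnbar hf hf0 hg hg0 2 le_rfl
  -- `M` blocks of length about `N / M` each fail with probability of order `M ^ (-2)`, by Markov's
  -- inequality for the fourth moment; the union has probability of order `1 / M`. The constants are
  -- `16 = 4 ^ 2` from `h ≤ 4 N / M` and `81 = 3 ^ 4` from `r`.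
  obtain ⟨M, hM⟩ := exists_nat_gt (K * 16 * 81 / ε ^ 4 / η)
  have hM0 : (0 : ℝ) < M := lt_of_le_of_lt (by positivity) hM
  have hMpos : 0 < M := by exact_mod_cast hM0
  refine ⟨(M : ℝ)⁻¹, by positivity, max N1 (M + 1), fun N hN => ?_⟩
  set Q := ProbabilityTheory.cond (Measure.pi fun _ : Fin N => ν) (sumEq N ⌊(N : ℝ) * nbar⌋₊)
  set S := partialSum (fun k => t k - c) N
  have hMN : M ≤ N := (Nat.le_succ M).trans ((le_max_right _ _).trans hN)
  have hNr : (0 : ℝ) < N := by exact_mod_cast hMpos.trans_le hMN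
  have hs : 0 < √(N : ℝ) := Real.sqrt_pos.mpr hNr
  -- One unit compensates the integer division and two are the slack required by
  -- `abs_interpolation_sub_le`.
  set h := N / M + 3
  set r := ε * √N / 3
  have hr : 0 < r := by positivity
  have h3 : (M : ℝ) ≤ N := by exact_mod_cast hMN
  have hh1 : (N : ℝ) * (M : ℝ)⁻¹ + 2 ≤ h := by
    have h1 : (N : ℝ) < M * ((N / M : ℕ) + 1) := by exact_mod_cast Nat.lt_mul_div_succ N hMpos
    have : (N : ℝ) / M ≤ (N / M : ℕ) + 1 := by rw [div_le_iff₀' hM0]; exact h1.le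
    simp only [h]
    push_cast
    rw [← div_eq_mul_inv]
    linarith
  have hh2 : (h : ℝ) ≤ 4 * N / M := by
    have h2 : (M : ℝ) * (N / M : ℕ) ≤ N := by exact_mod_cast Nat.mul_div_le N M
    simp only [h]
    push_cast
    rw [le_div_iff₀' hM0]
    linarith
  have hL : N + 1 < M * h := by
    have := Nat.lt_mul_div_succ N hMpos
    simp only [h]
    nlinarith
  have hbad : ∀ b, Q {n | ENNReal.ofReal r < maxIncr S (b * h) h n}
      ≤ ENNReal.ofReal (K * (h : ℝ) ^ 2 / r ^ 4) := fun b => by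
    have hsub : {n | ENNReal.ofReal r < maxIncr S (b * h) h n}
        ⊆ {n | ENNReal.ofReal (r ^ 4) ≤ maxIncr S (min (b * h) N) (min h (N - min (b * h) N)) n ^ 4} :=
      fun n hn => by
      rw [Set.mem_ofPred_eq, ENNReal.ofReal_pow hr.le]
      exact pow_le_pow_left₀ zero_le (hn.le.trans (maxIncr_partialSum_le _ _ _ _ _)) 4
    refine (measure_mono hsub).trans ((meas_ge_le_lintegral_div
      (measurable_of_countable _).aemeasurable (by simpa using pow_pos hr 4)
      ENNReal.ofReal_ne_top).trans ?_)
    rw [ENNReal.ofReal_div_of_pos (by positivity)]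
    refine ENNReal.div_le_div_right ((hmax N ((le_max_left _ _).trans hN) _ _ (by omega)).trans
      (ENNReal.ofReal_le_ofReal ?_)) _
    gcongr
    exact min_le_left _ _
  have hsub : {n | ¬ ((∀ x y : unitInterval, dist x y ≤ (M : ℝ)⁻¹ →
        |interpolation (fun k => t k - c) n x - interpolation (fun k => t k - c) n y| ≤ ε) ∧
      ∀ x, |height t c n x - interpolation (fun k => t k - c) n x| ≤ ε)}
      ⊆ ⋃ b ∈ Finset.range M, {n | ENNReal.ofReal r < maxIncr S (b * h) h n} := fun n hn => by
    by_contra hcon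
    simp only [Set.mem_iUnion, Finset.mem_range, Set.mem_ofPred_eq, exists_prop, not_exists, not_and,
      not_lt] at hcon
    have hS := fun i j (hij : i ≤ j) (hj : j ≤ N + 1) (hjh : j ≤ i + h) =>
      abs_sub_le_of_maxIncr hr.le (Nat.succ_pos _) hL hcon hij hj hjh
    have hε' : (√(N : ℝ))⁻¹ * (3 * r) = ε := by
      simp only [r]
      field_simp
    refine hn ⟨fun x y hxy => ?_, fun x => ?_⟩
    · rw [← hε']
      refine abs_interpolation_sub_le _ n hS x y ?_
      rw [← sub_mul, abs_mul, Nat.abs_cast, mul_comm]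
      refine le_trans ?_ hh1
      gcongr
      exact hxy
    · rw [← hε']
      exact abs_height_sub_interpolation_le t c n (by positivity)
        (fun i hi => hS i (i + 1) (by omega) (by omega)
          (Nat.add_le_add_left (Nat.le_add_left 1 _) i)) x
  calc _ ≤ ∑ b ∈ Finset.range M, Q {n | ENNReal.ofReal r < maxIncr S (b * h) h n} :=
        (measure_mono hsub).trans (measure_biUnion_finset_le _ _)
    _ ≤ ∑ _b ∈ Finset.range M, ENNReal.ofReal (K * (h : ℝ) ^ 2 / r ^ 4) :=
        Finset.sum_le_sum fun b _ => hbad b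
    _ = ENNReal.ofReal (M * (K * (h : ℝ) ^ 2 / r ^ 4)) := by
        rw [Finset.sum_const, Finset.card_range, nsmul_eq_mul, ENNReal.ofReal_mul hM0.le,
          ENNReal.ofReal_natCast]
    _ ≤ ENNReal.ofReal η := by
        refine ENNReal.ofReal_le_ofReal ?_
        have hr4 : r ^ 4 = ε ^ 4 * (N : ℝ) ^ 2 / 81 := by
          have : √(N : ℝ) ^ 4 = (N : ℝ) ^ 2 := by
            rw [show 4 = 2 * 2 from rfl, pow_mul, Real.sq_sqrt hNr.le]
          simp only [r]
          rw [div_pow, mul_pow, this]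
          norm_num
        calc (M : ℝ) * (K * (h : ℝ) ^ 2 / r ^ 4) ≤ M * (K * (4 * N / M) ^ 2 / r ^ 4) := by gcongr
          _ = K * 16 * 81 / ε ^ 4 / M := by
              rw [hr4]
              field_simp
              norm_num
          _ ≤ η := by
              rw [div_le_iff₀ hM0, ← div_le_iff₀' hη]
              exact hM.le

end Modulus

end ZeroRange

namespace ZeroRange

/-! ### Tightness in the space of continuous paths -/

section Tightness

variable {E : Type*} [NormedAddCommGroup E]

/-- The paths whose oscillation over distances at most `δ` is at most `ε`. -/
def modulusSet (E : Type*) [NormedAddCommGroup E] (δ ε : ℝ) : Set C(unitInterval, E) :=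
  {f | ∀ x y, dist x y ≤ δ → dist (f x) (f y) ≤ ε}

lemma isClosed_modulusSet (δ ε : ℝ) : IsClosed (modulusSet E δ ε) := by
  simp only [modulusSet, Set.ofPred_forall]
  refine isClosed_iInter fun x => isClosed_iInter fun y => isClosed_iInter fun _ => ?_
  exact isClosed_le ((continuous_eval_const x).dist (continuous_eval_const y))
    continuous_const

lemma modulusSet_anti {δ δ' : ℝ} (h : δ ≤ δ') (ε : ℝ) : modulusSet E δ' ε ⊆ modulusSet E δ ε :=
  fun _ hf x y hxy => hf x y (hxy.trans h)

/-- Chaining from `0` to `x` in `m` equal steps, each moving the path by at most `1`. -/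
lemma norm_le_of_modulus {f : unitInterval → E} (hf0 : f 0 = 0) {m : ℕ} (hm : 0 < m)
    (hf : ∀ x y, dist x y ≤ (m : ℝ)⁻¹ → dist (f x) (f y) ≤ 1) (x : unitInterval) : ‖f x‖ ≤ m := by
  have hm' : (0 : ℝ) < m := by exact_mod_cast hm
  have hmem : ∀ j : ℕ, j ≤ m → (x : ℝ) * j / m ∈ unitInterval := fun j hj =>
    ⟨div_nonneg (mul_nonneg x.2.1 j.cast_nonneg) hm'.le, by
      rw [div_le_one hm']
      exact (mul_le_of_le_one_left j.cast_nonneg x.2.2).trans (by exact_mod_cast hj)⟩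
  have key : ∀ j (hj : j ≤ m), ‖f ⟨_, hmem j hj⟩‖ ≤ j := fun j => by
    induction j with
    | zero =>
      intro hj
      have : (⟨_, hmem 0 hj⟩ : unitInterval) = 0 := Subtype.ext (by simp)
      rw [this, hf0]
      simp
    | succ j ih =>
      intro hj
      have h1 := ih (Nat.le_of_succ_le hj)
      have h2 := hf ⟨_, hmem (j + 1) hj⟩ ⟨_, hmem j (Nat.le_of_succ_le hj)⟩ (by
        rw [Subtype.dist_eq, Real.dist_eq]
        push_cast
        rw [show (x : ℝ) * (j + 1) / m - x * j / m = x * (m : ℝ)⁻¹ by field_simp; ring,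
          abs_of_nonneg (mul_nonneg x.2.1 (by positivity))]
        exact mul_le_of_le_one_left (by positivity) x.2.2)
      rw [dist_eq_norm] at h2
      have h3 := norm_le_norm_add_norm_sub' (f ⟨_, hmem (j + 1) hj⟩)
        (f ⟨_, hmem j (Nat.le_of_succ_le hj)⟩)
      exact (h3.trans (add_le_add h1 h2)).trans_eq (Nat.cast_succ j).symm
  have h := key m le_rfl
  have hx : (⟨_, hmem m le_rfl⟩ : unitInterval) = x := Subtype.ext (by
    change (x : ℝ) * m / m = x
    field_simp)
  rwa [hx] at h

/-- Arzelà-Ascoli: the moduli give equicontinuity, and together with the value at `0` they give a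
uniform bound by `norm_le_of_modulus`. -/
lemma isCompact_iInter_modulusSet [ProperSpace E] {δ ε : ℕ → ℝ} (hδ : ∀ k, 0 < δ k)
    (hε : ∀ r > 0, ∃ k, ε k ≤ r) :
    IsCompact ({f : C(unitInterval, E) | f 0 = 0} ∩ ⋂ k, modulusSet E (δ k) (ε k)) := by
  set A : Set (unitInterval → E) :=
    {f | f 0 = 0 ∧ ∀ k x y, dist x y ≤ δ k → dist (f x) (f y) ≤ ε k}
  have hsmall : ∀ f ∈ A, ∀ r > 0, ∃ d > 0, ∀ x y, dist x y < d → dist (f x) (f y) ≤ r :=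
    fun f hf r hr => by
    obtain ⟨k, hk⟩ := hε r hr
    exact ⟨δ k, hδ k, fun x y hxy => (hf.2 k x y hxy.le).trans hk⟩
  -- The modulus conditions alone force continuity, so the image is cut out by conditions that are
  -- closed for pointwise convergence, hence is closed inside a product of balls.
  have himage : ContinuousMap.toFun '' ({f : C(unitInterval, E) | f 0 = 0} ∩
      ⋂ k, modulusSet E (δ k) (ε k)) = A := by
    ext f
    constructor
    · rintro ⟨f, ⟨hf0, hf⟩, rfl⟩
      exact ⟨hf0, fun k => Set.mem_iInter.mp hf k⟩
    · intro hf
      refine ⟨⟨f, Metric.continuous_iff.mpr fun y r hr => ?_⟩,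
        ⟨hf.1, Set.mem_iInter.mpr fun k => hf.2 k⟩, rfl⟩
      obtain ⟨d, hd, h⟩ := hsmall f hf (r / 2) (half_pos hr)
      exact ⟨d, hd, fun x hxy => (h x y hxy).trans_lt (half_lt_self hr)⟩
  refine ArzelaAscoli.isCompact_of_equicontinuous _ ?_ ?_
  · rw [himage]
    obtain ⟨k, hk⟩ := hε 1 one_pos
    obtain ⟨m, hm⟩ := exists_nat_one_div_lt (hδ k)
    refine (isCompact_univ_pi fun _ : unitInterval =>
      isCompact_closedBall (0 : E) ((m + 1 : ℕ) : ℝ)).of_isClosed_subset ?_ fun f hf => ?_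
    · simp only [A, Set.ofPred_and, Set.ofPred_forall]
      refine (isClosed_eq (continuous_apply 0) continuous_const).inter ?_
      refine isClosed_iInter fun k => isClosed_iInter fun x => isClosed_iInter fun y =>
        isClosed_iInter fun _ => ?_
      exact isClosed_le ((continuous_apply x).dist (continuous_apply y)) continuous_const
    · refine fun x _ => mem_closedBall_zero_iff.mpr ?_
      refine norm_le_of_modulus hf.1 m.succ_pos (fun x y hxy => (hf.2 k x y (hxy.trans ?_)).trans hk) x
      rw [← one_div]
      push_cast
      exact hm.le
  · refine fun x => Metric.equicontinuousAt_iff.mpr fun r hr => ?_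
    obtain ⟨k, hk⟩ := hε (r / 2) (half_pos hr)
    refine ⟨δ k, hδ k, fun y hxy f => lt_of_le_of_lt ?_ (half_lt_self hr)⟩
    refine ((Set.mem_iInter.mp f.2.2 k) x y ?_).trans hk
    rw [dist_comm]
    exact hxy.le

variable [MeasurableSpace C(unitInterval, E)] [BorelSpace C(unitInterval, E)]

/-- Each continuous path on `[0, 1]` is uniformly continuous, so the bad sets decrease to the empty
set. Used for the finitely many indices below the threshold of the asymptotic bound. -/
lemma exists_measure_compl_modulusSet_le (μ : Measure C(unitInterval, E)) [IsFiniteMeasure μ]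
    {ε : ℝ} (hε : 0 < ε) {η : ℝ≥0∞} (hη : 0 < η) :
    ∃ δ : ℝ, 0 < δ ∧ μ (modulusSet E δ ε)ᶜ ≤ η := by
  have hanti : Antitone fun k : ℕ => (modulusSet E (1 / ((k : ℝ) + 1)) ε)ᶜ := fun k l hkl =>
    Set.compl_subset_compl.mpr (modulusSet_anti (Nat.one_div_le_one_div hkl) ε)
  have hlim := tendsto_measure_iInter_atTop (μ := μ)
    (fun k : ℕ => ((isClosed_modulusSet (E := E) (1 / ((k : ℝ) + 1)) ε).measurableSet.compl).nullMeasurableSet)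
    hanti ⟨0, measure_ne_top _ _⟩
  have hempty : ⋂ k : ℕ, (modulusSet E (1 / ((k : ℝ) + 1)) ε)ᶜ = ∅ := by
    rw [← Set.compl_iUnion, Set.compl_empty_iff, Set.eq_univ_iff_forall]
    intro f
    obtain ⟨d, hd, h⟩ := Metric.uniformContinuous_iff.mp
      (CompactSpace.uniformContinuous_of_continuous f.continuous) ε hε
    obtain ⟨k, hk⟩ := exists_nat_one_div_lt hd
    exact Set.mem_iUnion.mpr ⟨k, fun x y hxy => (h (hxy.trans_lt hk)).le⟩
  rw [hempty, measure_empty] at hlim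
  obtain ⟨k, hk⟩ := (hlim.eventually_lt_const hη).exists
  exact ⟨1 / ((k : ℝ) + 1), Nat.one_div_pos_of_nat, hk.le⟩

/-- A sequence of laws on paths started at `0` is tight when the modulus of continuity is
eventually controlled in probability. -/
theorem isTightMeasureSet_range_of_modulus [ProperSpace E] (μ : ℕ → Measure C(unitInterval, E))
    [∀ N, IsFiniteMeasure (μ N)] (h0 : ∀ N, ∀ᵐ f ∂μ N, f 0 = 0)
    (h : ∀ ε : ℝ, 0 < ε → ∀ η : ℝ, 0 < η → ∃ δ : ℝ, 0 < δ ∧ ∃ N0, ∀ N ≥ N0,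
      μ N (modulusSet E δ ε)ᶜ ≤ ENNReal.ofReal η) :
    IsTightMeasureSet (Set.range μ) := by
  have hall : ∀ ε : ℝ, 0 < ε → ∀ η : ℝ≥0∞, 0 < η → ∃ δ : ℝ, 0 < δ ∧ ∀ N,
      μ N (modulusSet E δ ε)ᶜ ≤ η := fun ε hε η hη => by
    obtain ⟨r, hr0, hr⟩ := ENNReal.lt_iff_exists_nnreal_btwn.mp hη
    obtain ⟨δ, hδ, N0, hN0⟩ := h ε hε r (by exact_mod_cast hr0)
    choose d hd hdμ using fun N => exists_measure_compl_modulusSet_le (μ N) hε hη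
    have hfin : ∃ δ' : ℝ, 0 < δ' ∧ ∀ N < N0, δ' ≤ d N := by
      clear hN0
      induction N0 with
      | zero => exact ⟨1, one_pos, by simp⟩
      | succ m ih =>
        obtain ⟨δ', h1, h2⟩ := ih
        refine ⟨min δ' (d m), lt_min h1 (hd m), fun N hN => ?_⟩
        rcases Nat.lt_succ_iff_lt_or_eq.mp hN with h | rfl
        · exact (min_le_left _ _).trans (h2 N h)
        · exact min_le_right _ _
    obtain ⟨δ', hδ', hle⟩ := hfin
    refine ⟨min δ δ', lt_min hδ hδ', fun N => ?_⟩
    rcases Nat.lt_or_ge N N0 with hN | hN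
    · exact (measure_mono (Set.compl_subset_compl.mpr
        (modulusSet_anti ((min_le_right _ _).trans (hle N hN)) ε))).trans (hdμ N)
    · refine (measure_mono (Set.compl_subset_compl.mpr
        (modulusSet_anti (min_le_left _ _) ε))).trans ((hN0 N hN).trans ?_)
      rw [ENNReal.ofReal_coe_nnreal]
      exact hr.le
  rw [isTightMeasureSet_iff_exists_isCompact_measure_compl_le]
  intro η hη
  obtain ⟨η', hη', hsum⟩ := ENNReal.exists_pos_sum_of_countable' hη.ne' ℕ
  -- One modulus condition for each level `1 / (k + 1)`, with failure probabilities summing to less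
  -- than `η`; the compact set imposes all of them at once.
  choose δ hδ hδμ using fun k : ℕ => hall (1 / ((k : ℝ) + 1)) Nat.one_div_pos_of_nat (η' k) (hη' k)
  refine ⟨_, isCompact_iInter_modulusSet (E := E) hδ (ε := fun k : ℕ => 1 / ((k : ℝ) + 1)) fun r hr => ?_, ?_⟩
  · obtain ⟨k, hk⟩ := exists_nat_one_div_lt hr
    exact ⟨k, hk.le⟩
  · rintro _ ⟨N, rfl⟩
    rw [Set.compl_inter, Set.compl_iInter]
    calc _ ≤ μ N {f | f 0 = 0}ᶜ + μ N (⋃ k, (modulusSet E (δ k) (1 / ((k : ℝ) + 1)))ᶜ) :=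
          measure_union_le _ _
      _ ≤ 0 + ∑' k, η' k := by
          refine add_le_add (le_of_eq (h0 N)) ((measure_iUnion_le _).trans ?_)
          exact ENNReal.tsum_le_tsum fun k => hδμ k N
      _ ≤ η := by
          rw [zero_add]
          exact hsum.le

end Tightness

end ZeroRange

namespace ZeroRange

/-! ### Functional limit theorem for approximately continuous paths -/

section FunctionalLimit

variable {S : ℕ → Type*} [∀ N, MeasurableSpace (S N)] [∀ N, Countable (S N)]
  [∀ N, MeasurableSingletonClass (S N)] {Q : ∀ N, Measure (S N)} [∀ N, IsProbabilityMeasure (Q N)]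

/-- Replacing paths by uniformly close ones from a tight family does not change the limits of the
expectations of bounded functionals that are continuous for uniform convergence. -/
theorem tendsto_integral_sub_of_close {E G : Type*} [NormedAddCommGroup E] [NormedAddCommGroup G]
    [NormedSpace ℝ G] [MeasurableSpace C(unitInterval, E)] [BorelSpace C(unitInterval, E)]
    {X : ∀ N, S N → unitInterval → E} {Y : ∀ N, S N → C(unitInterval, E)}
    (htight : IsTightMeasureSet (Set.range fun N => (Q N).map (Y N)))
    (hclose : ∀ ε : ℝ, 0 < ε → ∀ η : ℝ, 0 < η → ∃ N0, ∀ N ≥ N0,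
      Q N {s | ¬ ∀ x, dist (X N s x) (Y N s x) ≤ ε} ≤ ENNReal.ofReal η)
    (F : (unitInterval →ᵤ E) →ᵇ G) :
    Tendsto (fun N => ∫ s, F (UniformFun.ofFun (X N s)) ∂(Q N)
      - ∫ s, F (UniformFun.ofFun (Y N s)) ∂(Q N)) atTop (𝓝 0) := by
  have hYm : ∀ N, Measurable (Y N) := fun N => measurable_of_countable _
  -- Every function on the discrete space `S N` is measurable, so discontinuous paths cause no
  -- measurability problem.
  have hint : ∀ N (Z : S N → unitInterval → E),
      Integrable (fun s => F (UniformFun.ofFun (Z s))) (Q N) := fun N Z =>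
    (integrable_const ‖F‖).mono' .of_discrete
      (.of_forall fun s => F.norm_coe_le_norm _)
  rw [Metric.tendsto_atTop]
  intro ε hε
  set C := 2 * ‖F‖ + 1
  have hC : 0 < C := by positivity
  set η := ε / (8 * C) with hηdef
  have hη : 0 < η := by positivity
  obtain ⟨K, hK, hKμ⟩ := isTightMeasureSet_iff_exists_isCompact_measure_compl_le.mp htight
    (ENNReal.ofReal η) (ENNReal.ofReal_pos.mpr hη)
  have hK' : IsCompact ((fun f : C(unitInterval, E) => UniformFun.ofFun (f : unitInterval → E)) '' K) :=
    hK.image ContinuousMap.isUniformEmbedding_uniformFunOfFun.uniformContinuous.continuous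
  -- `F` is only continuous, but near a compact set it is uniformly so with just one of the two
  -- points in the compact set. This matters because the paths `X` are not continuous.
  have hunif := hK'.uniformContinuousAt_of_continuousAt F (fun a _ => F.continuous.continuousAt)
    (Metric.dist_mem_uniformity (half_pos hε))
  obtain ⟨V, hV, hVsub⟩ := (UniformFun.hasBasis_uniformity unitInterval E).mem_iff.mp hunif
  obtain ⟨δ, hδ, hδV⟩ := Metric.mem_uniformity_dist.mp hV
  obtain ⟨N0, hN0⟩ := hclose (δ / 2) (half_pos hδ) η hη
  refine ⟨N0, fun N hN => ?_⟩
  set B := {s | ¬ ∀ x, dist (X N s x) (Y N s x) ≤ δ / 2} ∪ Y N ⁻¹' Kᶜ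
  have hBm : MeasurableSet B := (Set.to_countable B).measurableSet
  have hB : (Q N).real B ≤ 2 * η := by
    have h1 : Q N B ≤ ENNReal.ofReal η + ENNReal.ofReal η := by
      refine (measure_union_le _ _).trans (add_le_add (hN0 N hN) ?_)
      rw [← Measure.map_apply (hYm N) hK.isClosed.measurableSet.compl]
      exact hKμ _ ⟨N, rfl⟩
    rw [← ENNReal.ofReal_add hη.le hη.le] at h1
    refine (ENNReal.toReal_le_of_le_ofReal (by positivity) h1).trans (by linarith)
  have hpt : ∀ s, ‖F (UniformFun.ofFun (X N s)) - F (UniformFun.ofFun (Y N s))‖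
      ≤ ε / 2 + B.indicator (fun _ => C) s := fun s => by
    by_cases hs : s ∈ B
    · rw [Set.indicator_of_mem hs]
      refine (norm_sub_le _ _).trans ?_
      have h1 := F.norm_coe_le_norm (UniformFun.ofFun (X N s))
      have h2 := F.norm_coe_le_norm (UniformFun.ofFun (Y N s))
      simp only [C]
      linarith
    · rw [Set.indicator_of_notMem hs, add_zero]
      simp only [B, Set.mem_union, Set.mem_ofPred_eq, Set.mem_preimage, Set.mem_compl_iff, not_or,
        not_not] at hs
      have h1 : (UniformFun.ofFun (Y N s : unitInterval → E), UniformFun.ofFun (X N s))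
          ∈ UniformFun.gen unitInterval E V := fun x => hδV (by
        rw [dist_comm]
        exact (hs.1 x).trans_lt (half_lt_self hδ))
      have h2 := hVsub h1 ⟨Y N s, hs.2, rfl⟩
      rw [← dist_eq_norm, dist_comm]
      exact le_of_lt h2
  rw [dist_zero_right, ← integral_sub (hint N _) (hint N _)]
  refine (norm_integral_le_integral_norm _).trans_lt ?_
  have hi : Integrable (B.indicator fun _ => C) (Q N) := (integrable_const C).indicator hBm
  refine (integral_mono ((hint N _).sub (hint N _)).norm ((integrable_const _).add hi) hpt).trans_lt ?_
  rw [integral_add' (integrable_const _) hi, integral_indicator_const C hBm]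
  simp only [integral_const, probReal_univ, smul_eq_mul]
  have : (Q N).real B * C ≤ 2 * η * C := mul_le_mul_of_nonneg_right hB hC.le
  have h2 : 2 * η * C = ε / 4 := by
    rw [hηdef]
    field_simp
    norm_num
  linarith

/-- The pairing of a path with a finitely supported family of vectors. -/
noncomputable def pathPairing (f : unitInterval → ℝ × ℝ) (w : unitInterval →₀ ℝ × ℝ) : ℝ :=
  w.sum fun x v => v.1 * (f x).1 + v.2 * (f x).2

/-- The pairing as a bilinear map on continuous paths. -/
noncomputable def pathPairingₗ :
    C(unitInterval, ℝ × ℝ) →ₗ[ℝ] (unitInterval →₀ ℝ × ℝ) →ₗ[ℝ] ℝ :=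
  LinearMap.mk₂ ℝ (fun f w => pathPairing f w)
    (fun f g w => by
      simp only [pathPairing, Finsupp.sum, ← Finset.sum_add_distrib]
      refine Finset.sum_congr rfl fun x _ => ?_
      simp only [ContinuousMap.add_apply, Prod.fst_add, Prod.snd_add]
      ring)
    (fun c f w => by
      simp only [pathPairing, Finsupp.sum, smul_eq_mul, Finset.mul_sum]
      refine Finset.sum_congr rfl fun x _ => ?_
      simp only [ContinuousMap.smul_apply, Prod.smul_fst, Prod.smul_snd, smul_eq_mul]
      ring)
    (fun f w w' => Finsupp.sum_add_index' (fun x => by simp) fun x v v' => by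
      simp only [Prod.fst_add, Prod.snd_add]
      ring)
    (fun c f w => by
      simp only [pathPairing]
      rw [Finsupp.sum_smul_index' fun x => by simp, Finsupp.sum, Finsupp.sum, smul_eq_mul,
        Finset.mul_sum]
      refine Finset.sum_congr rfl fun x _ => ?_
      simp only [Prod.smul_fst, Prod.smul_snd, smul_eq_mul]
      ring)

lemma continuous_pathPairing (w : unitInterval →₀ ℝ × ℝ) :
    Continuous fun f : unitInterval →ᵤ ℝ × ℝ => pathPairing (UniformFun.toFun f) w := by
  refine continuous_finsetSum _ fun x _ => ?_
  have h := (UniformFun.uniformContinuous_eval (ℝ × ℝ) x).continuous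
  exact (continuous_const.mul h.fst).add (continuous_const.mul h.snd)

lemma continuous_pathPairing_coe (w : unitInterval →₀ ℝ × ℝ) :
    Continuous fun f : C(unitInterval, ℝ × ℝ) => pathPairing f w :=
  (continuous_pathPairing w).comp
    ContinuousMap.isUniformEmbedding_uniformFunOfFun.uniformContinuous.continuous

/-- The character of the space of paths associated with a pairing. -/
noncomputable def pathChar (w : unitInterval →₀ ℝ × ℝ) : (unitInterval →ᵤ ℝ × ℝ) →ᵇ ℂ :=
  BoundedContinuousFunction.ofNormedAddCommGroup
    (fun f => Complex.exp (pathPairing (UniformFun.toFun f) w * Complex.I))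
    (Complex.continuous_exp.comp
      ((Complex.continuous_ofReal.comp (continuous_pathPairing w)).mul continuous_const)) 1
    fun _ => (norm_cexp_ofReal_mul_I _).le

variable [MeasurableSpace C(unitInterval, ℝ × ℝ)] [BorelSpace C(unitInterval, ℝ × ℝ)]

/-- Convergence in law of tight sequences follows from the convergence of the characteristic
functions of the finite-dimensional distributions. -/
theorem tendsto_of_tight_of_pathChar {μ : ℕ → ProbabilityMeasure C(unitInterval, ℝ × ℝ)}
    {μ₀ : ProbabilityMeasure C(unitInterval, ℝ × ℝ)}
    (htight : IsTightMeasureSet (Set.range fun N => (μ N : Measure C(unitInterval, ℝ × ℝ))))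
    (h : ∀ w, Tendsto (fun N => ∫ f, pathChar w (UniformFun.ofFun f) ∂(μ N : Measure C(unitInterval, ℝ × ℝ)))
      atTop (𝓝 (∫ f, pathChar w (UniformFun.ofFun f) ∂(μ₀ : Measure C(unitInterval, ℝ × ℝ))))) :
    Tendsto μ atTop (𝓝 μ₀) := by
  -- The discrete topology on the test families reduces joint continuity of the pairing to
  -- continuity in the path.
  let _ : TopologicalSpace (unitInterval →₀ ℝ × ℝ) := ⊥
  have _ : DiscreteTopology (unitInterval →₀ ℝ × ℝ) := ⟨rfl⟩
  have hL : Continuous fun p : C(unitInterval, ℝ × ℝ) × (unitInterval →₀ ℝ × ℝ) =>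
      pathPairingₗ p.1 p.2 :=
    continuous_prod_of_discrete_right.mpr fun w => continuous_pathPairing_coe w
  refine ProbabilityMeasure.tendsto_of_tight_of_separatesPoints (𝕜 := ℂ) htight
    (A := BoundedContinuousFunction.charPoly Real.continuous_probChar hL) ?_ fun g hg => ?_
  · refine BoundedContinuousFunction.separatesPoints_charPoly _ Real.probChar_ne_one _ fun f hf => ?_
    obtain ⟨x, hx⟩ := DFunLike.ne_iff.mp hf
    -- Testing at `x` with the vector `f x` itself gives its squared Euclidean length, which is
    -- nonzero.
    refine DFunLike.ne_iff.mpr ⟨Finsupp.single x (f x), fun h0 => hx ?_⟩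
    have h1 : (f x).1 * (f x).1 + (f x).2 * (f x).2 = 0 := by
      have h2 : pathPairing f (Finsupp.single x (f x)) = 0 := h0
      rwa [pathPairing, Finsupp.sum_single_index (by simp)] at h2
    obtain ⟨h2, h3⟩ := mul_self_add_mul_self_eq_zero.mp h1
    exact Prod.ext h2 h3
  · obtain ⟨w, hw⟩ := (BoundedContinuousFunction.mem_charPoly _).mp hg
    have h_eq : ∀ μ : ProbabilityMeasure C(unitInterval, ℝ × ℝ),
        ∫ f, g f ∂(μ : Measure C(unitInterval, ℝ × ℝ)) = w.coeff.sum fun a z => z *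
          ∫ f, pathChar a (UniformFun.ofFun f) ∂(μ : Measure C(unitInterval, ℝ × ℝ)) := fun μ => by
      simp_rw [hw, Finsupp.sum]
      rw [integral_finsetSum]
      · refine Finset.sum_congr rfl fun a _ => ?_
        rw [integral_const_mul]
        rfl
      · refine fun a _ => Integrable.const_mul ?_ _
        exact BoundedContinuousFunction.integrable _
          (BoundedContinuousFunction.char Real.continuous_probChar hL a)
    simp_rw [h_eq]
    exact tendsto_finsetSum _ fun a _ => (h a).const_mul _

/-- **Functional limit theorem.** Paths that are uniformly close to continuous paths with a
controlled modulus of continuity, and whose finite-dimensional characteristic functions converge,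
converge in law to a random continuous path. -/
theorem exists_functional_limit {X : ∀ N, S N → unitInterval → ℝ × ℝ}
    {Y : ∀ N, S N → C(unitInterval, ℝ × ℝ)} (hY0 : ∀ N s, Y N s 0 = 0)
    (hmod : ∀ ε : ℝ, 0 < ε → ∀ η : ℝ, 0 < η → ∃ δ : ℝ, 0 < δ ∧ ∃ N0, ∀ N ≥ N0,
      Q N {s | ¬ ((∀ x y, dist x y ≤ δ → dist (Y N s x) (Y N s y) ≤ ε) ∧
        ∀ x, dist (X N s x) (Y N s x) ≤ ε)} ≤ ENNReal.ofReal η)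
    {φ : (unitInterval →₀ ℝ × ℝ) → ℂ}
    (hφ : ∀ w, Tendsto (fun N => ∫ s, pathChar w (UniformFun.ofFun (X N s)) ∂(Q N)) atTop (𝓝 (φ w))) :
    ∃ μ₀ : ProbabilityMeasure C(unitInterval, ℝ × ℝ),
      (∀ w, ∫ f, pathChar w (UniformFun.ofFun f) ∂(μ₀ : Measure C(unitInterval, ℝ × ℝ)) = φ w) ∧
      ∀ F : (unitInterval →ᵤ ℝ × ℝ) →ᵇ ℝ,
        Tendsto (fun N => ∫ s, F (UniformFun.ofFun (X N s)) ∂(Q N)) atTop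
          (𝓝 (∫ f, F (UniformFun.ofFun f) ∂(μ₀ : Measure C(unitInterval, ℝ × ℝ)))) := by
  have hYm : ∀ N, Measurable (Y N) := fun N => measurable_of_countable _
  have hofFun : Continuous fun f : C(unitInterval, ℝ × ℝ) =>
      UniformFun.ofFun (f : unitInterval → ℝ × ℝ) :=
    ContinuousMap.isUniformEmbedding_uniformFunOfFun.uniformContinuous.continuous
  set μ : ℕ → ProbabilityMeasure C(unitInterval, ℝ × ℝ) := fun N =>
    ⟨(Q N).map (Y N), Measure.isProbabilityMeasure_map (hYm N).aemeasurable⟩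
  have hμ : ∀ N, (μ N : Measure C(unitInterval, ℝ × ℝ)) = (Q N).map (Y N) := fun N => rfl
  have htight : IsTightMeasureSet (Set.range fun N => (Q N).map (Y N)) := by
    have : ∀ N, IsFiniteMeasure ((Q N).map (Y N)) := fun N => inferInstance
    refine isTightMeasureSet_range_of_modulus _ (fun N => ?_) fun ε hε η hη => ?_
    · rw [ae_map_iff (hYm N).aemeasurable
        (isClosed_eq (continuous_eval_const 0) continuous_const).measurableSet]
      exact .of_forall (hY0 N)
    · obtain ⟨δ, hδ, N0, hN0⟩ := hmod ε hε η hη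
      refine ⟨δ, hδ, N0, fun N hN => ?_⟩
      rw [Measure.map_apply (hYm N) (isClosed_modulusSet δ ε).measurableSet.compl]
      refine le_trans (measure_mono ?_) (hN0 N hN)
      exact fun s hs h => hs h.1
  have hclose : ∀ ε : ℝ, 0 < ε → ∀ η : ℝ, 0 < η → ∃ N0, ∀ N ≥ N0,
      Q N {s | ¬ ∀ x, dist (X N s x) (Y N s x) ≤ ε} ≤ ENNReal.ofReal η := fun ε hε η hη => by
    obtain ⟨_, _, N0, hN0⟩ := hmod ε hε η hη
    refine ⟨N0, fun N hN => le_trans (measure_mono ?_) (hN0 N hN)⟩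
    exact fun s hs h => hs h.2
  have hmapc : ∀ (w : unitInterval →₀ ℝ × ℝ) N,
      ∫ f, pathChar w (UniformFun.ofFun f) ∂(μ N : Measure C(unitInterval, ℝ × ℝ))
        = ∫ s, pathChar w (UniformFun.ofFun (Y N s)) ∂(Q N) := fun w N =>
    integral_map (hYm N).aemeasurable
      ((pathChar w).continuous.comp hofFun).aestronglyMeasurable
  have hchar : ∀ w, Tendsto (fun N =>
      ∫ f, pathChar w (UniformFun.ofFun f) ∂(μ N : Measure C(unitInterval, ℝ × ℝ))) atTop
      (𝓝 (φ w)) := fun w => by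
    have h := (hφ w).sub (tendsto_integral_sub_of_close htight hclose (pathChar w))
    simp only [sub_sub_cancel, sub_zero] at h
    simpa only [hmapc] using h
  have hcompact : IsCompact (closure (Set.range μ)) := by
    refine isCompact_closure_of_isTightMeasureSet ?_
    have : {x | ∃ ν ∈ Set.range μ, (ν : Measure C(unitInterval, ℝ × ℝ)) = x}
        = Set.range fun N => (Q N).map (Y N) := by
      ext x
      simp [hμ]
    rwa [this]
  -- Prokhorov's theorem makes the laws relatively compact, and a limit along a free ultrafilter
  -- supplies the candidate. Its characteristic functions must be `φ`, and these determine the limit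
  -- of the whole sequence.
  obtain ⟨μ₀, -, hμ₀⟩ := hcompact.ultrafilter_le_nhds ((hyperfilter ℕ).map μ)
    (le_principal_iff.mpr (mem_map.mpr (univ_mem' fun N => subset_closure ⟨N, rfl⟩)))
  have hμ₀' : Tendsto μ (hyperfilter ℕ) (𝓝 μ₀) := hμ₀
  have hμ₀char : ∀ w, ∫ f, pathChar w (UniformFun.ofFun f) ∂(μ₀ : Measure C(unitInterval, ℝ × ℝ))
      = φ w := fun w => by
    rw [ProbabilityMeasure.tendsto_iff_forall_integral_rclike_tendsto ℂ] at hμ₀'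
    exact tendsto_nhds_unique (hμ₀' ((pathChar w).compContinuous ⟨_, hofFun⟩))
      ((hchar w).mono_left Nat.hyperfilter_le_atTop)
  have hlim : Tendsto μ atTop (𝓝 μ₀) := by
    refine tendsto_of_tight_of_pathChar htight fun w => ?_
    rw [hμ₀char w]
    exact hchar w
  refine ⟨μ₀, hμ₀char, fun F => ?_⟩
  have h1 := (ProbabilityMeasure.tendsto_iff_forall_integral_tendsto.mp hlim)
    (F.compContinuous ⟨_, hofFun⟩)
  have h2 : ∀ N, ∫ f, F (UniformFun.ofFun f) ∂(μ N : Measure C(unitInterval, ℝ × ℝ))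
      = ∫ s, F (UniformFun.ofFun (Y N s)) ∂(Q N) := fun N =>
    integral_map (hYm N).aemeasurable (F.continuous.comp hofFun).aestronglyMeasurable
  have h3 := (tendsto_integral_sub_of_close htight hclose F).add h1
  rw [zero_add] at h3
  refine h3.congr fun N => ?_
  have h4 : ∫ f, (F.compContinuous ⟨_, hofFun⟩) f ∂(μ N : Measure C(unitInterval, ℝ × ℝ))
      = ∫ s, F (UniformFun.ofFun (Y N s)) ∂(Q N) := h2 N
  rw [h4, sub_add_cancel]

end FunctionalLimit

end ZeroRange

namespace ZeroRange

/-! ### Identification of the Gaussian limit -/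

section Gaussian

variable (α ρ γ : ℝ)

/-- The (non-symmetrised) covariance kernel of the limit process. -/
noncomputable def limitKernel (x : unitInterval) (v : ℝ × ℝ) (y : unitInterval) (v' : ℝ × ℝ) : ℝ :=
  α * (v.1 * v'.1 * (min (x : ℝ) y - x * y)) + 2 * ρ * (v.1 * v'.2 * (min (x : ℝ) y - x * y))
    + v.2 * v'.2 * (γ * min (x : ℝ) y - ρ ^ 2 / α * (x * y))

/-- The bilinear form on finitely supported families induced by `limitKernel`. -/
noncomputable def limitForm (w w' : unitInterval →₀ ℝ × ℝ) : ℝ :=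
  w.sum fun x v => w'.sum fun y v' => limitKernel α ρ γ x v y v'

lemma limitVar_support (w : unitInterval →₀ ℝ × ℝ) :
    limitVar α ρ γ (fun x : w.support => (x : unitInterval)) (fun x => (w x).1) (fun x => (w x).2)
      = limitForm α ρ γ w w := by
  refine Eq.trans (Finset.sum_congr rfl fun x _ => ?_) (Finset.sum_coe_sort w.support
    fun x => ∑ y ∈ w.support, limitKernel α ρ γ x (w x) y (w y))
  exact Finset.sum_coe_sort w.support fun y => limitKernel α ρ γ x (w x) y (w y)

lemma limitForm_add_left (w₁ w₂ w' : unitInterval →₀ ℝ × ℝ) :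
    limitForm α ρ γ (w₁ + w₂) w' = limitForm α ρ γ w₁ w' + limitForm α ρ γ w₂ w' := by
  refine Finsupp.sum_add_index' (fun x => ?_) fun x v₁ v₂ => ?_
  · simp [limitKernel]
  · rw [← Finsupp.sum_add]
    refine Finsupp.sum_congr fun y _ => ?_
    simp only [limitKernel, Prod.fst_add, Prod.snd_add]
    ring

lemma limitForm_add_right (w w₁ w₂ : unitInterval →₀ ℝ × ℝ) :
    limitForm α ρ γ w (w₁ + w₂) = limitForm α ρ γ w w₁ + limitForm α ρ γ w w₂ := by
  rw [limitForm, limitForm, limitForm, ← Finsupp.sum_add]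
  refine Finsupp.sum_congr fun x _ => Finsupp.sum_add_index' (fun y => ?_) fun y v₁ v₂ => ?_
  · simp [limitKernel]
  · simp only [limitKernel, Prod.fst_add, Prod.snd_add]
    ring

lemma limitForm_smul (c : ℝ) (w : unitInterval →₀ ℝ × ℝ) :
    limitForm α ρ γ (c • w) (c • w) = c ^ 2 * limitForm α ρ γ w w := by
  rw [limitForm, Finsupp.sum_smul_index' fun x => by simp [limitKernel], limitForm, Finsupp.mul_sum]
  refine Finsupp.sum_congr fun x _ => ?_
  rw [Finsupp.sum_smul_index' fun x => by simp [limitKernel], Finsupp.mul_sum]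
  refine Finsupp.sum_congr fun y _ => ?_
  simp only [limitKernel, Prod.smul_fst, Prod.smul_snd, smul_eq_mul]
  ring

lemma limitForm_single (x : unitInterval) (v : ℝ × ℝ) (y : unitInterval) (v' : ℝ × ℝ) :
    limitForm α ρ γ (Finsupp.single x v) (Finsupp.single y v') = limitKernel α ρ γ x v y v' := by
  rw [limitForm, Finsupp.sum_single_index (by simp [limitKernel]),
    Finsupp.sum_single_index (by simp [limitKernel])]

lemma pathPairing_single (f : unitInterval → ℝ × ℝ) (x : unitInterval) (v : ℝ × ℝ) :
    pathPairing f (Finsupp.single x v) = v.1 * (f x).1 + v.2 * (f x).2 :=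
  Finsupp.sum_single_index (by simp)

variable {α ρ γ} [MeasurableSpace C(unitInterval, ℝ × ℝ)] [BorelSpace C(unitInterval, ℝ × ℝ)]

/-- A linear combination of the coordinates of a continuous path. -/
noncomputable def pathCoord (w : unitInterval →₀ ℝ × ℝ) (f : C(unitInterval, ℝ × ℝ)) : ℝ :=
  pathPairing f w

lemma measurable_pathCoord (w : unitInterval →₀ ℝ × ℝ) : Measurable (pathCoord w) :=
  (continuous_pathPairing_coe w).measurable

variable {μ : Measure C(unitInterval, ℝ × ℝ)} [IsProbabilityMeasure μ]

theorem map_pathCoord_eq_gaussianReal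
    (h : ∀ w, ∫ f, pathChar w (UniformFun.ofFun f) ∂μ
      = (Real.exp (-(limitForm α ρ γ w w / 2)) : ℂ)) (w : unitInterval →₀ ℝ × ℝ) :
    0 ≤ limitForm α ρ γ w w ∧
      μ.map (pathCoord w) = gaussianReal 0 (limitForm α ρ γ w w).toNNReal := by
  have hm := measurable_pathCoord w
  have : IsProbabilityMeasure (μ.map (pathCoord w)) :=
    Measure.isProbabilityMeasure_map hm.aemeasurable
  have hchar : ∀ t : ℝ, charFun (μ.map (pathCoord w)) t
      = (Real.exp (-(t ^ 2 * limitForm α ρ γ w w / 2)) : ℂ) := fun t => by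
    rw [charFun_apply_real, integral_map hm.aemeasurable (by fun_prop), ← limitForm_smul, ← h]
    refine integral_congr_ae (.of_forall fun f => ?_)
    have h1 : pathPairing f (t • w) = t * pathCoord w f := (pathPairingₗ f).map_smul t w
    change _ = Complex.exp (pathPairing f (t • w) * Complex.I)
    rw [h1]
    push_cast
    ring_nf
  -- Nonnegativity of the form comes from the modulus of a characteristic function being at most
  -- `1`, with no computation on the kernel.
  have h0 : 0 ≤ limitForm α ρ γ w w := by
    have h1 := norm_charFun_le_one (μ := μ.map (pathCoord w)) 1
    rw [hchar, Complex.norm_real, Real.norm_of_nonneg (Real.exp_pos _).le, Real.exp_le_one_iff] at h1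
    linarith
  refine ⟨h0, Measure.ext_of_charFun (funext fun t => ?_)⟩
  rw [hchar, charFun_gaussianReal, Real.coe_toNNReal _ h0]
  push_cast
  ring_nf

variable (h : ∀ w, ∫ f, pathChar w (UniformFun.ofFun f) ∂μ
  = (Real.exp (-(limitForm α ρ γ w w / 2)) : ℂ))

include h

lemma memLp_pathCoord (w : unitInterval →₀ ℝ × ℝ) :
    MemLp (pathCoord w) 2 μ := by
  have h1 := memLp_id_gaussianReal (μ := 0) (v := (limitForm α ρ γ w w).toNNReal) 2
  rw [← (map_pathCoord_eq_gaussianReal h w).2] at h1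
  exact (memLp_map_measure_iff (by fun_prop) (measurable_pathCoord w).aemeasurable).mp h1

lemma integral_pathCoord (w : unitInterval →₀ ℝ × ℝ) : ∫ f, pathCoord w f ∂μ = 0 := by
  have h1 := integral_map (measurable_pathCoord w).aemeasurable (μ := μ) (f := fun x : ℝ => x)
    (by fun_prop)
  rw [← h1, (map_pathCoord_eq_gaussianReal h w).2, integral_id_gaussianReal]

lemma variance_pathCoord (w : unitInterval →₀ ℝ × ℝ) :
    Var[pathCoord w; μ] = limitForm α ρ γ w w := by
  obtain ⟨h0, hmap⟩ := map_pathCoord_eq_gaussianReal h w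
  have h1 := variance_map (μ := μ) (X := id) (Y := pathCoord w) (by fun_prop)
    (measurable_pathCoord w).aemeasurable
  rw [hmap, variance_id_gaussianReal, Real.coe_toNNReal _ h0] at h1
  exact h1.symm

/-- Polarisation: only the quadratic form is known, so the covariance is its symmetrisation. This
turns the coefficient `2 ρ` of the kernel into `ρ`. -/
lemma covariance_pathCoord (w w' : unitInterval →₀ ℝ × ℝ) :
    cov[pathCoord w, pathCoord w'; μ]
      = (limitForm α ρ γ w w' + limitForm α ρ γ w' w) / 2 := by
  have h1 := variance_add (memLp_pathCoord h w) (memLp_pathCoord h w')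
  have h2 : pathCoord w + pathCoord w' = pathCoord (w + w') :=
    funext fun f => ((pathPairingₗ f).map_add w w').symm
  rw [h2, variance_pathCoord h, variance_pathCoord h, variance_pathCoord h,
    limitForm_add_left, limitForm_add_right, limitForm_add_right] at h1
  linarith

lemma isGaussianProcess_eval :
    IsGaussianProcess (fun x (f : C(unitInterval, ℝ × ℝ)) => ((f x).1, (f x).2)) μ := by
  classical
  refine ⟨fun I => ⟨isGaussian_of_map_eq_gaussianReal fun L => ?_⟩⟩
  -- Any linear functional of finitely many coordinates is a `pathCoord`, with coefficients read off
  -- on the basis vectors; its law is Gaussian, which suffices by Cramér-Wold.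
  set w : unitInterval →₀ ℝ × ℝ := ∑ i : I, Finsupp.single (i : unitInterval)
    (L (Pi.single i (1, 0)), L (Pi.single i (0, 1)))
  refine ⟨0, _, Eq.trans ?_ (map_pathCoord_eq_gaussianReal h w).2⟩
  have hm : Measurable fun f : C(unitInterval, ℝ × ℝ) =>
      I.restrict (fun x => ((f x).1, (f x).2)) :=
    measurable_pi_lambda _ fun i => (continuous_eval_const (i : unitInterval)).measurable
  rw [Measure.map_map L.continuous.measurable hm]
  refine congrArg (fun φ => μ.map φ) (funext fun f => ?_)
  have h1 : pathCoord w f = ∑ i : I, (L (Pi.single i (1, 0)) * (f i).1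
      + L (Pi.single i (0, 1)) * (f i).2) := by
    have h2 : pathCoord w f = pathPairingₗ f w := rfl
    rw [h2, map_sum]
    exact Finset.sum_congr rfl fun i _ => pathPairing_single f i _
  rw [h1, Function.comp]
  set g : I → ℝ × ℝ := I.restrict (fun x => ((f x).1, (f x).2))
  have h3 : g = ∑ i : I, ((f i).1 • (Pi.single i (1, 0) : I → ℝ × ℝ)
      + (f i).2 • (Pi.single i (0, 1) : I → ℝ × ℝ)) := by
    rw [← LinearMap.sum_single_apply _ g]
    refine Finset.sum_congr rfl fun i _ => ?_
    rw [← Pi.single_smul, ← Pi.single_smul, ← Pi.single_add]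
    congr 1
    simp [g]
  rw [h3, map_sum]
  refine Finset.sum_congr rfl fun i _ => ?_
  rw [map_add, map_smul, map_smul, smul_eq_mul, smul_eq_mul]
  ring

/-- The coordinates of a random path with these characteristic functions form a centred Gaussian
process with the covariance of the limit. -/
theorem gaussian_coordinates :
    (∀ x, ∫ f : C(unitInterval, ℝ × ℝ), (f x).1 ∂μ = 0) ∧
    (∀ x, ∫ f : C(unitInterval, ℝ × ℝ), (f x).2 ∂μ = 0) ∧
    (∀ s t : unitInterval, cov[fun f : C(unitInterval, ℝ × ℝ) => (f s).1, fun f => (f t).1; μ]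
      = α * (min (s : ℝ) t * (1 - max (s : ℝ) t))) ∧
    (∀ s t : unitInterval, cov[fun f : C(unitInterval, ℝ × ℝ) => (f s).2, fun f => (f t).2; μ]
      = γ * min (s : ℝ) t - ρ ^ 2 / α * ((s : ℝ) * t)) ∧
    (∀ s t : unitInterval, cov[fun f : C(unitInterval, ℝ × ℝ) => (f s).1, fun f => (f t).2; μ]
      = ρ * (min (s : ℝ) t * (1 - max (s : ℝ) t))) := by
  have e1 : ∀ (x : unitInterval), (fun f : C(unitInterval, ℝ × ℝ) => (f x).1)
      = pathCoord (Finsupp.single x (1, 0)) := fun x => by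
    ext f
    rw [pathCoord, pathPairing_single]
    ring
  have e2 : ∀ (x : unitInterval), (fun f : C(unitInterval, ℝ × ℝ) => (f x).2)
      = pathCoord (Finsupp.single x (0, 1)) := fun x => by
    ext f
    rw [pathCoord, pathPairing_single]
    ring
  have e3 : ∀ s t : ℝ, min s t * (1 - max s t) = min s t - s * t := fun s t => by
    rw [mul_sub, min_mul_max, mul_one]
  simp only [e1, e2, e3, integral_pathCoord h, covariance_pathCoord h, limitForm_single,
    limitKernel, implies_true, true_and]
  refine ⟨fun s t => ?_, fun s t => ?_, fun s t => ?_⟩ <;> rw [min_comm (t : ℝ) s] <;> ring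

end Gaussian

end ZeroRange

namespace ZeroRange

/-! ### The functional limit theorem for the height functions -/

section HeightLimit

variable {ν : Measure ℕ} [IsProbabilityMeasure ν]

lemma pathPairing_eq_sum (w : unitInterval →₀ ℝ × ℝ) (u v : unitInterval → ℝ) :
    pathPairing (fun x => (u x, v x)) w
      = ∑ x : w.support, ((w x).1 * u x + (w x).2 * v x) :=
  (Finset.sum_coe_sort w.support fun x => (w x).1 * u x + (w x).2 * v x).symm

theorem exists_height_limit (h0 : 0 < ν.real {0}) (h1 : 0 < ν.real {1}) {nbar : ℝ}
    (hnbar : 0 ≤ nbar) {t : ℕ → ℝ} {tbar : ℝ}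
    (hf : ∀ p : ℕ, Integrable (fun k : ℕ => |(k : ℝ) - nbar| ^ p) ν)
    (hg : ∀ p : ℕ, Integrable (fun k => |t k - tbar| ^ p) ν)
    (hf0 : ∫ k : ℕ, ((k : ℝ) - nbar) ∂ν = 0) (hg0 : ∫ k, (t k - tbar) ∂ν = 0)
    {α ρ γ : ℝ} (hα : ∫ k : ℕ, ((k : ℝ) - nbar) ^ 2 ∂ν = α)
    (hρ : ∫ k : ℕ, ((k : ℝ) - nbar) * (t k - tbar) ∂ν = ρ) (hγ : ∫ k, (t k - tbar) ^ 2 ∂ν = γ)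
    {Q : ∀ N : ℕ, Measure (Fin N → ℕ)} [∀ N, IsProbabilityMeasure (Q N)]
    (hQ : ∀ N, Q N = ProbabilityTheory.cond (Measure.pi fun _ => ν) (sumEq N ⌊(N : ℝ) * nbar⌋₊))
    [MeasurableSpace C(unitInterval, ℝ × ℝ)] [BorelSpace C(unitInterval, ℝ × ℝ)] :
    ∃ μ₀ : ProbabilityMeasure C(unitInterval, ℝ × ℝ),
      (∀ w, ∫ f, pathChar w (UniformFun.ofFun f) ∂(μ₀ : Measure C(unitInterval, ℝ × ℝ))
        = (Real.exp (-(limitForm α ρ γ w w / 2)) : ℂ)) ∧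
      ∀ F : (unitInterval →ᵤ ℝ × ℝ) →ᵇ ℝ,
        Tendsto (fun N => ∫ n, F (UniformFun.ofFun fun x =>
            (height (fun k => (k : ℝ)) nbar n x, height t tbar n x)) ∂(Q N)) atTop
          (𝓝 (∫ f, F (UniformFun.ofFun f) ∂(μ₀ : Measure C(unitInterval, ℝ × ℝ)))) := by
  refine exists_functional_limit
    (X := fun N n x => (height (fun k => (k : ℝ)) nbar n x, height t tbar n x))
    (Y := fun N n => (interpolation (fun k => (k : ℝ) - nbar) n).prodMk
      (interpolation (fun k => t k - tbar) n)) (fun N n => ?_) (fun ε hε η hη => ?_) fun w => ?_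
  · rw [ContinuousMap.prod_eval, interpolation_zero, interpolation_zero]
    rfl
  · obtain ⟨δ₁, hδ₁, N₁, hN₁⟩ := exists_measure_modulus_le h0 h1 hnbar hf hf0 hf hf0 hε (half_pos hη)
    obtain ⟨δ₂, hδ₂, N₂, hN₂⟩ := exists_measure_modulus_le h0 h1 hnbar hf hf0 hg hg0 hε (half_pos hη)
    refine ⟨min δ₁ δ₂, lt_min hδ₁ hδ₂, max N₁ N₂, fun N hN => ?_⟩
    have e1 := hN₁ N ((le_max_left _ _).trans hN)
    have e2 := hN₂ N ((le_max_right _ _).trans hN)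
    rw [← hQ] at e1 e2
    refine le_trans (measure_mono ?_) ((measure_union_le _ _).trans ((add_le_add e1 e2).trans_eq ?_))
    · intro n hn
      by_contra hcon
      simp only [Set.mem_union, Set.mem_ofPred_eq, not_or, not_not] at hcon
      obtain ⟨⟨a1, b1⟩, a2, b2⟩ := hcon
      refine hn ⟨fun x y hxy => ?_, fun x => ?_⟩
      · exact max_le (a1 x y (hxy.trans (min_le_left _ _))) (a2 x y (hxy.trans (min_le_right _ _)))
      · exact max_le (b1 x) (b2 x)
    · rw [← ENNReal.ofReal_add (half_pos hη).le (half_pos hη).le, add_halves]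
  · rw [← limitVar_support]
    refine (tendsto_integral_cond_height h0 h1 hnbar hf hg hf0 hg0 hα hρ hγ
      (fun x : w.support => (x : unitInterval)) (fun x => (w x).1) (fun x => (w x).2)).congr fun N => ?_
    rw [hQ]
    refine integral_congr_ae (.of_forall fun n => ?_)
    change _ = Complex.exp (pathPairing _ w * Complex.I)
    rw [UniformFun.toFun_ofFun, pathPairing_eq_sum]

end HeightLimit

/-! ### Uniform moment bounds -/

section MomentBounds

/-- The probabilistic estimates hold only for large `N`; the remaining finitely many measures have
finite support, so their integrals are finite. -/
lemma iSup_lt_top_of_eventually_le {F : ∀ N : ℕ, 1 ≤ N → ℝ≥0∞} (hfin : ∀ N hN, F N hN < ∞) {C : ℝ≥0∞}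
    (hC : C < ∞) {N0 : ℕ} (hle : ∀ N ≥ N0, ∀ hN, F N hN ≤ C) : ⨆ (N) (hN), F N hN < ∞ := by
  have h1 : ∀ N, ⨆ hN, F N hN < ∞ := fun N => by
    by_cases hN : 1 ≤ N
    · rw [iSup_pos hN]
      exact hfin N hN
    · simp [iSup_neg hN]
  refine lt_of_le_of_lt (b := (∑ N ∈ Finset.range N0, ⨆ hN, F N hN) + C) (iSup_le fun N => ?_)
    (ENNReal.add_lt_top.mpr ⟨ENNReal.sum_lt_top.mpr fun N _ => h1 N, hC⟩)
  rcases Nat.lt_or_ge N N0 with hN | hN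
  · exact le_add_right (Finset.single_le_sum (f := fun N => ⨆ hN, F N hN) (fun _ _ => zero_le)
      (Finset.mem_range.mpr hN))
  · exact le_add_left (iSup_le (hle N hN))

lemma lintegral_invMeasure_lt_top (τ : ℕ → ℝ) (nbar : ℝ) (N : ℕ) {φ : (Fin N → ℕ) → ℝ≥0∞}
    (hφ : ∀ n, φ n < ∞) : ∫⁻ n, φ n ∂(invMeasure τ nbar N) < ∞ := by
  rw [invMeasure, lintegral_finsetSum_measure]
  refine ENNReal.sum_lt_top.mpr fun n _ => ?_
  rw [lintegral_smul_measure, lintegral_dirac, smul_eq_mul]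
  exact ENNReal.mul_lt_top ENNReal.ofReal_lt_top (hφ n)

lemma maxIncr_lt_top {Ω : Type*} (S : ℕ → Ω → ℝ) (a l : ℕ) (ω : Ω) : maxIncr S a l ω < ∞ :=
  (Finset.sup_lt_iff ENNReal.zero_lt_top).mpr fun _ _ => enorm_lt_top

lemma rpow_le_one_add_pow {r p : ℝ} {m : ℕ} (hr : 0 ≤ r) (hp : 0 ≤ p) (hpm : p ≤ m) :
    r ^ p ≤ 1 + r ^ m := by
  rcases le_total r 1 with h | h
  · exact (Real.rpow_le_one hr h hp).trans (le_add_of_nonneg_right (pow_nonneg hr m))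
  · refine le_trans ?_ (le_add_of_nonneg_left zero_le_one)
    rw [← Real.rpow_natCast]
    exact Real.rpow_le_rpow_of_exponent_le h hpm

lemma iSup_rpow_height_le (f : ℕ → ℝ) (c : ℝ) {N : ℕ} (n : Fin N → ℕ) {p : ℝ} {q : ℕ} (hp : 0 ≤ p)
    (hpq : p ≤ (2 * q : ℕ)) :
    ⨆ x : unitInterval, ENNReal.ofReal (|height f c n x| ^ p)
      ≤ 1 + ENNReal.ofReal (((√N)⁻¹) ^ (2 * q))
        * maxIncr (partialSum (fun k => f k - c) N) 0 N n ^ (2 * q) := by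
  refine iSup_le fun x => ?_
  refine (ENNReal.ofReal_le_ofReal (rpow_le_one_add_pow (abs_nonneg _) hp hpq)).trans ?_
  rw [ENNReal.ofReal_add zero_le_one (by positivity), ENNReal.ofReal_one]
  refine add_le_add le_rfl ?_
  have hs : 0 ≤ (√(N : ℝ))⁻¹ := by positivity
  rw [ENNReal.ofReal_pow (abs_nonneg _), ENNReal.ofReal_pow hs, ← mul_pow,
    height_eq_partialSum, abs_mul, abs_of_nonneg hs, ENNReal.ofReal_mul hs, ← Real.enorm_eq_ofReal_abs]
  have h := enorm_sub_le_maxIncr (partialSum (fun k => f k - c) N) (a := 0) (floor_mul_le x N) n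
  have hz : partialSum (fun k => f k - c) N 0 n = 0 := by simp [partialSum]
  rw [hz, sub_zero, zero_add] at h
  gcongr

variable {τ : ℕ → ℝ} {nbar : ℝ} {ν : Measure ℕ} [IsProbabilityMeasure ν]

theorem iSup_lintegral_height_lt_top (h0 : 0 < ν.real {0}) (h1 : 0 < ν.real {1})
    (hnbar : 0 ≤ nbar) (hf : ∀ p : ℕ, Integrable (fun k : ℕ => |(k : ℝ) - nbar| ^ p) ν)
    (hf0 : ∫ k : ℕ, ((k : ℝ) - nbar) ∂ν = 0) {t : ℕ → ℝ} {c : ℝ}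
    (hg : ∀ p : ℕ, Integrable (fun k => |t k - c| ^ p) ν) (hg0 : ∫ k, (t k - c) ∂ν = 0)
    (hQ : ∀ N, invMeasure τ nbar N
      = ProbabilityTheory.cond (Measure.pi fun _ => ν) (sumEq N ⌊(N : ℝ) * nbar⌋₊))
    [∀ N, IsProbabilityMeasure (invMeasure τ nbar N)] {p : ℝ} (hp : 0 ≤ p) :
    ⨆ (N : ℕ) (_ : 1 ≤ N), ∫⁻ n, ⨆ x : unitInterval,
      ENNReal.ofReal (|height t c n x| ^ p) ∂(invMeasure τ nbar N) < ∞ := by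
  obtain ⟨m, hm⟩ := exists_nat_ge p
  -- `2 q ≥ p` dominates the required moment, and `q ≥ 2` is needed for the maximal inequality.
  set q := max m 2
  have hpq : p ≤ (2 * q : ℕ) := hm.trans (by exact_mod_cast (le_max_left m 2).trans (by omega))
  obtain ⟨K, hK, N0, hmax⟩ := exists_lintegral_cond_maxIncr_le h0 h1 hnbar hf hf0 hg hg0 q
    (le_max_right _ _)
  refine iSup_lt_top_of_eventually_le (N0 := N0) (C := 1 + ENNReal.ofReal K) (fun N _ => ?_)
    (ENNReal.add_lt_top.mpr ⟨ENNReal.one_lt_top, ENNReal.ofReal_lt_top⟩) fun N hN hN1 => ?_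
  · refine lintegral_invMeasure_lt_top τ nbar N fun n => (iSup_rpow_height_le t c n hp hpq).trans_lt ?_
    exact ENNReal.add_lt_top.mpr ⟨ENNReal.one_lt_top,
      ENNReal.mul_lt_top ENNReal.ofReal_lt_top (ENNReal.pow_lt_top (maxIncr_lt_top _ _ _ _))⟩
  · refine (lintegral_mono fun n => iSup_rpow_height_le t c n hp hpq).trans ?_
    rw [lintegral_add_left measurable_const, lintegral_const, measure_univ, mul_one,
      lintegral_const_mul _ (measurable_of_countable _)]
    refine add_le_add le_rfl ?_
    have hNr : (0 : ℝ) < N := by exact_mod_cast hN1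
    have h2 := hmax N hN N 0 (by omega)
    rw [← hQ] at h2
    refine (mul_le_mul_right h2 _).trans_eq ?_
    rw [← ENNReal.ofReal_mul (by positivity), pow_mul, inv_pow, Real.sq_sqrt hNr.le]
    rw [mul_comm K, ← mul_assoc, ← mul_pow, inv_mul_cancel₀ hNr.ne', one_pow, one_mul]

/-- A single site leaves at least a quarter of all sites once `N ≥ 2`, so its conditioned law is
dominated by a constant multiple of `ν`. -/
theorem iSup_lintegral_site_lt_top (h0 : 0 < ν.real {0}) (h1 : 0 < ν.real {1})
    (hnbar : 0 ≤ nbar) (hf : ∀ p : ℕ, Integrable (fun k : ℕ => |(k : ℝ) - nbar| ^ p) ν)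
    (hf0 : ∫ k : ℕ, ((k : ℝ) - nbar) ∂ν = 0)
    (hQ : ∀ N, invMeasure τ nbar N
      = ProbabilityTheory.cond (Measure.pi fun _ => ν) (sumEq N ⌊(N : ℝ) * nbar⌋₊))
    {φ : ℕ → ℝ≥0∞} (hφ : ∀ k, φ k < ∞) (hφν : ∫⁻ k, φ k ∂ν < ∞) :
    ⨆ (N : ℕ) (hN : 1 ≤ N), ∫⁻ n, φ (n ⟨0, hN⟩) ∂(invMeasure τ nbar N) < ∞ := by
  obtain ⟨C, _, N0, hC⟩ := exists_lintegral_cond_le h0 h1 hnbar hf hf0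
  refine iSup_lt_top_of_eventually_le (N0 := max N0 2) (C := ENNReal.ofReal C * ∫⁻ k, φ k ∂ν)
    (fun N hN => lintegral_invMeasure_lt_top τ nbar N fun n => hφ _)
    (ENNReal.mul_lt_top ENNReal.ofReal_lt_top hφν) fun N hN hN1 => ?_
  have hN2 : 2 ≤ N := (le_max_right _ _).trans hN
  have h2 := hC N ((le_max_left _ _).trans hN) {⟨0, hN1⟩} (by
    rw [Finset.card_compl, Finset.card_singleton, Fintype.card_fin]
    omega) fun y => φ (y ⟨⟨0, hN1⟩, Finset.mem_singleton_self _⟩)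
  rw [← hQ] at h2
  refine h2.trans_eq ?_
  rw [(measurePreserving_eval (fun _ : Fin N => ν) ⟨0, hN1⟩).lintegral_comp
    (measurable_of_countable φ)]

end MomentBounds

end ZeroRange

/-! ### Application to the one-site law at `a = Phi τ nbar` -/

theorem mainTheorem8
    (τ : ℕ → ℝ) (hτ_zero : τ 0 = 0) (hτ_mono : Monotone τ) (hτ_pos : ∀ k, 1 ≤ k → 0 < τ k)
    (hτ_poly : ∃ (C : ℝ) (d : ℕ), ∀ k : ℕ, τ k ≤ C * (1 + (k : ℝ)) ^ d)
    (nbar : ℝ) (hnbar_pos : 0 < nbar) (hnbar_lt : ENNReal.ofReal nbar < ZeroRange.RStar τ) :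
    (∃ (Ω : Type) (_ : MeasurableSpace Ω) (P : Measure Ω) (_ : IsProbabilityMeasure P)
        (β ζ : unitInterval → Ω → ℝ),
      IsGaussianProcess (fun x ω => (β x ω, ζ x ω)) P ∧
      (∀ ω, Continuous (fun x => (β x ω, ζ x ω))) ∧
      (∀ x, ∫ ω, β x ω ∂P = 0) ∧ (∀ x, ∫ ω, ζ x ω ∂P = 0) ∧
      (∀ s t : unitInterval, covariance (β s) (β t) P
        = ZeroRange.alpha τ nbar * (min (s : ℝ) t * (1 - max (s : ℝ) t))) ∧
      (∀ s t : unitInterval, covariance (ζ s) (ζ t) P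
        = ZeroRange.gam τ nbar * min (s : ℝ) t
          - ZeroRange.rho τ nbar ^ 2 / ZeroRange.alpha τ nbar * ((s : ℝ) * t)) ∧
      (∀ s t : unitInterval, covariance (β s) (ζ t) P
        = ZeroRange.rho τ nbar * (min (s : ℝ) t * (1 - max (s : ℝ) t))) ∧
      ZeroRange.ConvergesInLaw (fun N => ZeroRange.invMeasure τ nbar N)
        (fun _ n x => (ZeroRange.uN nbar n x, ZeroRange.qN τ nbar n x))
        P (fun ω x => (β x ω, ζ x ω))) ∧
    (∀ p : ℝ, 1 ≤ p →
      (⨆ (N : ℕ) (_ : 1 ≤ N), ∫⁻ n, ⨆ x : unitInterval,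
          ENNReal.ofReal (|ZeroRange.uN nbar n x| ^ p) ∂(ZeroRange.invMeasure τ nbar N)) < ∞ ∧
      (⨆ (N : ℕ) (_ : 1 ≤ N), ∫⁻ n, ⨆ x : unitInterval,
          ENNReal.ofReal (|ZeroRange.qN τ nbar n x| ^ p) ∂(ZeroRange.invMeasure τ nbar N)) < ∞ ∧
      (⨆ (N : ℕ) (hN : 1 ≤ N), ∫⁻ n, ENNReal.ofReal (τ (n ⟨0, hN⟩) ^ p)
          ∂(ZeroRange.invMeasure τ nbar N)) < ∞) := by
  have ha := ZeroRange.Phi_mem hτ_pos hnbar_pos hnbar_lt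
  have hR := ZeroRange.R_Phi hτ_pos hnbar_pos hnbar_lt
  have hτ_nonneg : ∀ k, 0 ≤ τ k := fun k => hτ_zero ▸ hτ_mono (Nat.zero_le k)
  obtain ⟨C, d, hCd⟩ := hτ_poly
  have hτ_abs : ∀ k : ℕ, |τ k| ≤ C * (1 + (k : ℝ)) ^ d := fun k => by
    rw [abs_of_nonneg (hτ_nonneg k)]
    exact hCd k
  have hid_abs : ∀ k : ℕ, |(k : ℝ)| ≤ 1 * (1 + (k : ℝ)) ^ 1 := fun k => by
    rw [Nat.abs_cast]
    linarith
  have hν := ZeroRange.isProbabilityMeasure_nuMeasure hτ_pos ha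
  have hinv := ZeroRange.isProbabilityMeasure_invMeasure hτ_pos ha nbar
  have hQ := ZeroRange.invMeasure_eq_cond hτ_pos ha nbar
  have hmean := ZeroRange.integral_nuMeasure hτ_pos ha
  have hsite : ∀ k, 0 < (ZeroRange.nuMeasure τ (ZeroRange.Phi τ nbar)).real {k} := fun k => by
    rw [ZeroRange.nuMeasure_real_singleton hτ_pos ha]
    exact ZeroRange.nu_pos hτ_pos ha k
  have hf := ZeroRange.integrable_pow_sub_nuMeasure hτ_pos ha hid_abs nbar
  have hg := ZeroRange.integrable_pow_sub_nuMeasure hτ_pos ha hτ_abs (ZeroRange.tauBar τ nbar)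
  have hf0 : ∫ k : ℕ, ((k : ℝ) - nbar) ∂(ZeroRange.nuMeasure τ (ZeroRange.Phi τ nbar)) = 0 := by
    rw [integral_sub (ZeroRange.integrable_nuMeasure_of_le_pow hτ_pos ha 1 1 hid_abs)
      (integrable_const _), hmean, integral_const, probReal_univ, one_smul]
    exact sub_eq_zero.mpr hR
  have hg0 : ∫ k, (τ k - ZeroRange.tauBar τ nbar)
      ∂(ZeroRange.nuMeasure τ (ZeroRange.Phi τ nbar)) = 0 := by
    rw [integral_sub (ZeroRange.integrable_nuMeasure_of_le_pow hτ_pos ha C d hτ_abs)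
      (integrable_const _), hmean, integral_const, probReal_univ, one_smul]
    exact sub_self _
  constructor
  · borelize C(unitInterval, ℝ × ℝ)
    obtain ⟨μ₀, hchar, hlim⟩ := ZeroRange.exists_height_limit (hsite 0) (hsite 1) hnbar_pos.le hf hg
      hf0 hg0 (hmean _) (hmean _) (hmean _) hQ
    obtain ⟨hβ, hζ, hββ, hζζ, hβζ⟩ := ZeroRange.gaussian_coordinates hchar
    -- The probability space is the space of continuous paths with the limit law, and `β`, `ζ` are
    -- its coordinate processes, so every sample path is continuous.
    exact ⟨C(unitInterval, ℝ × ℝ), inferInstance, μ₀, inferInstance, fun x f => (f x).1,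
      fun x f => (f x).2, ZeroRange.isGaussianProcess_eval hchar, fun f => f.continuous, hβ, hζ, hββ,
      hζζ, hβζ, hlim⟩
  · intro p hp
    have hp0 : 0 ≤ p := zero_le_one.trans hp
    refine ⟨ZeroRange.iSup_lintegral_height_lt_top (hsite 0) (hsite 1) hnbar_pos.le hf hf0 hf hf0 hQ hp0,
      ZeroRange.iSup_lintegral_height_lt_top (hsite 0) (hsite 1) hnbar_pos.le hf hf0 hg hg0 hQ hp0,
      ZeroRange.iSup_lintegral_site_lt_top (hsite 0) (hsite 1) hnbar_pos.le hf hf0 hQ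
        (φ := fun k => ENNReal.ofReal (τ k ^ p)) (fun _ => ENNReal.ofReal_lt_top) ?_⟩
    -- The real power is dominated by one plus a natural power, which is integrable by polynomial
    -- growth of `τ`.
    obtain ⟨m, hm⟩ := exists_nat_ge p
    have hτm := ZeroRange.integrable_pow_sub_nuMeasure hτ_pos ha hτ_abs 0 m
    simp only [sub_zero] at hτm
    refine (((integrable_const (1 : ℝ)).add hτm).mono' (measurable_of_countable _).aestronglyMeasurable
      (.of_forall fun k => ?_)).lintegral_lt_top
    rw [Real.norm_of_nonneg (Real.rpow_nonneg (hτ_nonneg k) p), Pi.add_apply,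
      abs_of_nonneg (hτ_nonneg k)]
    exact ZeroRange.rpow_le_one_add_pow (hτ_nonneg k) hp0 hm
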